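/- **Setting.** Let $G$ be a compact Lie group with normalized Haar measure and Lie algebra $\mathfrak g$, equipped with a faithful smooth unitary representation $G\to U(N)$. Let $E\neq 0$ be a finite-dimensional Hilbert space with a unital $*$-representation of $\mathrm{Mat}_N(\mathbb C)$. Fix an invariant metric on $\mathfrak g$, an orthonormal basis $e_1,\dots,e_q$ of $\mathfrak g$, and a cyclic $*$-representation $S$ of the Clifford algebra $\mathbb C\mathrm l(\mathfrak g)$ (relation $xy+yx=2\langle x,y\rangle$, elements of $\mathfrak g$ self-adjoint) with unit cyclic vector $\mathbb I$. Assume that $S$ is $\mathbb Z/2$-graded by a self-adjoint involution for which the elements of $\mathfrak g$ act as odd operators. By the graded tensor product rule, $\mathbb C\mathrm l(\mathfrak g^n)$ then acts on $S^{\otimes n}$. **The triple of a graph.** For a directed graph $\Gamma$, let $\mathcal G(\Gamma)$ be its free groupoid and $\mathcal A_\Gamma=\mathrm{Hom}(\mathcal G(\Gamma),G)$. Let $\mathfrak F=(\gamma_1,\dots,\gamma_n)$ be a finite free generating set of $\mathcal G(\Gamma)$: for every group $X$, each map $\mathfrak F\to X$ extends uniquely to a groupoid homomorphism $\mathcal G(\Gamma)\to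 X$. Then $\mathcal A_\Gamma\cong G^n$ via $\nabla\mapsto(\nabla(\gamma_k))_k$. Put $$E\otimes\mathcal H_{\mathfrak F}=L^2(G^n,\,E\otimes S^{\otimes n}),$$ and let $\mathcal D_{\mathfrak F}$ be the closure of $$\frac1{\sqrt{-1}}\sum_{k=1}^n\sum_{i=1}^q e_i^{(k)}\otimes e_i^{(k)}$$ on smooth functions, where the first factor is the left-invariant derivative in the $k$-th variable and the second is the Clifford action of the $k$-th copy of $\mathfrak g$. Fix a vertex $\nu$. Let $\mathcal B_\Gamma$ be the $*$-algebra of matrix-valued functions on $\mathcal A_\Gamma$ spanned by the holonomies $h_\gamma(\nabla)=\nabla(\gamma)$ for loops $\gamma\in\mathcal G(\Gamma)$ at $\nu$. It acts on $E\otimes\mathcal H_{\mathfrak F}$ by pointwise multiplication on the factor $E$. **Morphisms.** A refinement $\Gamma<\Gamma'$ is a graph morphism $\Gamma\to\mathcal G(\Gamma')$ that takes each edge to a product of edges of $\Gamma'$ and whose induced groupoid homomorphism $\mathcal G(\Gamma)\to\mathcal G(\Gamma')$ is injective. Suppose that it takes the base vertex of $\Gamma$ to that of $\Gamma'$, and that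 the generating sets are nested: $\mathfrak F'=(\gamma'_1,\dots,\gamma'_m)$ with $m\ge n$, where $\gamma'_k$ is the image of $\gamma_k$ for $k\le n$. Define: - $\iota:E\otimes\mathcal H_{\mathfrak F}\to E\otimes\mathcal H_{\mathfrak F'}$ extends functions by constants in the last $m-n$ variables and tensors the values with $\mathbb I^{\otimes(m-n)}$; - $P(a)=\iota a\iota^*$ for $a\in B(E\otimes\mathcal H_{\mathfrak F})$; - $Q:\mathcal B_\Gamma\to\mathcal B_{\Gamma'}$ is pullback along the restriction $\mathcal A_{\Gamma'}\to\mathcal A_\Gamma$, so that it takes $h_\gamma$ to $h$ of the image of $\gamma$. **Definitions.** A spectral triple $(\mathcal B,B(\mathcal H),\mathcal D)$ consists of a separable Hilbert space $\mathcal H$, a $*$-algebra $\mathcal B$ faithfully represented on $\mathcal H$, and a densely defined self-adjoint operator $\mathcal D$ on $\mathcal H$, such that every $b\in\mathcal B$ preserves $\mathrm{Dom}(\mathcal D)$, each $[\mathcal D,b]$ extends to a bounded operator, and $(1+\mathcal D^2)^{-1/2}$ is compact. A morphism $(Q,P,\iota)$ from $(\mathcal B,B(\mathcal H),\mathcal D)$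 to $(\mathcal B',B(\mathcal H'),\mathcal D')$ consists of $*$-homomorphisms $Q:\mathcal B\to\mathcal B'$ and $P:B(\mathcal H)\to B(\mathcal H')$ and a linear isometry $\iota:\mathcal H\to\mathcal H'$ with $\iota(\mathrm{Dom}\,\mathcal D)\subset\mathrm{Dom}\,\mathcal D'$, $\mathcal D'\iota=\iota\mathcal D$ on $\mathrm{Dom}\,\mathcal D$, $P(a)\iota=\iota a$ for all $a\in B(\mathcal H)$, and $Q(b)\iota=\iota b$ for all $b\in\mathcal B$. **Proposition.** 1. For every refinement $\Gamma<\Gamma'$ with nested generating sets as above, $(\mathcal B_\Gamma,B(E\otimes\mathcal H_{\mathfrak F}),\mathcal D_{\mathfrak F})$ and $(\mathcal B_{\Gamma'},B(E\otimes\mathcal H_{\mathfrak F'}),\mathcal D_{\mathfrak F'})$ are spectral triples, and $(Q,P,\iota)$ is a morphism from the first to the second. 2. Let $(\Gamma_j)_{j\in\mathbb N}$ be directed graphs with base vertices $\nu_j$ and refinements $\Gamma_i<\Gamma_j$ for $i\le j$ that preserve the base vertices and are compatible with composition (the one for $i=j$ inducing the identity of $\mathcal G(\Gamma_i)$), and let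 $\mathfrak F_j$ be finite free generating sets of $\mathcal G(\Gamma_j)$, nested as above for all $i\le j$. Then the spectral triples $(\mathcal B_{\Gamma_j},B(E\otimes\mathcal H_{\mathfrak F_j}),\mathcal D_{\mathfrak F_j})$ with the morphisms $(Q_{ij},P_{ij},\iota_{ij})_{i\le j}$ form an inductive system of spectral triples: $(Q_{ii},P_{ii},\iota_{ii})$ is the identity and $(Q_{jk},P_{jk},\iota_{jk})\circ(Q_{ij},P_{ij},\iota_{ij})=(Q_{ik},P_{ik},\iota_{ik})$ for all $i\le j\le k$. -/

import Mathlib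

open scoped Manifold ContDiff TensorProduct
open CategoryTheory MeasureTheory

universe u v u' v' w uM uS uE

noncomputable section
namespace GraphTriple

/-! ### Spectral triples, their morphisms, and inductive systems -/

/-- `(A, B(H), D)` is an (odd) spectral triple: the `*`-algebra `A` is represented faithfully on the
separable Hilbert space `H` through `π` (so that it is a `*`-subalgebra of `B(H)`), `D` is a densely
defined self-adjoint operator, every commutator `[D, a]` extends to a bounded operator, and
`T = (1 + D²)^(-1/2)` is compact; the last clause says that `T` is the positive operator
whose square is the inverse of `1 + D²`. -/
structure IsSpectralTriple {A H : Type*} [Ring A] [StarRing A] [Algebra ℂ A]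
    [NormedAddCommGroup H] [InnerProductSpace ℂ H] [CompleteSpace H]
    (π : A →⋆ₐ[ℂ] (H →L[ℂ] H)) (D : H →ₗ.[ℂ] H) : Prop where
  separable : TopologicalSpace.SeparableSpace H
  faithful : Function.Injective π
  dense_domain : Dense (D.domain : Set H)
  selfAdjoint : IsSelfAdjoint D
  bounded_commutator : ∀ a : A, ∃ C : H →L[ℂ] H, ∀ η : D.domain,
    ∃ h : π a η ∈ D.domain, D ⟨π a η, h⟩ - π a (D η) = C η
  compact_resolvent : ∃ T : H →L[ℂ] H, T.IsPositive ∧ IsCompactOperator T ∧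
    ∀ x : H, ∃ y z : D.domain, (y : H) = T (T x) ∧ (z : H) = D y ∧ (y : H) + D z = x

/-- `(Q, P, ι)` is a morphism of (odd) spectral triples from `(A, B(H), D)` to `(A', B(H'), D')`:
`ι` is an inner product preserving linear map that carries the domain of `D` into that of `D'` and
intertwines `D` and `D'`, and it intertwines `a` and `P a`, and `b` and `Q b`. -/
structure IsTripleMorphism {A A' H H' : Type*} [Ring A] [StarRing A] [Algebra ℂ A]
    [Ring A'] [StarRing A'] [Algebra ℂ A']
    [NormedAddCommGroup H] [InnerProductSpace ℂ H] [CompleteSpace H]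
    [NormedAddCommGroup H'] [InnerProductSpace ℂ H'] [CompleteSpace H']
    (π : A →⋆ₐ[ℂ] (H →L[ℂ] H)) (D : H →ₗ.[ℂ] H)
    (π' : A' →⋆ₐ[ℂ] (H' →L[ℂ] H')) (D' : H' →ₗ.[ℂ] H')
    (Q : A →⋆ₐ[ℂ] A') (P : (H →L[ℂ] H) →⋆ₙₐ[ℂ] (H' →L[ℂ] H')) (ι : H →ₗᵢ[ℂ] H') : Prop where
  dirac : ∀ η : D.domain, ∃ h : ι η ∈ D'.domain, D' ⟨ι η, h⟩ = ι (D η)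
  operators : ∀ (a : H →L[ℂ] H) (η : H), P a (ι η) = ι (a η)
  algebra : ∀ (b : A) (η : H), π' (Q b) (ι η) = ι (π b η)

/-- An inductive system of spectral triples over a directed set: a family of spectral triples with
a morphism from the `i`-th to the `j`-th one for all `i ≤ j`, compatible with composition. -/
structure IsInductiveSystem {I : Type*} [Preorder I] [IsDirectedOrder I] [Nonempty I]
    {A H : I → Type*} [∀ i, Ring (A i)] [∀ i, StarRing (A i)] [∀ i, Algebra ℂ (A i)]
    [∀ i, NormedAddCommGroup (H i)] [∀ i, InnerProductSpace ℂ (H i)] [∀ i, CompleteSpace (H i)]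
    (π : ∀ i, A i →⋆ₐ[ℂ] (H i →L[ℂ] H i)) (D : ∀ i, H i →ₗ.[ℂ] H i)
    (Q : ∀ i j, i ≤ j → A i →⋆ₐ[ℂ] A j)
    (P : ∀ i j, i ≤ j → (H i →L[ℂ] H i) →⋆ₙₐ[ℂ] (H j →L[ℂ] H j))
    (ι : ∀ i j, i ≤ j → H i →ₗᵢ[ℂ] H j) : Prop where
  triple : ∀ i, IsSpectralTriple (π i) (D i)
  morphism : ∀ i j (h : i ≤ j),
    IsTripleMorphism (π i) (D i) (π j) (D j) (Q i j h) (P i j h) (ι i j h)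
  algebra_refl : ∀ i, Q i i le_rfl = StarAlgHom.id ℂ (A i)
  operators_refl : ∀ i, P i i le_rfl = NonUnitalStarAlgHom.id ℂ (H i →L[ℂ] H i)
  isometry_refl : ∀ i, ι i i le_rfl = LinearIsometry.id
  algebra_comp : ∀ i j k (hij : i ≤ j) (hjk : j ≤ k),
    (Q j k hjk).comp (Q i j hij) = Q i k (hij.trans hjk)
  operators_comp : ∀ i j k (hij : i ≤ j) (hjk : j ≤ k),
    (P j k hjk).comp (P i j hij) = P i k (hij.trans hjk)
  isometry_comp : ∀ i j k (hij : i ≤ j) (hjk : j ≤ k),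
    (ι j k hjk).comp (ι i j hij) = ι i k (hij.trans hjk)

/-- The `*`-homomorphism `B(H) → B(H')`, `a ↦ ι a ι*`, induced by an isometry `ι`: the operators on
`H` become block matrices on `H' = ι(H) ⊕ ι(H)ᗮ`. -/
def conjIsometry {H H' : Type*}
    [NormedAddCommGroup H] [InnerProductSpace ℂ H] [CompleteSpace H]
    [NormedAddCommGroup H'] [InnerProductSpace ℂ H'] [CompleteSpace H']
    (ι : H →ₗᵢ[ℂ] H') : (H →L[ℂ] H) →⋆ₙₐ[ℂ] (H' →L[ℂ] H') where
  toFun a := ι.toContinuousLinearMap ∘L a ∘L ContinuousLinearMap.adjoint ι.toContinuousLinearMap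
  map_smul' c a := by ext; simp
  map_zero' := by ext; simp
  map_add' a b := by ext; simp
  map_mul' a b := by
    have h : ∀ x : H, ContinuousLinearMap.adjoint ι.toContinuousLinearMap (ι x) = x := by
      intro x
      have := ContinuousLinearMap.ext_iff.1
        ((ContinuousLinearMap.norm_map_iff_adjoint_comp_self ι.toContinuousLinearMap).1
          (fun x => ι.norm_map x)) x
      exact this
    ext x; simp [h]
  map_star' a := by
    simp [ContinuousLinearMap.star_eq_adjoint, ContinuousLinearMap.adjoint_comp,
      ContinuousLinearMap.comp_assoc]

/-! ### Tensor powers of a finite-dimensional Hilbert space -/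

section Spin

/-- The tensor power `S ⊗ ⋯ ⊗ S` (`n` factors); below it becomes a Hilbert space with
`⟪s₁ ⊗ ⋯ ⊗ sₙ, t₁ ⊗ ⋯ ⊗ tₙ⟫ = ∏ ⟪sᵢ, tᵢ⟫`, see `SpinTensor.inner_tprod`. -/
def SpinTensor (S : Type*) [NormedAddCommGroup S] [InnerProductSpace ℂ S] (n : ℕ) : Type _ :=
  PiTensorProduct ℂ (fun _ : Fin n => S)

namespace SpinTensor
variable {S : Type*} [NormedAddCommGroup S] [InnerProductSpace ℂ S] {n : ℕ}

instance : AddCommGroup (SpinTensor S n) :=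
  inferInstanceAs (AddCommGroup (PiTensorProduct ℂ (fun _ : Fin n => S)))
instance : Module ℂ (SpinTensor S n) :=
  inferInstanceAs (Module ℂ (PiTensorProduct ℂ (fun _ : Fin n => S)))

/-- The pure tensor `s₁ ⊗ ⋯ ⊗ sₙ`. -/
def tprod (s : Fin n → S) : SpinTensor S n := PiTensorProduct.tprod ℂ s

theorem induction {p : SpinTensor S n → Prop} (x : SpinTensor S n)
    (ht : ∀ s, p (tprod s)) (hs : ∀ (c : ℂ) x, p x → p (c • x))
    (ha : ∀ x y, p x → p y → p (x + y)) : p x := by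
  refine PiTensorProduct.induction_on (motive := p) x (fun c s => hs c _ (ht s)) ha

/-- The tensor product `f₁ ⊗ ⋯ ⊗ fₙ` of operators on `S`. -/
def map (f : Fin n → Module.End ℂ S) : Module.End ℂ (SpinTensor S n) :=
  PiTensorProduct.map f

theorem map_tprod (f : Fin n → Module.End ℂ S) (s : Fin n → S) :
    map f (tprod s) = tprod fun i => f i (s i) := PiTensorProduct.map_tprod _ _

theorem pad_update {n m : ℕ} (h : n ≤ m) (v : S) (s : Fin n → S) (k : Fin n) (x : S) :
    (fun i : Fin m => if hi : (i : ℕ) < n then Function.update s k x ⟨i, hi⟩ else v) =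
      Function.update (fun i : Fin m => if hi : (i : ℕ) < n then s ⟨i, hi⟩ else v)
        (Fin.castLE h k) x := by
  funext i
  by_cases hik : i = Fin.castLE h k
  · subst hik
    simp
  · by_cases hi : (i : ℕ) < n
    · have : (⟨i, hi⟩ : Fin n) ≠ k := by
        rintro rfl
        exact hik rfl
      simp [hi, hik, this]
    · simp [hi, hik]

/-- The linear map `s₁ ⊗ ⋯ ⊗ sₙ ↦ s₁ ⊗ ⋯ ⊗ sₙ ⊗ v ⊗ ⋯ ⊗ v`. -/
def padₗ {n m : ℕ} (h : n ≤ m) (v : S) : SpinTensor S n →ₗ[ℂ] SpinTensor S m :=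
  PiTensorProduct.lift
    { toFun := fun s => tprod fun i : Fin m => if hi : (i : ℕ) < n then s ⟨i, hi⟩ else v
      map_update_add' := by
        intro inst s k x y
        rw [Subsingleton.elim inst (instDecidableEqFin n)]
        simp only [pad_update h]
        exact (PiTensorProduct.tprod ℂ).map_update_add _ _ _ _
      map_update_smul' := by
        intro inst s k c x
        rw [Subsingleton.elim inst (instDecidableEqFin n)]
        simp only [pad_update h]
        exact (PiTensorProduct.tprod ℂ).map_update_smul _ _ _ _ }

theorem padₗ_tprod {n m : ℕ} (h : n ≤ m) (v : S) (s : Fin n → S) :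
    padₗ h v (tprod s) = tprod fun i : Fin m => if hi : (i : ℕ) < n then s ⟨i, hi⟩ else v :=
  PiTensorProduct.lift.tprod _

/-- The product basis of an orthonormal basis of `S`. -/
def basis (S : Type*) [NormedAddCommGroup S] [InnerProductSpace ℂ S] [FiniteDimensional ℂ S]
    (n : ℕ) : Module.Basis (Fin n → Fin (Module.finrank ℂ S)) ℂ (SpinTensor S n) :=
  Basis.piTensorProduct (fun _ : Fin n => (stdOrthonormalBasis ℂ S).toBasis)

variable [FiniteDimensional ℂ S]

instance : FiniteDimensional ℂ (SpinTensor S n) := (basis S n).finiteDimensional_of_finite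

/-- Coordinates in the product basis. -/
def toEuclidean (S : Type*) [NormedAddCommGroup S] [InnerProductSpace ℂ S] [FiniteDimensional ℂ S]
    (n : ℕ) : SpinTensor S n ≃ₗ[ℂ] EuclideanSpace ℂ (Fin n → Fin (Module.finrank ℂ S)) :=
  (basis S n).equivFun.trans (WithLp.linearEquiv 2 ℂ _).symm

instance : NormedAddCommGroup (SpinTensor S n) :=
  NormedAddCommGroup.induced _ _ (toEuclidean S n) (toEuclidean S n).injective

instance : InnerProductSpace ℂ (SpinTensor S n) where
  norm_smul_le c x := by
    change ‖toEuclidean S n (c • x)‖ ≤ ‖c‖ * ‖toEuclidean S n x‖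
    rw [map_smul, norm_smul]
  inner x y := inner ℂ (toEuclidean S n x) (toEuclidean S n y)
  norm_sq_eq_re_inner x := norm_sq_eq_re_inner (𝕜 := ℂ) (toEuclidean S n x)
  conj_inner_symm x y := inner_conj_symm _ _
  add_left x y z := by simp only [map_add, inner_add_left]
  smul_left x y c := by simp only [map_smul, inner_smul_left]

/-- The inner product is the standard one on the tensor power (so it does not depend on the basis
that served to define it). -/
theorem inner_tprod (s t : Fin n → S) :
    inner ℂ (tprod s) (tprod t) = ∏ i, inner ℂ (s i) (t i) := by
  have h (u : Fin n → S) (p) : (toEuclidean S n (tprod u)).ofLp p =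
      ∏ i, inner ℂ (stdOrthonormalBasis ℂ S (p i)) (u i) := by
    change (basis S n).repr (tprod u) p = _
    simp only [basis, tprod]
    refine (Basis.piTensorProduct_repr_tprod_apply _ _ _).trans ?_
    simp [OrthonormalBasis.repr_apply_apply]
  change inner ℂ (toEuclidean S n (tprod s)) (toEuclidean S n (tprod t)) = _
  simp only [PiLp.inner_apply, h, RCLike.inner_apply, map_prod, inner_conj_symm]
  simp only [← Finset.prod_mul_distrib]
  have e (i : Fin n) : inner ℂ (s i) (t i) = ∑ j, inner ℂ (stdOrthonormalBasis ℂ S j) (t i) *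
      inner ℂ (s i) (stdOrthonormalBasis ℂ S j) := by
    rw [← (stdOrthonormalBasis ℂ S).sum_inner_mul_inner (s i) (t i)]
    exact Finset.sum_congr rfl fun j _ => mul_comm _ _
  simp only [e]
  rw [Finset.prod_univ_sum]
  simp

/-- For a unit vector `v`, the isometric embedding `s₁ ⊗ ⋯ ⊗ sₙ ↦ s₁ ⊗ ⋯ ⊗ sₙ ⊗ v ⊗ ⋯ ⊗ v`. -/
def pad {n m : ℕ} (h : n ≤ m) (v : S) (hv : ‖v‖ = 1) : SpinTensor S n →ₗᵢ[ℂ] SpinTensor S m :=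
  (padₗ h v).isometryOfInner fun x y => by
    induction x using induction with
    | hs c x hx => rw [map_smul, inner_smul_left, inner_smul_left, hx]
    | ha x x' hx hx' => rw [map_add, inner_add_left, inner_add_left, hx, hx']
    | ht s =>
      induction y using induction with
      | hs c x hx => rw [map_smul, inner_smul_right, inner_smul_right, hx]
      | ha x x' hx hx' => rw [map_add, inner_add_right, inner_add_right, hx, hx']
      | ht t =>
        obtain ⟨d, rfl⟩ := Nat.exists_eq_add_of_le h
        rw [padₗ_tprod, padₗ_tprod, inner_tprod, inner_tprod, Fin.prod_univ_add]
        simp [hv]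

end SpinTensor
end Spin

/-! ### Multiplication operators, and extension by constants -/

section Mul
variable {X W : Type*} [TopologicalSpace X] [CompactSpace X] [MeasurableSpace X] [BorelSpace X]
  [SecondCountableTopology X]
  [NormedAddCommGroup W] [InnerProductSpace ℂ W] [CompleteSpace W] (μ : Measure X)
  [IsFiniteMeasure μ]

/-- Pointwise multiplication by a continuous operator-valued function, see `coeFn_mulOp`. -/
def mulOp (m : C(X, W →L[ℂ] W)) : Lp W 2 μ →L[ℂ] Lp W 2 μ :=
  (ContinuousLinearMap.id ℂ (W →L[ℂ] W)).holderL μ ⊤ 2 2 (ContinuousMap.toLp ⊤ μ ℂ m)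

theorem coeFn_mulOp (m : C(X, W →L[ℂ] W)) (η : Lp W 2 μ) :
    mulOp μ m η =ᵐ[μ] fun x => m x (η x) := by
  have h1 := ContinuousLinearMap.coeFn_holder (r := 2) (ContinuousLinearMap.id ℂ (W →L[ℂ] W))
    (ContinuousMap.toLp ⊤ μ ℂ m) η
  filter_upwards [h1, ContinuousMap.coeFn_toLp (p := ⊤) (𝕜 := ℂ) μ m] with x h1 h2
  refine h1.trans ?_
  rw [h2]
  rfl

/-- Pointwise multiplication as a `*`-representation. -/
def mulRep : C(X, W →L[ℂ] W) →⋆ₐ[ℂ] (Lp W 2 μ →L[ℂ] Lp W 2 μ) where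
  toFun := mulOp μ
  map_one' := by
    ext1 η
    refine Lp.ext ?_
    filter_upwards [coeFn_mulOp μ 1 η] with x hx
    simpa using hx
  map_mul' m m' := by
    ext1 η
    refine Lp.ext ?_
    filter_upwards [coeFn_mulOp μ (m * m') η, coeFn_mulOp μ m (mulOp μ m' η),
      coeFn_mulOp μ m' η] with x h1 h2 h3
    simp only [mul_apply_eq_comp]
    rw [h1, h2, h3]
    rfl
  map_zero' := by
    simp [mulOp]
  map_add' m m' := by
    simp [mulOp]
  commutes' c := by
    ext1 η
    refine Lp.ext ?_
    filter_upwards [coeFn_mulOp μ (algebraMap ℂ _ c) η, Lp.coeFn_smul c η] with x hx h2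
    rw [hx, Algebra.algebraMap_eq_smul_one, Algebra.algebraMap_eq_smul_one]
    simpa using h2.symm
  map_star' m := by
    rw [ContinuousLinearMap.star_eq_adjoint, ContinuousLinearMap.eq_adjoint_iff]
    intro η ζ
    rw [L2.inner_def, L2.inner_def]
    refine integral_congr_ae ?_
    filter_upwards [coeFn_mulOp μ (star m) η, coeFn_mulOp μ m ζ] with x h1 h2
    rw [h1, h2]
    simp [ContinuousLinearMap.star_eq_adjoint, ContinuousLinearMap.adjoint_inner_left]

end Mul

section Iota
variable {G W W' : Type*} [MeasurableSpace G] (μ : Measure G) [IsProbabilityMeasure μ]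
  [NormedAddCommGroup W] [InnerProductSpace ℂ W] [NormedAddCommGroup W'] [InnerProductSpace ℂ W']

/-- Dropping the last `m - n` coordinates preserves the product measure. -/
theorem measurePreserving_restrict {n m : ℕ} (h : n ≤ m) :
    MeasurePreserving (fun (x : Fin m → G) (i : Fin n) => x (Fin.castLE h i))
      (Measure.pi fun _ : Fin m => μ) (Measure.pi fun _ : Fin n => μ) := by
  refine ⟨by fun_prop, ?_⟩
  refine (Measure.pi_eq fun s hs => ?_).symm
  rw [Measure.map_apply (by fun_prop) (MeasurableSet.univ_pi hs)]
  obtain ⟨d, rfl⟩ := Nat.exists_eq_add_of_le h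
  have : (fun (x : Fin (n + d) → G) (i : Fin n) => x (Fin.castLE h i)) ⁻¹' (Set.univ.pi s) =
      Set.univ.pi (Fin.append s (fun _ : Fin d => Set.univ)) := by
    ext x
    simp only [Set.mem_preimage, Set.mem_pi, Set.mem_univ, true_implies]
    constructor
    · intro hx i
      refine Fin.addCases (fun i => ?_) (fun i => ?_) i
      · rw [Fin.append_left]
        exact hx i
      · simp
    · intro hx i
      have := hx (Fin.castAdd d i)
      rwa [Fin.append_left] at this
  rw [this, Measure.pi_pi, Fin.prod_univ_add]
  simp

/-- Pointwise application of an isometry. -/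
def compIsometry {X : Type*} [MeasurableSpace X] (ν : Measure X) (J : W →ₗᵢ[ℂ] W') :
    Lp W 2 ν →ₗᵢ[ℂ] Lp W' 2 ν where
  toLinearMap := J.toContinuousLinearMap.compLpₗ 2 ν
  norm_map' η := by
    have h := J.toContinuousLinearMap.coeFn_compLp η
    refine le_antisymm (Lp.norm_le_norm_of_ae_le ?_) (Lp.norm_le_norm_of_ae_le ?_)
    all_goals
      filter_upwards [h] with x hx
      have hxJ := (congrArg norm hx).trans (J.norm_map _)
      first | exact hxJ.le | exact hxJ.ge

/-- The isometry `L²(Gⁿ, W) → L²(Gᵐ, W')` that extends functions by constants in the last `m - n`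
variables and applies `J` to the values, see `coeFn_extendConst`. -/
def extendConst {n m : ℕ} (h : n ≤ m) (J : W →ₗᵢ[ℂ] W') :
    Lp W 2 (Measure.pi fun _ : Fin n => μ) →ₗᵢ[ℂ] Lp W' 2 (Measure.pi fun _ : Fin m => μ) :=
  (compIsometry _ J).comp
    (Lp.compMeasurePreservingₗᵢ ℂ _ (measurePreserving_restrict μ h))

theorem coeFn_extendConst {n m : ℕ} (h : n ≤ m) (J : W →ₗᵢ[ℂ] W')
    (η : Lp W 2 (Measure.pi fun _ : Fin n => μ)) :
    extendConst μ h J η =ᵐ[Measure.pi fun _ : Fin m => μ]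
      fun x => J (η fun i => x (Fin.castLE h i)) := by
  filter_upwards [J.toContinuousLinearMap.coeFn_compLp
      (Lp.compMeasurePreserving _ (measurePreserving_restrict μ h) η),
    Lp.coeFn_compMeasurePreserving η (measurePreserving_restrict μ h)] with x h1 h2
  refine h1.trans ?_
  rw [h2]
  rfl
end Iota

/-! ### Graphs, free groupoids, refinements and connections -/

section Graphs


/-- The space of `G`-connections on the directed graph `V`: groupoid homomorphisms from the free
groupoid of the graph to the group `G`. -/
abbrev Connection (V : Type u) [Quiver.{v} V] (G : Type w) [Group G] :=
  Quiver.FreeGroupoid V ⥤ SingleObj G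

/-- The arrows `F₁, …, Fₙ` form a free generating set of the free groupoid of the graph: for every
group `X`, every map from the generating set to `X` extends uniquely to a groupoid homomorphism.
(As for Mathlib's `IsFreeGroupoid`, only groups need to be tested.) -/
def IsFreeGenerating {V : Type u} [Quiver.{v} V] {n : ℕ}
    (F : Fin n → Arrow (Quiver.FreeGroupoid V)) : Prop :=
  ∀ (X : Type w) [Group X] (f : Fin n → X),
    ∃! T : Connection V X, ∀ k, T.map (F k).hom = f k

/-- The arrow is a product of edges of the graph (no inverses of edges). -/
inductive IsEdgePath {V : Type u} [Quiver.{v} V] :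
    ∀ {x y : Quiver.FreeGroupoid V}, (x ⟶ y) → Prop
  | edge {a b : V} (e : a ⟶ b) : IsEdgePath ((Quiver.FreeGroupoid.of V).map e)
  | comp {x y z : Quiver.FreeGroupoid V} (p : x ⟶ y) (q : y ⟶ z) :
      IsEdgePath p → IsEdgePath q → IsEdgePath (p ≫ q)

/-- A refinement of the graph `V` by the graph `V'`: a graph morphism from `V` to the free groupoid of
`V'` that takes every edge to a product of edges, and whose induced groupoid homomorphism is
injective. -/
structure Refinement (V : Type u) [Quiver.{v} V] (V' : Type u') [Quiver.{v'} V'] where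
  toPrefunctor : V ⥤q Quiver.FreeGroupoid V'
  edge : ∀ {a b : V} (e : a ⟶ b), IsEdgePath (toPrefunctor.map e)
  injective_obj : Function.Injective (Quiver.FreeGroupoid.lift toPrefunctor).obj
  injective_map : ∀ {x y : Quiver.FreeGroupoid V},
    Function.Injective ((Quiver.FreeGroupoid.lift toPrefunctor).map : (x ⟶ y) → _)

/-- The groupoid homomorphism induced by a refinement. -/
abbrev Refinement.functor {V : Type u} [Quiver.{v} V] {V' : Type u'} [Quiver.{v'} V']
    (r : Refinement V V') : Quiver.FreeGroupoid V ⥤ Quiver.FreeGroupoid V' :=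
  Quiver.FreeGroupoid.lift r.toPrefunctor

section Conn
variable {V : Type u} [Quiver.{v} V] {n : ℕ} {F : Fin n → Arrow (Quiver.FreeGroupoid V)}
  {G : Type w} [Group G]

/-- The connection with values `x₁, …, xₙ` on the free generators; this is the identification of
`Gⁿ` with the space of connections. -/
def connectionOf (hF : IsFreeGenerating.{u, v, w} F) (x : Fin n → G) : Connection V G :=
  (hF G x).choose

theorem connectionOf_map (hF : IsFreeGenerating.{u, v, w} F) (x : Fin n → G) (k : Fin n) :
    (connectionOf hF x).map (F k).hom = x k := (hF G x).choose_spec.1 k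

theorem eq_connectionOf (hF : IsFreeGenerating.{u, v, w} F) (x : Fin n → G) (T : Connection V G)
    (hT : ∀ k, T.map (F k).hom = x k) : T = connectionOf hF x := (hF G x).choose_spec.2 T hT

/-- The holonomy of a connection along an arrow. -/
def holonomy {V : Type u} [Quiver.{v} V] {G : Type w} [Group G] {a b : Quiver.FreeGroupoid V}
    (T : Connection V G) (γ : a ⟶ b) : G := T.map γ

theorem continuous_holonomy [TopologicalSpace G] [IsTopologicalGroup G]
    (hF : IsFreeGenerating.{u, v, w} F) {a b : Quiver.FreeGroupoid V} (γ : a ⟶ b) :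
    Continuous fun x : Fin n → G => holonomy (connectionOf hF x) γ := by
  let U := (hF C(Fin n → G, G) fun k => ⟨fun x => x k, continuous_apply k⟩).choose
  have hU := (hF C(Fin n → G, G) fun k => ⟨fun x => x k, continuous_apply k⟩).choose_spec.1
  have key (x : Fin n → G) : connectionOf hF x = U ⋙ MonoidHom.toFunctor
      (⟨⟨fun f => f x, rfl⟩, fun _ _ => rfl⟩ : C(Fin n → G, G) →* G) := by
    refine (eq_connectionOf hF x _ fun k => ?_).symm
    exact congrArg (fun f : C(Fin n → G, G) => f x) (hU k)
  simp only [key]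
  exact (show C(Fin n → G, G) from U.map γ).continuous

end Conn
end Graphs

/-! ### The Lie group, its Clifford algebra and its representation -/

section Lie
variable (EG : Type*) [NormedAddCommGroup EG] [NormedSpace ℝ EG]
  (G : Type*) [TopologicalSpace G] [ChartedSpace EG G] [Group G]

/-- An invariant metric on the Lie algebra of `G`. -/
structure InvariantMetric where
  form : LinearMap.BilinForm ℝ (GroupLieAlgebra 𝓘(ℝ, EG) G)
  symm : ∀ x y, form x y = form y x
  pos : ∀ x, x ≠ 0 → 0 < form x x
  invariant : ∀ x y z, form ⁅x, y⁆ z = form x ⁅y, z⁆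

variable {EG G}

/-- The complex Clifford algebra of the metric, with `x y + y x = 2 ⟨x, y⟩`. -/
abbrev InvariantMetric.Cl (B : InvariantMetric EG G) : Type _ :=
  ℂ ⊗[ℝ] CliffordAlgebra (LinearMap.BilinMap.toQuadraticMap B.form)

/-- The generator of the Clifford algebra given by an element of the Lie algebra. -/
def InvariantMetric.gen (B : InvariantMetric EG G) (x : GroupLieAlgebra 𝓘(ℝ, EG) G) : B.Cl :=
  1 ⊗ₜ CliffordAlgebra.ι (LinearMap.BilinMap.toQuadraticMap B.form) x

/-- A cyclic `*`-representation `act` of the Clifford algebra on `S` (the elements of the Lie algebra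
act by self-adjoint operators) with unit cyclic vector `vac`, together with a `ℤ/2`-grading operator
of `S` for which the elements of the Lie algebra are odd. -/
structure SpinModule (B : InvariantMetric EG G)
    (S : Type*) [NormedAddCommGroup S] [InnerProductSpace ℂ S] where
  act : B.Cl →ₐ[ℂ] Module.End ℂ S
  act_symm : ∀ x, (act (B.gen x)).IsSymmetric
  vac : S
  norm_vac : ‖vac‖ = 1
  cyclic : ∀ s, ∃ a, act a vac = s
  grading : Module.End ℂ S
  grading_symm : grading.IsSymmetric
  grading_sq : grading * grading = 1
  grading_anti : ∀ x, grading * act (B.gen x) = -(act (B.gen x) * grading)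

/-- A faithful (smooth) unitary representation of `G` by `N × N` matrices. -/
structure FaithfulRep (EG : Type*) [NormedAddCommGroup EG] [NormedSpace ℝ EG]
    (G : Type*) [TopologicalSpace G] [ChartedSpace EG G] [Group G] (N : ℕ) where
  hom : G →* Matrix.unitaryGroup (Fin N) ℂ
  injective : Function.Injective hom
  smooth : ∀ a b, ContMDiff 𝓘(ℝ, EG) 𝓘(ℝ, ℂ) ∞
    fun g => (hom g : Matrix (Fin N) (Fin N) ℂ) a b

theorem FaithfulRep.continuous {N : ℕ} (ρ : FaithfulRep EG G N) :
    Continuous fun g => (ρ.hom g : Matrix (Fin N) (Fin N) ℂ) :=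
  continuous_matrix fun a b => (ρ.smooth a b).continuous

end Lie

/-! ### The spectral triple of a graph -/

section Triple

variable {EG : Type*} [NormedAddCommGroup EG] [NormedSpace ℝ EG]
  {G : Type w} [TopologicalSpace G] [ChartedSpace EG G] [Group G]
  {N : ℕ}

/-- The matrix-valued function `h_γ` on the space of connections, for a loop `γ` at `ν`. -/
def loopHolonomy {V : Type u} [Quiver.{v} V] (ρ : FaithfulRep EG G N) (ν : V)
    (γ : (Quiver.FreeGroupoid.of V).obj ν ⟶ (Quiver.FreeGroupoid.of V).obj ν)
    (T : Connection V G) : Matrix (Fin N) (Fin N) ℂ :=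
  ρ.hom (holonomy T γ)

/-- The algebra of holonomies: the algebra of matrix-valued functions on the space of connections
generated by the functions `h_γ`, for `γ` in the isotropy group of `ν`. Since these form a group
of unitaries, it consists of their linear combinations, with
`(∑ aᵢ h_γᵢ)* = ∑ (conj aᵢ) (h_γᵢ)⁻¹`. -/
def holonomyAlgebra {V : Type u} [Quiver.{v} V] (ρ : FaithfulRep EG G N) (ν : V) :
    StarSubalgebra ℂ (Connection V G → Matrix (Fin N) (Fin N) ℂ) :=
  StarAlgebra.adjoin ℂ (Set.range (loopHolonomy ρ ν))

theorem pullback_mem {V : Type u} [Quiver.{v} V] {V' : Type u'} [Quiver.{v'} V']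
    (ρ : FaithfulRep EG G N) (r : Refinement V V') {ν : V} {ν' : V'}
    (hν : r.functor.obj ((Quiver.FreeGroupoid.of V).obj ν) = (Quiver.FreeGroupoid.of V').obj ν')
    {b : Connection V G → Matrix (Fin N) (Fin N) ℂ} (hb : b ∈ holonomyAlgebra ρ ν) :
    (fun T : Connection V' G => b (r.functor ⋙ T)) ∈ holonomyAlgebra ρ ν' := by
  induction hb using StarAlgebra.adjoin_induction with
  | mem f hf =>
    obtain ⟨γ, rfl⟩ := hf
    refine StarAlgebra.subset_adjoin ℂ _ ⟨eqToHom hν.symm ≫ r.functor.map γ ≫ eqToHom hν, ?_⟩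
    funext T
    have h : ∀ (x y : Quiver.FreeGroupoid V') (h : x = y) (δ : x ⟶ x),
        holonomy T (eqToHom h.symm ≫ δ ≫ eqToHom h) = holonomy T δ := by
      rintro x _ rfl δ
      simp
    simp only [loopHolonomy, h _ _ hν]
    rfl
  | algebraMap c => exact (holonomyAlgebra ρ ν').algebraMap_mem c
  | add f g _ _ hf hg => exact add_mem hf hg
  | mul f g _ _ hf hg => exact mul_mem hf hg
  | star f _ hf => exact star_mem hf

/-- The `*`-homomorphism `Q` between the algebras of holonomies: pullback along the restriction of
connections; it takes `h_γ` to `h_(r γ)`. -/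
def mapQ {V : Type u} [Quiver.{v} V] {V' : Type u'} [Quiver.{v'} V']
    (ρ : FaithfulRep EG G N) (r : Refinement V V') {ν : V} {ν' : V'}
    (hν : r.functor.obj ((Quiver.FreeGroupoid.of V).obj ν) = (Quiver.FreeGroupoid.of V').obj ν') :
    holonomyAlgebra ρ ν →⋆ₐ[ℂ] holonomyAlgebra ρ ν' where
  toFun b := ⟨fun T => b.1 (r.functor ⋙ T), pullback_mem ρ r hν b.2⟩
  map_one' := rfl
  map_mul' _ _ := rfl
  map_zero' := rfl
  map_add' _ _ := rfl
  commutes' _ := rfl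
  map_star' _ := rfl

theorem continuous_coord {V : Type u} [Quiver.{v} V] {n : ℕ}
    [IsTopologicalGroup G]
    {F : Fin n → Arrow (Quiver.FreeGroupoid V)} (hF : IsFreeGenerating.{u, v, w} F)
    (ρ : FaithfulRep EG G N) {ν : V}
    {b : Connection V G → Matrix (Fin N) (Fin N) ℂ} (hb : b ∈ holonomyAlgebra ρ ν) :
    Continuous fun x : Fin n → G => b (connectionOf hF x) := by
  induction hb using StarAlgebra.adjoin_induction with
  | mem f hf =>
    obtain ⟨γ, rfl⟩ := hf
    exact ρ.continuous.comp (continuous_holonomy hF γ)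
  | algebraMap c => exact continuous_const
  | add f g _ _ hf hg => exact hf.add hg
  | mul f g _ _ hf hg => exact hf.mul hg
  | star f _ hf => exact hf.star

/-- An element of the algebra of holonomies as a function on `Gⁿ`. -/
def coordHom {V : Type u} [Quiver.{v} V] {n : ℕ}
    [IsTopologicalGroup G]
    {F : Fin n → Arrow (Quiver.FreeGroupoid V)} (hF : IsFreeGenerating.{u, v, w} F)
    (ρ : FaithfulRep EG G N) (ν : V) :
    holonomyAlgebra ρ ν →⋆ₐ[ℂ] C(Fin n → G, Matrix (Fin N) (Fin N) ℂ) where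
  toFun b := ⟨fun x => b.1 (connectionOf hF x), continuous_coord hF ρ b.2⟩
  map_one' := rfl
  map_mul' _ _ := rfl
  map_zero' := rfl
  map_add' _ _ := rfl
  commutes' _ := rfl
  map_star' _ := rfl

variable {S : Type*} [NormedAddCommGroup S] [InnerProductSpace ℂ S] [FiniteDimensional ℂ S]
  {E : Type*} [NormedAddCommGroup E] [InnerProductSpace ℂ E] [FiniteDimensional ℂ E]
  [CompleteSpace E]

/-- The fibre `E ⊗ S ⊗ ⋯ ⊗ S`. -/
abbrev Fiber (E : Type*) [NormedAddCommGroup E] [InnerProductSpace ℂ E]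
    (S : Type*) [NormedAddCommGroup S] [InnerProductSpace ℂ S] (n : ℕ) : Type _ :=
  E ⊗[ℂ] SpinTensor S n

instance (n : ℕ) : CompleteSpace (Fiber E S n) := FiniteDimensional.complete ℂ _

/-- Matrices act on the factor `E` of the fibre. -/
def matAct (α : Matrix (Fin N) (Fin N) ℂ →⋆ₐ[ℂ] (E →L[ℂ] E)) (n : ℕ) :
    Matrix (Fin N) (Fin N) ℂ →⋆ₐ[ℂ] (Fiber E S n →L[ℂ] Fiber E S n) where
  toFun a := (α a).rTensor (SpinTensor S n)
  map_one' := by rw [map_one, ContinuousLinearMap.rTensor_one]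
  map_mul' a b := by rw [map_mul, ContinuousLinearMap.rTensor_mul]
  map_zero' := by rw [map_zero, ContinuousLinearMap.rTensor_zero]
  map_add' a b := by rw [map_add, ContinuousLinearMap.rTensor_add]
  commutes' c := by
    rw [AlgHomClass.commutes, Algebra.algebraMap_eq_smul_one, ContinuousLinearMap.rTensor_smul,
      ContinuousLinearMap.rTensor_one, Algebra.algebraMap_eq_smul_one]
  map_star' a := by
    rw [ContinuousLinearMap.star_eq_adjoint, ContinuousLinearMap.adjoint_rTensor, map_star,
      ContinuousLinearMap.star_eq_adjoint]

theorem continuous_matAct (α : Matrix (Fin N) (Fin N) ℂ →⋆ₐ[ℂ] (E →L[ℂ] E)) (n : ℕ) :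
    Continuous (matAct (S := S) α n) :=
  LinearMap.continuous_of_finiteDimensional (matAct (S := S) α n).toAlgHom.toLinearMap

variable [IsTopologicalGroup G] [CompactSpace G] [SecondCountableTopology G]
  [MeasurableSpace G] [BorelSpace G] (μ : Measure G) [IsProbabilityMeasure μ]

/-- The Hilbert space `E ⊗ (L²(G) ⊗ S) ⊗ ⋯ ⊗ (L²(G) ⊗ S) = L²(Gⁿ, E ⊗ S ⊗ ⋯ ⊗ S)`. -/
abbrev GraphHilbert (E : Type*) [NormedAddCommGroup E] [InnerProductSpace ℂ E]
    (S : Type*) [NormedAddCommGroup S] [InnerProductSpace ℂ S] [FiniteDimensional ℂ S]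
    {G : Type*} [MeasurableSpace G] (μ : Measure G) (n : ℕ) : Type _ :=
  Lp (Fiber E S n) 2 (Measure.pi fun _ : Fin n => μ)

/-- The representation of the algebra of holonomies: `(b η)(x) = b(∇ₓ) η(x)`, where `∇ₓ` is the
connection with coordinates `x` and `b(∇ₓ)` acts on the factor `E`. -/
def holonomyRep {V : Type u} [Quiver.{v} V] {n : ℕ}
    {F : Fin n → Arrow (Quiver.FreeGroupoid V)} (hF : IsFreeGenerating.{u, v, w} F)
    (ρ : FaithfulRep EG G N) (ν : V) (α : Matrix (Fin N) (Fin N) ℂ →⋆ₐ[ℂ] (E →L[ℂ] E)) :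
    holonomyAlgebra ρ ν →⋆ₐ[ℂ] (GraphHilbert E S μ n →L[ℂ] GraphHilbert E S μ n) :=
  ((mulRep (Measure.pi fun _ : Fin n => μ)).comp
    (ContinuousMap.compStarAlgHom (Fin n → G) (matAct (S := S) α n) (continuous_matAct α n))).comp
    (coordHom hF ρ ν)

/-- The derivative of `f` in the `k`-th variable along the left-invariant vector field of `v`. -/
def leftDeriv {W : Type*} [NormedAddCommGroup W] [NormedSpace ℝ W] {n : ℕ} (k : Fin n)
    (v : GroupLieAlgebra 𝓘(ℝ, EG) G) (f : (Fin n → G) → W) (x : Fin n → G) : W :=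
  mfderiv 𝓘(ℝ, EG) 𝓘(ℝ, W) (fun g : G => f (Function.update x k g)) (x k)
    (mulInvariantVectorField v (x k))

/-- The Clifford action of `v` in the `k`-th copy of the Lie algebra on `S ⊗ ⋯ ⊗ S`: the Clifford
algebra of a direct sum is the graded tensor product, so `v` acts as
`ε ⊗ ⋯ ⊗ ε ⊗ v ⊗ 1 ⊗ ⋯ ⊗ 1`, with the grading operator `ε` in the factors before the `k`-th. -/
def SpinModule.cliff {B : InvariantMetric EG G} (σ : SpinModule B S) {n : ℕ} (k : Fin n)
    (v : GroupLieAlgebra 𝓘(ℝ, EG) G) : Module.End ℂ (SpinTensor S n) :=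
  SpinTensor.map fun i => if i < k then σ.grading else if i = k then σ.act (B.gen v) else 1

/-- The differential operator `(1/i) ∑ₖ ∑ᵢ eᵢ⁽ᵏ⁾ ⊗ eᵢ⁽ᵏ⁾` on functions on `Gⁿ`. -/
def diracFun {B : InvariantMetric EG G} (σ : SpinModule B S) {q : ℕ}
    (e : Fin q → GroupLieAlgebra 𝓘(ℝ, EG) G) {n : ℕ}
    (f : (Fin n → G) → Fiber E S n) (x : Fin n → G) : Fiber E S n :=
  (Complex.I)⁻¹ • ∑ k : Fin n, ∑ i : Fin q,
    (LinearMap.toContinuousLinearMap (σ.cliff k (e i))).lTensor E (leftDeriv k (e i) f x)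

variable (E) in
/-- The Dirac operator with the smooth functions as its domain, given through its graph (a linear
subspace, so that taking the span changes nothing). -/
def diracCore {B : InvariantMetric EG G} (σ : SpinModule B S) {q : ℕ}
    (e : Fin q → GroupLieAlgebra 𝓘(ℝ, EG) G) (n : ℕ) :
    GraphHilbert E S μ n →ₗ.[ℂ] GraphHilbert E S μ n :=
  (Submodule.span ℂ {p : GraphHilbert E S μ n × GraphHilbert E S μ n |
    ∃ f : (Fin n → G) → Fiber E S n,
      ContMDiff (ModelWithCorners.pi fun _ : Fin n => 𝓘(ℝ, EG)) 𝓘(ℝ, Fiber E S n) ∞ f ∧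
      p.1 =ᵐ[Measure.pi fun _ : Fin n => μ] f ∧
      p.2 =ᵐ[Measure.pi fun _ : Fin n => μ] diracFun σ e f}).toLinearPMap

variable (E) in
/-- The Dirac operator: the closure of the one on smooth functions. -/
def dirac {B : InvariantMetric EG G} (σ : SpinModule B S) {q : ℕ}
    (e : Fin q → GroupLieAlgebra 𝓘(ℝ, EG) G) (n : ℕ) :
    GraphHilbert E S μ n →ₗ.[ℂ] GraphHilbert E S μ n :=
  (diracCore E μ σ e n).closure

variable (E) in
/-- The isometry `ι`: extend functions by constants in the last `m - n` variables and tensor the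
spinors with copies of the cyclic vector. -/
def mapIota {B : InvariantMetric EG G} (σ : SpinModule B S) {n m : ℕ} (h : n ≤ m) :
    GraphHilbert E S μ n →ₗᵢ[ℂ] GraphHilbert E S μ m :=
  extendConst μ h ((SpinTensor.pad h σ.vac σ.norm_vac).lTensor E)

end Triple
end GraphTriple

end

open GraphTriple

noncomputable section
namespace GraphTriple

/-! ### Unbounded symmetric operators with discrete spectrum -/

section Abstract
variable {H : Type*} [NormedAddCommGroup H] [InnerProductSpace ℂ H]

/-! The analytic core is that the Dirac operator on `Gⁿ` has an orthonormal basis of smooth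
eigenvectors, with only finitely many eigenvalues (counted with multiplicity) in any bounded
interval. The closure of a symmetric operator with such a basis is diagonal in it
(`mem_closure_graph_iff`), and self-adjointness and compactness of `(1 + D²)^(-1/2)` are read off
the eigenvalues.

The eigenbasis comes from an exhaustion by finite-dimensional invariant subspaces
(`exists_eigenbasis`): the polynomials of degree at most `d` in the matrix coefficients of the
faithful representation and their conjugates. They are stable under right translations, hence under
left-invariant derivatives, and dense by Stone–Weierstrass. The eigenvalues grow for two reasons.
The Clifford relations and the skew-symmetry of the derivatives bound the gradient of `f` by `‖f‖`
and `‖Df‖` (`clifford_estimate`, `exists_gradient_estimate`). Moreover, a polynomial `f` orthogonal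
to all those of low degree is small compared with its gradient
(`exists_norm_le_of_orthogonal_trigSpace`): a polynomial approximation of a bump function at the
identity integrates to zero against the pairing of `f` with its translates, while translations near
the identity barely move `f`. These two estimates take the place of Rellich's theorem and of the
spectral theory of the Laplacian.

The rest is algebra. Freeness of the generators, applied to the group of smooth maps `Gⁿ → G`, makes
every holonomy a smooth function of the coordinates (`contMDiff_holonomy`). By the Leibniz rule its
commutator with `D` is multiplication by a continuous function, because matrices and Clifford
elements act on different tensor factors. The isometry `ι` intertwines the Dirac operators because
derivatives in the new variables kill functions constant in them, and because the Clifford action of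
an old copy of the Lie algebra puts grading operators only on earlier factors, never on the appended
cyclic vectors. Identities involving `D` are checked on smooth functions and carried to the closure
by a bounded map of graphs (`map_mem_closure_graph`). -/

theorem map_mem_closure_graph {H' : Type*} [NormedAddCommGroup H'] [InnerProductSpace ℂ H']
    {A : H →ₗ.[ℂ] H} (hA : A.IsClosable) {D : H' →ₗ.[ℂ] H'} (hD : D.IsClosed)
    (Φ : H × H →L[ℂ] H' × H') (h : ∀ p ∈ A.graph, Φ p ∈ D.graph) {p : H × H}
    (hp : p ∈ A.closure.graph) : Φ p ∈ D.graph := by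
  rw [← hA.graph_closure_eq_closure_graph] at hp
  have hD' : IsClosed (D.graph : Set (H' × H')) := hD
  exact closure_minimal (s := (A.graph : Set (H × H))) (t := Φ ⁻¹' (D.graph : Set (H' × H')))
    (fun q hq => h q hq) (hD'.preimage Φ.continuous) hp

variable {ι : Type*}

theorem norm_le_of_coord_le (b : HilbertBasis ι ℂ H) {c : ℝ} (hc : 0 ≤ c) {x y : H}
    (h : ∀ i, ‖inner ℂ (b i) x‖ ≤ c * ‖inner ℂ (b i) y‖) : ‖x‖ ≤ c * ‖y‖ := by
  have key (z : H) : HasSum (fun i => ‖inner ℂ (b i) z‖ ^ 2) (‖z‖ ^ 2) := by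
    have h1 := Complex.hasSum_re (b.hasSum_inner_mul_inner z z)
    have h2 : (inner ℂ z z).re = ‖z‖ ^ 2 := by
      rw [inner_self_eq_norm_sq_to_K]; norm_cast
    rw [h2] at h1
    refine h1.congr_fun ?_ |> fun h => h
    intro i
    rw [← inner_conj_symm z (b i), ← Complex.normSq_eq_conj_mul_self, Complex.normSq_eq_norm_sq]
    norm_cast
  have := hasSum_le (fun i => ?_) (key x) ((key y).mul_left (c ^ 2))
  · rw [← mul_pow] at this
    exact (pow_le_pow_iff_left₀ (norm_nonneg _) (by positivity) two_ne_zero).1 this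
  · rw [← mul_pow]
    exact pow_le_pow_left₀ (norm_nonneg _) (h i) 2

theorem eq_of_coord_eq (b : HilbertBasis ι ℂ H) {x y : H}
    (h : ∀ i, inner ℂ (b i) x = inner ℂ (b i) y) : x = y := by
  have := norm_le_of_coord_le b (x := x - y) (y := 0) le_rfl fun i => by
    simp [h i]
  rw [zero_mul, norm_le_zero_iff, sub_eq_zero] at this
  exact this

/-- A bounded operator with prescribed bounded real eigenvalues on a Hilbert basis. -/
theorem exists_diagonal [CompleteSpace H] (b : HilbertBasis ι ℂ H) (t : ι → ℝ) (ht : ∀ i, |t i| ≤ 1) :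
    ∃ T : H →L[ℂ] H, ∀ i x, inner ℂ (b i) (T x) = t i * inner ℂ (b i) x := by
  have mem (x : H) : Memℓp (fun i => (t i : ℂ) * b.repr x i) 2 := by
    have hx := (b.repr x).2
    refine memℓp_gen ((hx.summable (by norm_num)).of_nonneg_of_le (fun i => by positivity) fun i => ?_)
    refine Real.rpow_le_rpow (norm_nonneg _) ?_ (by norm_num)
    rw [norm_mul]
    refine mul_le_of_le_one_left (norm_nonneg _) ?_
    simpa using ht i
  let f : H → H := fun x => b.repr.symm ⟨_, mem x⟩
  have hf (i : ι) (x : H) : inner ℂ (b i) (f x) = t i * inner ℂ (b i) x := by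
    rw [← b.repr_apply_apply, ← b.repr_apply_apply]
    simp [f]
  let L : H →ₗ[ℂ] H :=
    { toFun := f
      map_add' := fun x y => eq_of_coord_eq b fun i => by
        simp only [hf, inner_add_right, mul_add]
      map_smul' := fun c x => eq_of_coord_eq b fun i => by
        simp only [hf, inner_smul_right, RingHom.id_apply]; ring }
  refine ⟨L.mkContinuous 1 fun x => norm_le_of_coord_le b zero_le_one fun i => ?_, fun i x => hf i x⟩
  change ‖inner ℂ (b i) (f x)‖ ≤ _
  rw [hf, norm_mul]
  refine mul_le_mul_of_nonneg_right ?_ (norm_nonneg _)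
  simpa using ht i

/-- Keeping only the finitely many entries with `|t i| > 1/(n+1)` gives a finite-rank operator at
distance at most `1/(n+1)` from `T`, so `T` is a norm limit of compact operators. -/
theorem isCompactOperator_of_diagonal [CompleteSpace H] (b : HilbertBasis ι ℂ H) (t : ι → ℝ)
    (T : H →L[ℂ] H) (hT : ∀ i x, inner ℂ (b i) (T x) = t i * inner ℂ (b i) x)
    (ht : ∀ ε > 0, {i | ε < |t i|}.Finite) : IsCompactOperator T := by
  classical
  let R (i : ι) : H →L[ℂ] H :=
    (ContinuousLinearMap.toSpanSingleton ℂ (b i)).comp (innerSL ℂ (b i))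
  have hR (i : ι) : IsCompactOperator (R i) :=
    (isCompactOperator_of_locallyCompactSpace_rng
      (ContinuousLinearMap.toSpanSingleton ℂ (b i))).comp_clm _
  have hRi (i j : ι) (x : H) : inner ℂ (b i) (R j x) = if i = j then inner ℂ (b i) x else 0 := by
    simp only [R, ContinuousLinearMap.comp_apply, innerSL_apply_apply,
      ContinuousLinearMap.toSpanSingleton_apply, inner_smul_right,
      orthonormal_iff_ite.1 b.orthonormal]
    split_ifs with h
    · rw [h, mul_one]
    · rw [mul_zero]
  let F (n : ℕ) : H →L[ℂ] H := ∑ i ∈ (ht (1 / ((n : ℝ) + 1)) (by positivity)).toFinset, (t i : ℂ) • R i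
  refine isCompactOperator_of_tendsto (F := F) (l := Filter.atTop) ?_ (.of_forall fun n => ?_)
  · rw [tendsto_iff_norm_sub_tendsto_zero]
    refine squeeze_zero (fun _ => norm_nonneg _) (fun n => ?_) tendsto_one_div_add_atTop_nhds_zero_nat
    refine ContinuousLinearMap.opNorm_le_bound _ (by positivity) fun x => ?_
    refine norm_le_of_coord_le b (by positivity) fun i => ?_
    have h1 : inner ℂ (b i) (F n x) =
        if i ∈ (ht (1 / ((n : ℝ) + 1)) (by positivity)).toFinset then t i * inner ℂ (b i) x else 0 := by
      simp only [F, sum_apply, inner_sum, smul_apply,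
        inner_smul_right, hRi, mul_ite, mul_zero, Finset.sum_ite_eq]
    rw [sub_apply, inner_sub_right, h1, hT]
    split_ifs with h
    · simp; positivity
    · rw [zero_sub, norm_neg, norm_mul]
      refine mul_le_mul_of_nonneg_right ?_ (norm_nonneg _)
      simpa using h
  · exact (compactOperator (RingHom.id ℂ) H H).sum_mem fun i _ =>
      (compactOperator (RingHom.id ℂ) H H).smul_mem _ (hR i)

variable [CompleteSpace H]

/-- A symmetric densely defined operator is contained in its adjoint, which is closed. -/
theorem isClosable_of_symmetric {A : H →ₗ.[ℂ] H} (hA : A.IsFormalAdjoint A)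
    (hd : Dense (A.domain : Set H)) : A.IsClosable :=
  (LinearPMap.adjoint_isClosed hd).isClosable.leIsClosable (hA.le_adjoint hd)

section Basis
variable {A : H →ₗ.[ℂ] H} (b : HilbertBasis ι ℂ H) (l : ι → ℝ)

omit [CompleteSpace H] in
theorem dense_domain_of_eigenbasis (hb : ∀ i, (b i, (l i : ℂ) • b i) ∈ A.graph) :
    Dense (A.domain : Set H) := by
  have h1 : Submodule.span ℂ (Set.range b) ≤ A.domain := by
    rw [Submodule.span_le]
    rintro _ ⟨i, rfl⟩
    obtain ⟨y, hy, -⟩ := (LinearPMap.mem_graph_iff A).1 (hb i)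
    rw [← show (y : H) = b i from hy]
    exact y.2
  have h2 := Submodule.topologicalClosure_mono h1
  rw [b.dense_span, top_le_iff] at h2
  rw [dense_iff_closure_eq, ← Submodule.topologicalClosure_coe, h2]
  rfl

/-- The closure of a symmetric operator with an orthonormal basis of eigenvectors. -/
theorem mem_closure_graph_iff (hA : A.IsFormalAdjoint A)
    (hb : ∀ i, (b i, (l i : ℂ) • b i) ∈ A.graph) (p : H × H) :
    p ∈ A.closure.graph ↔ ∀ i, inner ℂ (b i) p.2 = l i * inner ℂ (b i) p.1 := by
  have hd := dense_domain_of_eigenbasis b l hb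
  have hc := isClosable_of_symmetric hA hd
  rw [← hc.graph_closure_eq_closure_graph]
  constructor
  · intro hp i
    -- The coordinate condition is closed in `p`, and on the graph of `A` it is symmetry tested
    -- against the eigenvector `b i`.
    refine closure_minimal (s := (A.graph : Set (H × H)))
      (t := {p | inner ℂ (b i) p.2 = l i * inner ℂ (b i) p.1}) ?_ (isClosed_eq ?_ ?_) hp
    · rintro ⟨x, y⟩ hxy
      obtain ⟨x', rfl, rfl⟩ := (LinearPMap.mem_graph_iff A).1 hxy
      obtain ⟨b', hb', hb''⟩ := (LinearPMap.mem_graph_iff A).1 (hb i)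
      simp only at hb' hb''
      have := hA b' x'
      rw [hb', hb'', inner_smul_left] at this
      simpa using this.symm
    · fun_prop
    · fun_prop
  · intro hp
    -- The condition on coordinates says that the expansions of `p.1` and `p.2` combine into one
    -- expansion of `p` along the vectors `(b i, l i • b i)`, whose partial sums lie in the graph of
    -- `A`.
    have h1 : HasSum (fun i => (b.repr p.1 i) • ((b i, (l i : ℂ) • b i) : H × H)) p := by
      refine ((b.hasSum_repr p.1).prodMk (b.hasSum_repr p.2)).congr_fun fun i => ?_
      rw [Prod.smul_mk, b.repr_apply_apply, b.repr_apply_apply, hp i, smul_smul, mul_comm]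
    exact mem_closure_of_tendsto h1 (.of_forall fun s =>
      A.graph.sum_mem fun i _ => A.graph.smul_mem _ (hb i))

/-- Pairing an element of the graph of the adjoint with `b i` yields exactly the coordinate
condition that describes the closure. Conversely, real eigenvalues make the closure symmetric by
Parseval. -/
theorem isSelfAdjoint_closure_of_eigenbasis (hA : A.IsFormalAdjoint A)
    (hb : ∀ i, (b i, (l i : ℂ) • b i) ∈ A.graph) : IsSelfAdjoint A.closure := by
  have hg := mem_closure_graph_iff b l hA hb
  have hd : Dense (A.closure.domain : Set H) :=
    (dense_domain_of_eigenbasis b l hb).mono A.le_closure.1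
  rw [LinearPMap.isSelfAdjoint_def]
  refine le_antisymm (LinearPMap.le_of_le_graph fun p hp => ?_)
    (LinearPMap.IsFormalAdjoint.le_adjoint hd fun x y => ?_)
  · rw [hg]
    intro i
    obtain ⟨y, hy, hy'⟩ := (LinearPMap.mem_graph_iff _).1 hp
    obtain ⟨b', hb', hb''⟩ := (LinearPMap.mem_graph_iff _).1
      ((LinearPMap.le_graph_of_le A.le_closure) (hb i))
    simp only at hb' hb''
    have := (LinearPMap.adjoint_isFormalAdjoint hd).symm b' y
    rw [hy, hy', hb', hb'', inner_smul_left] at this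
    simpa using this.symm
  · have hx := (hg _).1 (A.closure.mem_graph x)
    have hy := (hg _).1 (A.closure.mem_graph y)
    rw [← b.tsum_inner_mul_inner, ← b.tsum_inner_mul_inner (x : H)]
    refine tsum_congr fun i => ?_
    rw [hy i, ← inner_conj_symm, hx i, map_mul, inner_conj_symm]
    simp only [Complex.conj_ofReal]
    ring

theorem exists_compact_resolvent_of_eigenbasis (hA : A.IsFormalAdjoint A)
    (hb : ∀ i, (b i, (l i : ℂ) • b i) ∈ A.graph) (hfin : ∀ C, {i | |l i| ≤ C}.Finite) :
    ∃ T : H →L[ℂ] H, T.IsPositive ∧ IsCompactOperator T ∧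
      ∀ x : H, ∃ y z : A.closure.domain, (y : H) = T (T x) ∧ (z : H) = A.closure y ∧
        (y : H) + A.closure z = x := by
  have hg := mem_closure_graph_iff b l hA hb
  let t (i : ι) : ℝ := (√(1 + l i ^ 2))⁻¹
  have hpos (i : ι) : 0 < 1 + l i ^ 2 := by positivity
  have h1 (i : ι) : 1 ≤ √(1 + l i ^ 2) := Real.one_le_sqrt.2 (by nlinarith [sq_nonneg (l i)])
  have ht0 (i : ι) : 0 < t i := by positivity
  have ht1 (i : ι) : |t i| ≤ 1 := by
    rw [abs_of_pos (ht0 i)]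
    exact inv_le_one_of_one_le₀ (h1 i)
  have htt (i : ι) : t i * t i = (1 + l i ^ 2)⁻¹ := by
    rw [← mul_inv, Real.mul_self_sqrt (hpos i).le]
  obtain ⟨T, hT⟩ := exists_diagonal b t ht1
  -- While `T` is to be `(1 + D²)^(-1/2)`, `R` is `D (1 + D²)⁻¹`. The witnesses are then `y = T² x`
  -- and `z = D y = R x`, and `D z = x - T² x`.
  obtain ⟨R, hR⟩ := exists_diagonal b (fun i => l i * (1 + l i ^ 2)⁻¹) fun i => by
    rw [abs_mul, abs_of_pos (inv_pos.2 (hpos i)), ← div_eq_mul_inv, div_le_one (hpos i)]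
    nlinarith [sq_abs (l i), sq_nonneg (|l i| - 1), abs_nonneg (l i)]
  refine ⟨T, ?_, ?_, fun x => ?_⟩
  · rw [ContinuousLinearMap.isPositive_def']
    constructor
    · rw [ContinuousLinearMap.isSelfAdjoint_iff_isSymmetric]
      intro x y
      change inner ℂ (T x) y = inner ℂ x (T y)
      rw [← b.tsum_inner_mul_inner, ← b.tsum_inner_mul_inner x]
      refine tsum_congr fun i => ?_
      rw [hT, ← inner_conj_symm, hT, map_mul, inner_conj_symm, Complex.conj_ofReal]
      ring
    · intro x
      rw [ContinuousLinearMap.reApplyInnerSelf_apply, ← b.tsum_inner_mul_inner]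
      have h2 := b.hasSum_inner_mul_inner (T x) x
      refine ((Complex.hasSum_re h2).nonneg fun i => ?_).trans_eq ?_
      · rw [← inner_conj_symm, hT, map_mul, Complex.conj_ofReal, mul_assoc,
          ← Complex.normSq_eq_conj_mul_self, ← Complex.ofReal_mul, Complex.ofReal_re]
        have := (ht0 i).le
        have := Complex.normSq_nonneg (inner ℂ (b i) x)
        positivity
      · rw [h2.tsum_eq]; rfl
  · refine isCompactOperator_of_diagonal b t T hT fun ε hε => (hfin (1 / ε)).subset fun i hi => ?_
    simp only [Set.mem_ofPred_eq] at hi ⊢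
    rw [abs_of_pos (ht0 i)] at hi
    have h3 : √(1 + l i ^ 2) < 1 / ε := by
      rw [one_div]
      exact (lt_inv_comm₀ hε (by positivity)).1 hi
    refine le_trans ?_ h3.le
    rw [← Real.sqrt_sq_eq_abs]
    exact Real.sqrt_le_sqrt (by linarith)
  · have hy : (T (T x), R x) ∈ A.closure.graph := by
      rw [hg]
      intro i
      simp only [hT, hR]
      rw [← mul_assoc (t i : ℂ), ← Complex.ofReal_mul, htt, ← mul_assoc, Complex.ofReal_mul]
    have hz : (R x, x - T (T x)) ∈ A.closure.graph := by
      rw [hg]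
      intro i
      simp only [hT, hR, inner_sub_right]
      rw [← mul_assoc (t i : ℂ), ← Complex.ofReal_mul, htt, ← mul_assoc, ← Complex.ofReal_mul]
      have : (1 : ℝ) - (1 + l i ^ 2)⁻¹ = l i * (l i * (1 + l i ^ 2)⁻¹) := by
        have := (hpos i).ne'
        field_simp
        ring
      rw [← this]
      push_cast
      ring
    obtain ⟨y, hy1, hy2⟩ := (LinearPMap.mem_graph_iff _).1 hy
    obtain ⟨z, hz1, hz2⟩ := (LinearPMap.mem_graph_iff _).1 hz
    exact ⟨y, z, hy1, hz1.trans hy2.symm, by rw [hy1, hz2]; simp⟩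

end Basis
/-- A symmetric operator leaving invariant an exhaustion by finite-dimensional subspaces outside of
which it is large has an orthonormal basis of eigenvectors with eigenvalues tending to infinity. -/
theorem exists_eigenbasis {A : H →ₗ.[ℂ] H} (hA : A.IsFormalAdjoint A)
    (V : ℕ → Submodule ℂ H) (hmono : Monotone V) (hV0 : V 0 = ⊥)
    [hfd : ∀ d, FiniteDimensional ℂ (V d)]
    (hdense : (⨆ d, V d).topologicalClosure = ⊤)
    (hinv : ∀ d, ∀ x ∈ V d, ∃ y ∈ V d, (x, y) ∈ A.graph)
    (hbig : ∀ ε > 0, ∃ d, ∀ d', ∀ x ∈ V d', x ∈ (V d)ᗮ → ∀ y, (x, y) ∈ A.graph →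
      ‖x‖ ^ 2 ≤ ε * (‖x‖ ^ 2 + ‖y‖ ^ 2)) :
    ∃ (ι : Type) (b : HilbertBasis ι ℂ H) (l : ι → ℝ),
      (∀ i, (b i, (l i : ℂ) • b i) ∈ A.graph) ∧ ∀ C, {i | |l i| ≤ C}.Finite := by
  have hsym {x y x' y' : H} (h : (x, y) ∈ A.graph) (h' : (x', y') ∈ A.graph) :
      inner ℂ y x' = inner ℂ x y' := by
    obtain ⟨u, rfl, rfl⟩ := (LinearPMap.mem_graph_iff A).1 h
    obtain ⟨u', rfl, rfl⟩ := (LinearPMap.mem_graph_iff A).1 h'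
    exact hA u u'
  -- The orthogonal increments of the exhaustion. Since `V 0 = ⊥`, the first `d` of them span `V d`,
  -- and `A` can be diagonalized in each one separately.
  let W (d : ℕ) : Submodule ℂ H := V (d + 1) ⊓ (V d)ᗮ
  have hWfd (d : ℕ) : FiniteDimensional ℂ (W d) :=
    Submodule.finiteDimensional_of_le (S₂ := V (d + 1)) inf_le_left
  have hWinv (d : ℕ) (x : W d) : ∃ y : W d, ((x : H), (y : H)) ∈ A.graph := by
    obtain ⟨y, hy, hxy⟩ := hinv (d + 1) x x.2.1
    -- By symmetry the pairing of `z` with `A x` is that of `A z` with `x`, and `A z` is again in `V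
    -- d`, to which `x` is orthogonal.
    refine ⟨⟨y, hy, fun z hz => ?_⟩, hxy⟩
    obtain ⟨z', hz', hzz'⟩ := hinv d z hz
    rw [← hsym hzz' hxy]
    exact x.2.2 z' hz'
  choose T hT using hWinv
  have hTuniq (d : ℕ) (x y : W d) (h : ((x : H), (y : H)) ∈ A.graph) : T d x = y :=
    Subtype.ext (LinearPMap.mem_graph_snd_inj _ (hT d x) h rfl)
  let L (d : ℕ) : W d →ₗ[ℂ] W d :=
    { toFun := T d
      map_add' := fun x y => hTuniq d _ _ (A.graph.add_mem (hT d x) (hT d y))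
      map_smul' := fun c x => hTuniq d _ _ (A.graph.smul_mem c (hT d x)) }
  have hL (d : ℕ) : (L d).IsSymmetric := fun x y => hsym (hT d x) (hT d y)
  let ι := Σ d : ℕ, Fin (Module.finrank ℂ (W d))
  let v (i : ι) : H := ((hL i.1).eigenvectorBasis rfl i.2 : W i.1)
  let l (i : ι) : ℝ := (hL i.1).eigenvalues rfl i.2
  have hvA (i : ι) : (v i, (l i : ℂ) • v i) ∈ A.graph := by
    have h1 := hT i.1 ((hL i.1).eigenvectorBasis rfl i.2)
    have h2 : T i.1 ((hL i.1).eigenvectorBasis rfl i.2) = _ :=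
      (hL i.1).apply_eigenvectorBasis rfl i.2
    rw [h2] at h1
    exact h1
  have horth {d d' : ℕ} (h : d < d') (x : W d) (y : W d') : inner ℂ (x : H) (y : H) = 0 :=
    y.2.2 x (hmono h x.2.1)
  have hv : Orthonormal ℂ v := by
    constructor
    · intro i
      exact ((hL i.1).eigenvectorBasis rfl).orthonormal.1 i.2
    · rintro ⟨d, i⟩ ⟨d', j⟩ hij
      rcases lt_trichotomy d d' with h | rfl | h
      · exact horth h _ _
      · exact ((hL d).eigenvectorBasis rfl).orthonormal.2 fun h => hij (congrArg (Sigma.mk d) h)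
      · rw [← inner_conj_symm, horth h, map_zero]
  have hspanW (d : ℕ) : W d ≤ Submodule.span ℂ (Set.range v) := by
    intro x hx
    have h1 := ((hL d).eigenvectorBasis rfl).sum_repr ⟨x, hx⟩
    have h2 := congrArg (Submodule.subtype (W d)) h1
    rw [map_sum] at h2
    rw [show x = (W d).subtype ⟨x, hx⟩ from rfl, ← h2]
    refine Submodule.sum_mem _ fun i _ => ?_
    rw [map_smul]
    exact Submodule.smul_mem _ _ (Submodule.subset_span ⟨⟨d, i⟩, rfl⟩)
  have hspanV (d : ℕ) : V d ≤ Submodule.span ℂ (Set.range v) := by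
    induction d with
    | zero => rw [hV0]; exact bot_le
    | succ d ih =>
      intro x hx
      have h1 := (V d).starProjection_add_starProjection_orthogonal x
      have h2 : (V d).starProjection x ∈ V d := (V d).starProjection_apply_mem x
      have h3 : (V d)ᗮ.starProjection x ∈ (V d)ᗮ := (V d)ᗮ.starProjection_apply_mem x
      rw [← h1]
      refine Submodule.add_mem _ (ih h2) (hspanW d ⟨?_, h3⟩)
      rw [← eq_sub_iff_add_eq'] at h1
      rw [h1]
      exact Submodule.sub_mem _ hx (hmono (Nat.le_succ d) h2)
  have hdense' : ⊤ ≤ (Submodule.span ℂ (Set.range v)).topologicalClosure := by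
    rw [← hdense]
    exact Submodule.topologicalClosure_mono (iSup_le hspanV)
  refine ⟨ι, HilbertBasis.mk hv hdense', l, ?_, fun C => ?_⟩
  · rw [HilbertBasis.coe_mk]
    exact hvA
  -- With this `ε`, a unit eigenvector orthogonal to `V d` with `|l| ≤ C` would satisfy `1 ≤ (1 +
  -- l²) / (2 (1 + C²)) ≤ 1/2`. Hence such eigenvalues occur only in the finitely many increments
  -- below `d`.
  · obtain ⟨d, hd⟩ := hbig (1 / (2 * (1 + C ^ 2))) (by positivity)
    refine ((Finset.range d).sigma fun _ => Finset.univ).finite_toSet.subset ?_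
    rintro ⟨d', i⟩ hi
    replace hi : |l ⟨d', i⟩| ≤ C := hi
    rw [Finset.mem_coe, Finset.mem_sigma, Finset.mem_range]
    refine ⟨?_, Finset.mem_univ _⟩
    by_contra! hdd
    have h1 : v ⟨d', i⟩ ∈ W d' := ((hL d').eigenvectorBasis rfl i).2
    have h2 := hd (d' + 1) _ h1.1 (Submodule.orthogonal_le (hmono hdd) h1.2) _ (hvA ⟨d', i⟩)
    rw [norm_smul, hv.1, Complex.norm_real, Real.norm_eq_abs] at h2
    have h3 : |l ⟨d', i⟩| ^ 2 ≤ C ^ 2 := pow_le_pow_left₀ (abs_nonneg _) hi 2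
    rw [div_mul_eq_mul_div, le_div_iff₀ (by positivity)] at h2
    nlinarith

end Abstract

/-! ### Smooth functions on powers of a Lie group -/

section PiManifold
variable {EG : Type*} [NormedAddCommGroup EG] [NormedSpace ℝ EG]
  {G : Type*} [TopologicalSpace G] [ChartedSpace EG G] {n : ℕ}

variable (EG) in
/-- Smooth functions on `Gⁿ` with values in a vector space. -/
abbrev SmoothFun {W : Type*} [NormedAddCommGroup W] [NormedSpace ℝ W] (f : (Fin n → G) → W) : Prop :=
  ContMDiff (ModelWithCorners.pi fun _ : Fin n => 𝓘(ℝ, EG)) 𝓘(ℝ, W) ∞ f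

/-- The charts of the product are products of charts, so in charts this map is a coordinate
projection of `Fin n → EG`. -/
theorem contMDiff_apply_pi [IsManifold 𝓘(ℝ, EG) ∞ G] (k : Fin n) :
    ContMDiff (ModelWithCorners.pi fun _ : Fin n => 𝓘(ℝ, EG)) 𝓘(ℝ, EG) ∞
      fun x : Fin n → G => x k := by
  intro x
  rw [contMDiffAt_iff]
  refine ⟨(continuous_apply k).continuousAt, ?_⟩
  have h1 : ContDiffWithinAt ℝ ∞ (fun y : Fin n → EG => y k)
      (Set.range (ModelWithCorners.pi fun _ : Fin n => 𝓘(ℝ, EG)))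
      (extChartAt (ModelWithCorners.pi fun _ : Fin n => 𝓘(ℝ, EG)) x x) :=
    (contDiff_apply ℝ EG k).contDiffWithinAt
  have key : ∀ y : Fin n → EG, y k ∈ (extChartAt 𝓘(ℝ, EG) (x k)).target →
      (extChartAt 𝓘(ℝ, EG) (x k) ∘ (fun x : Fin n → G => x k) ∘
        (extChartAt (ModelWithCorners.pi fun _ : Fin n => 𝓘(ℝ, EG)) x).symm) y = y k := fun y hy =>
    (extChartAt 𝓘(ℝ, EG) (x k)).right_inv hy
  have hx : (extChartAt (ModelWithCorners.pi fun _ : Fin n => 𝓘(ℝ, EG)) x x) k ∈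
      (extChartAt 𝓘(ℝ, EG) (x k)).target := mem_extChartAt_target (I := 𝓘(ℝ, EG)) (x k)
  refine h1.congr_of_eventuallyEq ?_ (key _ hx)
  refine Filter.Eventually.filter_mono nhdsWithin_le_nhds ?_
  have h2 : {y : Fin n → EG | y k ∈ (extChartAt 𝓘(ℝ, EG) (x k)).target} ∈
      nhds (extChartAt (ModelWithCorners.pi fun _ : Fin n => 𝓘(ℝ, EG)) x x) :=
    ((isOpen_extChartAt_target (I := 𝓘(ℝ, EG)) (x k)).preimage (continuous_apply k)).mem_nhds hx
  filter_upwards [h2] with y hy using key y hy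

theorem contMDiffAt_pi_mk {EM HM M : Type*} [NormedAddCommGroup EM] [NormedSpace ℝ EM]
    [TopologicalSpace HM] {J : ModelWithCorners ℝ EM HM} [TopologicalSpace M] [ChartedSpace HM M]
    {f : M → Fin n → G} {x : M} (hf : ∀ k, ContMDiffAt J 𝓘(ℝ, EG) ∞ (fun y => f y k) x) :
    ContMDiffAt J (ModelWithCorners.pi fun _ : Fin n => 𝓘(ℝ, EG)) ∞ f x := by
  rw [contMDiffAt_iff]
  refine ⟨continuousAt_pi.2 fun k => (hf k).continuousAt, ?_⟩
  rw [contDiffWithinAt_pi]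
  exact fun k => (contMDiffAt_iff.1 (hf k)).2

theorem contMDiff_pi_mk {EM HM M : Type*} [NormedAddCommGroup EM] [NormedSpace ℝ EM]
    [TopologicalSpace HM] {J : ModelWithCorners ℝ EM HM} [TopologicalSpace M] [ChartedSpace HM M]
    {f : M → Fin n → G} (hf : ∀ k, ContMDiff J 𝓘(ℝ, EG) ∞ (fun y => f y k)) :
    ContMDiff J (ModelWithCorners.pi fun _ : Fin n => 𝓘(ℝ, EG)) ∞ f :=
  fun x => contMDiffAt_pi_mk fun k => hf k x

end PiManifold

/-! ### Left-invariant derivatives in a chart -/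

section Chart
variable {EG : Type*} [NormedAddCommGroup EG] [NormedSpace ℝ EG]
  {G : Type*} [TopologicalSpace G] [ChartedSpace EG G] [Group G] {n : ℕ}

/-- The inverse of the chart at the identity, centred so that `lieExp 0 = 1`. -/
def lieExp (u : EG) : G := (extChartAt 𝓘(ℝ, EG) (1 : G)).symm (extChartAt 𝓘(ℝ, EG) (1 : G) 1 + u)

/-- The chart at the identity, centred so that `lieLog 1 = 0`. -/
def lieLog (g : G) : EG := extChartAt 𝓘(ℝ, EG) (1 : G) g - extChartAt 𝓘(ℝ, EG) (1 : G) 1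

variable (EG G) in
/-- The domain of `lieExp`. -/
def expDomain : Set EG := {u | extChartAt 𝓘(ℝ, EG) (1 : G) 1 + u ∈ (extChartAt 𝓘(ℝ, EG) (1 : G)).target}

theorem isOpen_expDomain : IsOpen (expDomain EG G) :=
  (isOpen_extChartAt_target (I := 𝓘(ℝ, EG)) (1 : G)).preimage (by fun_prop)

theorem zero_mem_expDomain : (0 : EG) ∈ expDomain EG G := by
  rw [expDomain, Set.mem_ofPred_eq, add_zero]
  exact mem_extChartAt_target (I := 𝓘(ℝ, EG)) (1 : G)

theorem expDomain_mem_nhds : expDomain EG G ∈ nhds (0 : EG) :=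
  isOpen_expDomain.mem_nhds zero_mem_expDomain

theorem lieExp_zero : lieExp (0 : EG) = (1 : G) := by
  simp [lieExp]

theorem lieLog_one : lieLog (1 : G) = (0 : EG) := by
  simp [lieLog]

theorem lieLog_lieExp {u : EG} (hu : u ∈ expDomain EG G) : lieLog (lieExp u : G) = u := by
  rw [lieLog, lieExp, (extChartAt 𝓘(ℝ, EG) (1 : G)).right_inv hu]
  simp

theorem eventually_lieExp_lieLog : ∀ᶠ g in nhds (1 : G), lieExp (lieLog g : EG) = g := by
  filter_upwards [extChartAt_source_mem_nhds (I := 𝓘(ℝ, EG)) (1 : G)] with g hg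
  rw [lieExp, lieLog, add_sub_cancel]
  exact (extChartAt 𝓘(ℝ, EG) (1 : G)).left_inv hg

variable [IsManifold 𝓘(ℝ, EG) ∞ G]

theorem contMDiffAt_lieExp {u : EG} (hu : u ∈ expDomain EG G) :
    ContMDiffAt 𝓘(ℝ, EG) 𝓘(ℝ, EG) ∞ (lieExp : EG → G) u := by
  have h1 : ContMDiffAt 𝓘(ℝ, EG) 𝓘(ℝ, EG) ∞ (extChartAt 𝓘(ℝ, EG) (1 : G)).symm
      (extChartAt 𝓘(ℝ, EG) (1 : G) 1 + u) :=
    (contMDiffOn_extChartAt_symm (1 : G)).contMDiffAt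
      ((isOpen_extChartAt_target (I := 𝓘(ℝ, EG)) (1 : G)).mem_nhds hu)
  exact h1.comp u (by
    rw [contMDiffAt_iff_contDiffAt]
    fun_prop)

theorem contMDiffAt_lieLog : ∀ᶠ g in nhds (1 : G),
    ContMDiffAt 𝓘(ℝ, EG) 𝓘(ℝ, EG) ∞ (lieLog : G → EG) g := by
  filter_upwards [extChartAt_source_mem_nhds (I := 𝓘(ℝ, EG)) (1 : G)] with g hg
  rw [extChartAt_source] at hg
  exact (contMDiffAt_extChartAt' hg).sub contMDiffAt_const

end Chart

section Deriv
variable {EG : Type*} [NormedAddCommGroup EG] [NormedSpace ℝ EG]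
  {G : Type*} [TopologicalSpace G] [ChartedSpace EG G] [Group G] {n : ℕ}
  [LieGroup 𝓘(ℝ, EG) ∞ G]
  {W : Type*} [NormedAddCommGroup W] [NormedSpace ℝ W]

theorem contMDiff_mul_mulSingle (k : Fin n) :
    ContMDiff ((ModelWithCorners.pi fun _ : Fin n => 𝓘(ℝ, EG)).prod 𝓘(ℝ, EG))
      (ModelWithCorners.pi fun _ : Fin n => 𝓘(ℝ, EG)) ∞
      fun p : (Fin n → G) × G => p.1 * Pi.mulSingle k p.2 := by
  refine contMDiff_pi_mk fun i => ?_
  have h1 : ContMDiff ((ModelWithCorners.pi fun _ : Fin n => 𝓘(ℝ, EG)).prod 𝓘(ℝ, EG)) 𝓘(ℝ, EG) ∞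
      fun p : (Fin n → G) × G => p.1 i := (contMDiff_apply_pi i).comp contMDiff_fst
  by_cases h : i = k
  · subst h
    simp only [Pi.mul_apply, Pi.mulSingle_eq_same]
    exact h1.mul contMDiff_snd
  · simpa only [Pi.mul_apply, Pi.mulSingle_eq_of_ne h, mul_one] using h1

/-- `f` along the curves `u ↦ x * lieExp u` in the `k`-th variable. -/
def expCurve (k : Fin n) (f : (Fin n → G) → W) (x : Fin n → G) (u : EG) : W :=
  f (x * Pi.mulSingle k (lieExp u))

theorem contMDiffAt_expCurve (k : Fin n) {f : (Fin n → G) → W} (hf : SmoothFun EG f)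
    {EM HM M : Type*} [NormedAddCommGroup EM] [NormedSpace ℝ EM]
    [TopologicalSpace HM] {J : ModelWithCorners ℝ EM HM} [TopologicalSpace M] [ChartedSpace HM M]
    {x : M → Fin n → G} {u : M → EG} {p : M}
    (hx : ContMDiffAt J (ModelWithCorners.pi fun _ : Fin n => 𝓘(ℝ, EG)) ∞ x p)
    (hu : ContMDiffAt J 𝓘(ℝ, EG) ∞ u p) (hp : u p ∈ expDomain EG G) :
    ContMDiffAt J 𝓘(ℝ, W) ∞ (fun q => expCurve k f (x q) (u q)) p :=
  hf.contMDiffAt.comp p ((contMDiff_mul_mulSingle k).contMDiffAt.comp p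
    (hx.prodMk ((contMDiffAt_lieExp hp).comp p hu)))

theorem contDiffAt_expCurve (k : Fin n) {f : (Fin n → G) → W} (hf : SmoothFun EG f)
    (x : Fin n → G) {u : EG} (hu : u ∈ expDomain EG G) : ContDiffAt ℝ ∞ (expCurve k f x) u := by
  rw [← contMDiffAt_iff_contDiffAt]
  exact contMDiffAt_expCurve k hf contMDiffAt_const contMDiffAt_id hu

theorem differentiableAt_expCurve (k : Fin n) {f : (Fin n → G) → W} (hf : SmoothFun EG f)
    (x : Fin n → G) {u : EG} (hu : u ∈ expDomain EG G) : DifferentiableAt ℝ (expCurve k f x) u :=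
  (contDiffAt_expCurve k hf x hu).differentiableAt (by simp)

omit [TopologicalSpace G] in
theorem mul_mulSingle_eq_update (x : Fin n → G) (k : Fin n) (g : G) :
    x * Pi.mulSingle k g = Function.update x k (x k * g) := by
  funext i
  by_cases h : i = k
  · subst h; simp
  · simp [h]

/-- The left-invariant derivative in the `k`-th variable, computed in the chart at the identity. -/
def chartDeriv (k : Fin n) (v : EG) (f : (Fin n → G) → W) (x : Fin n → G) : W :=
  fderiv ℝ (expCurve k f x) (0 : EG) v

/-- The left-invariant field at `x k` is the image of `v` under left multiplication by `x k`, so the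
chain rule moves the derivative to the identity, where one chart serves all points. -/
theorem leftDeriv_eq_chartDeriv (k : Fin n) (v : GroupLieAlgebra 𝓘(ℝ, EG) G) {f : (Fin n → G) → W}
    (hf : SmoothFun EG f) (x : Fin n → G) :
    leftDeriv k v f x = chartDeriv (EG := EG) k v f x := by
  have hup : ContMDiff 𝓘(ℝ, EG) (ModelWithCorners.pi fun _ : Fin n => 𝓘(ℝ, EG)) ∞
      fun g : G => Function.update x k g := by
    refine contMDiff_pi_mk fun i => ?_
    by_cases h : i = k
    · subst h; simpa using! contMDiff_id
    · simpa [h] using contMDiff_const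
  have hF : MDifferentiableAt 𝓘(ℝ, EG) 𝓘(ℝ, W) (fun g : G => f (Function.update x k g)) (x k) :=
    (hf.comp hup).mdifferentiable (by simp) _
  -- The chain rule evaluates the outer derivative at the image of `1`, which is literally `x k *
  -- 1`.
  have hF' : MDifferentiableAt 𝓘(ℝ, EG) 𝓘(ℝ, W) (fun g : G => f (Function.update x k g)) (x k * 1) := by
    rwa [mul_one]
  have hL : MDifferentiableAt 𝓘(ℝ, EG) 𝓘(ℝ, EG) (fun g : G => x k * g) (1 : G) :=
    (contMDiff_mul_left (I := 𝓘(ℝ, EG)) (n := ∞)).mdifferentiable (by simp) _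
  have h1 : leftDeriv k v f x =
      mfderiv 𝓘(ℝ, EG) 𝓘(ℝ, W) (fun g : G => f (x * Pi.mulSingle k g)) (1 : G) v := by
    have h2 : (fun g : G => f (x * Pi.mulSingle k g)) =
        (fun g : G => f (Function.update x k g)) ∘ fun g => x k * g := by
      funext g
      simp only [Function.comp_apply, mul_mulSingle_eq_update]
    rw [h2, mfderiv_comp (I' := 𝓘(ℝ, EG)) (1 : G) hF' hL]
    simp only [leftDeriv, mulInvariantVectorField]
    change _ = (mfderiv 𝓘(ℝ, EG) 𝓘(ℝ, W) _ (x k * 1)) _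
    rw [mul_one]
    rfl
  rw [h1]
  have hM : MDifferentiableAt 𝓘(ℝ, EG) 𝓘(ℝ, W) (fun g : G => f (x * Pi.mulSingle k g)) (1 : G) := by
    have : ContMDiff 𝓘(ℝ, EG) 𝓘(ℝ, W) ∞ (fun g : G => f (x * Pi.mulSingle k g)) :=
      hf.comp ((contMDiff_mul_mulSingle k).comp (contMDiff_const.prodMk contMDiff_id))
    exact this.mdifferentiable (by simp) _
  rw [hM.mfderiv]
  have h3 : expCurve k f x = fun u => (writtenInExtChartAt 𝓘(ℝ, EG) 𝓘(ℝ, W) (1 : G)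
      (fun g : G => f (x * Pi.mulSingle k g))) (extChartAt 𝓘(ℝ, EG) (1 : G) 1 + u) := by
    funext u
    simp only [expCurve, lieExp, writtenInExtChartAt, extChartAt_model_space_eq_id,
      Function.comp_apply, PartialEquiv.refl_coe, id]
  change _ = fderiv ℝ (expCurve k f x) (0 : EG) v
  rw [h3, fderiv_comp_add_left, add_zero]
  simp [fderivWithin_univ]
  rfl

end Deriv

section Deriv
variable {EG : Type*} [NormedAddCommGroup EG] [NormedSpace ℝ EG]
  {G : Type*} [TopologicalSpace G] [ChartedSpace EG G] [Group G] {n : ℕ}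
  [LieGroup 𝓘(ℝ, EG) ∞ G]
  {W : Type*} [NormedAddCommGroup W] [NormedSpace ℝ W]

/-- In charts around the `x₀ i` the curve becomes a smooth function `Ψ` of two vector variables, and
the derivative in `u` alone is the full derivative of `Ψ` restricted to the second factor. -/
theorem continuousAt_fderiv_expCurve (k : Fin n) {f : (Fin n → G) → W} (hf : SmoothFun EG f)
    (x₀ : Fin n → G) {u₀ : EG} (hu₀ : u₀ ∈ expDomain EG G) :
    ContinuousAt (fun p : (Fin n → G) × EG => fderiv ℝ (expCurve k f p.1) p.2) (x₀, u₀) := by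
  let X (y : Fin n → EG) : Fin n → G := fun i => (extChartAt 𝓘(ℝ, EG) (x₀ i)).symm (y i)
  let Y (x : Fin n → G) : Fin n → EG := fun i => extChartAt 𝓘(ℝ, EG) (x₀ i) (x i)
  have hX : ContMDiffAt 𝓘(ℝ, Fin n → EG) (ModelWithCorners.pi fun _ : Fin n => 𝓘(ℝ, EG)) ∞ X
      (Y x₀) := by
    refine contMDiffAt_pi_mk fun i => ?_
    have h1 : ContMDiffAt 𝓘(ℝ, EG) 𝓘(ℝ, EG) ∞ (extChartAt 𝓘(ℝ, EG) (x₀ i)).symm (Y x₀ i) :=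
      (contMDiffOn_extChartAt_symm (x₀ i)).contMDiffAt (extChartAt_target_mem_nhds (x₀ i))
    have h2 : ContMDiffAt 𝓘(ℝ, Fin n → EG) 𝓘(ℝ, EG) ∞ (fun y : Fin n → EG => y i) (Y x₀) :=
      (contMDiffAt_iff_contDiffAt).2 (contDiff_apply ℝ EG i).contDiffAt
    exact h1.comp (Y x₀) h2
  have hY : ContinuousAt Y x₀ := continuousAt_pi.2 fun i =>
    ContinuousAt.comp (f := fun x : Fin n → G => x i) (x := x₀)
      (continuousAt_extChartAt (I := 𝓘(ℝ, EG)) (x₀ i)) (continuous_apply i).continuousAt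
  have hYX : ∀ᶠ x in nhds x₀, X (Y x) = x := by
    have h1 : ∀ᶠ x in nhds x₀, ∀ i, x i ∈ (extChartAt 𝓘(ℝ, EG) (x₀ i)).source :=
      Filter.eventually_all.2 fun i =>
        (continuous_apply i).continuousAt.preimage_mem_nhds
          (extChartAt_source_mem_nhds (I := 𝓘(ℝ, EG)) (x₀ i))
    filter_upwards [h1] with x hx
    funext i
    exact (extChartAt 𝓘(ℝ, EG) (x₀ i)).left_inv (hx i)
  let Ψ (p : (Fin n → EG) × EG) : W := expCurve k f (X p.1) p.2
  have hΨ : ContDiffAt ℝ ∞ Ψ (Y x₀, u₀) := by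
    rw [← contMDiffAt_iff_contDiffAt]
    exact contMDiffAt_expCurve k hf
      (hX.comp (Y x₀, u₀) ((contMDiffAt_iff_contDiffAt).2 contDiffAt_fst))
      ((contMDiffAt_iff_contDiffAt).2 contDiffAt_snd) hu₀
  have hΨ' : ContinuousAt (fun p => (fderiv ℝ Ψ p).comp
      (ContinuousLinearMap.inr ℝ (Fin n → EG) EG)) (Y x₀, u₀) :=
    (hΨ.continuousAt_fderiv (by simp)).clm_comp continuousAt_const
  have hpt : ContinuousAt (fun p : (Fin n → G) × EG => (Y p.1, p.2)) (x₀, u₀) :=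
    (ContinuousAt.comp (f := Prod.fst) (x := (x₀, u₀)) hY continuousAt_fst).prodMk continuousAt_snd
  refine (ContinuousAt.comp (f := fun p : (Fin n → G) × EG => (Y p.1, p.2)) (x := (x₀, u₀))
    hΨ' hpt).congr ?_
  have hd : ∀ᶠ p in nhds (Y x₀, u₀), DifferentiableAt ℝ Ψ p :=
    ((hΨ.of_le (m := 1) (by simp)).eventually (by simp)).mono fun p hp => hp.differentiableAt (by simp)
  filter_upwards [hpt.eventually hd, continuousAt_fst.eventually (p := fun x => X (Y x) = x) hYX]
    with p hp hp'
  have h2 : HasFDerivAt (fun u : EG => (Y p.1, u)) (ContinuousLinearMap.inr ℝ (Fin n → EG) EG) p.2 :=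
    hasFDerivAt_prodMk_right _ _
  have h3 := (hp.hasFDerivAt.comp p.2 h2).fderiv
  have h4 : Ψ ∘ (fun u : EG => (Y p.1, u)) = expCurve k f p.1 := by
    funext u
    simp only [Ψ, Function.comp_apply, hp']
  rw [h4] at h3
  exact h3.symm

theorem continuous_chartDeriv (k : Fin n) (v : EG) {f : (Fin n → G) → W}
    (hf : SmoothFun EG f) : Continuous (chartDeriv k v f) := by
  rw [continuous_iff_continuousAt]
  intro x
  have h2 := continuousAt_fderiv_expCurve k hf x (zero_mem_expDomain (EG := EG) (G := G))
  have h3 : ContinuousAt (fun x : Fin n → G => (x, (0 : EG))) x := by fun_prop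
  exact (ContinuousAt.comp (f := fun x : Fin n → G => (x, (0 : EG))) h2 h3).clm_apply
    continuousAt_const

/-- Joint continuity and compactness of `Gⁿ` make the bound uniform in `x`. It is the domination
needed to differentiate under the integral sign. -/
theorem exists_bound_fderiv_expCurve [CompactSpace G] (k : Fin n) {f : (Fin n → G) → W}
    (hf : SmoothFun EG f) :
    ∃ C, ∀ᶠ u in nhds (0 : EG), ∀ x : Fin n → G, ‖fderiv ℝ (expCurve k f x) u‖ ≤ C := by
  have hc : Continuous fun x : Fin n → G => fderiv ℝ (expCurve k f x) (0 : EG) := by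
    rw [continuous_iff_continuousAt]
    intro x
    have h3 : ContinuousAt (fun x : Fin n → G => (x, (0 : EG))) x := by fun_prop
    exact ContinuousAt.comp (f := fun x : Fin n → G => (x, (0 : EG)))
      (continuousAt_fderiv_expCurve k hf x zero_mem_expDomain) h3
  obtain ⟨C, hC⟩ := isCompact_univ.exists_bound_of_continuousOn hc.continuousOn
  refine ⟨C + 1, ?_⟩
  have := isCompact_univ.eventually_forall_of_forall_eventually (x₀ := (0 : EG))
    (P := fun (u : EG) (x : Fin n → G) => ‖fderiv ℝ (expCurve k f x) u‖ < C + 1) fun x _ => by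
      have h1 : ContinuousAt (fun p : EG × (Fin n → G) => ‖fderiv ℝ (expCurve k f p.2) p.1‖)
          ((0 : EG), x) :=
        (ContinuousAt.comp (f := Prod.swap) (x := ((0 : EG), x))
          (continuousAt_fderiv_expCurve k hf x zero_mem_expDomain) continuous_swap.continuousAt).norm
      exact h1.eventually_lt_const ((hC x trivial).trans_lt (lt_add_one C))
  exact this.mono fun u hu x => (hu x trivial).le

/-- Left-trivialized derivative of `lieExp`. -/
def expTheta (G : Type*) [TopologicalSpace G] [ChartedSpace EG G] [Group G] (u : EG) : EG →L[ℝ] EG :=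
  fderiv ℝ (fun u' : EG => lieLog ((lieExp u : G)⁻¹ * lieExp u')) u

/-- The adjoint action of `g⁻¹` in the chart. -/
def expAd (g : G) : EG →L[ℝ] EG :=
  fderiv ℝ (fun u : EG => lieLog (g⁻¹ * lieExp u * g)) (0 : EG)

/-- The map is a partial derivative, taken on the diagonal, of a function smooth near the origin,
and so is continuous at `0`. -/
theorem exists_bound_expTheta : ∃ C, ∀ᶠ u in nhds (0 : EG), ‖expTheta G u‖ ≤ C := by
  let Ψ (p : EG × EG) : EG := lieLog ((lieExp p.1 : G)⁻¹ * lieExp p.2)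
  have hΨ : ContDiffAt ℝ ∞ Ψ (0, 0) := by
    rw [← contMDiffAt_iff_contDiffAt]
    have h1 : ContMDiffAt 𝓘(ℝ, EG × EG) 𝓘(ℝ, EG) ∞ (fun p : EG × EG => (lieExp p.1 : G)) (0, 0) :=
      ContMDiffAt.comp (f := Prod.fst) ((0 : EG), (0 : EG)) (contMDiffAt_lieExp zero_mem_expDomain)
        ((contMDiffAt_iff_contDiffAt).2 contDiffAt_fst)
    have h2 : ContMDiffAt 𝓘(ℝ, EG × EG) 𝓘(ℝ, EG) ∞ (fun p : EG × EG => (lieExp p.2 : G)) (0, 0) :=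
      ContMDiffAt.comp (f := Prod.snd) ((0 : EG), (0 : EG)) (contMDiffAt_lieExp zero_mem_expDomain)
        ((contMDiffAt_iff_contDiffAt).2 contDiffAt_snd)
    have h3 : ContMDiffAt 𝓘(ℝ, EG) 𝓘(ℝ, EG) ∞ (lieLog : G → EG) ((lieExp (0 : EG))⁻¹ * lieExp (0 : EG)) := by
      rw [lieExp_zero, inv_one, one_mul]
      exact contMDiffAt_lieLog.self_of_nhds
    exact ContMDiffAt.comp (f := fun p : EG × EG => (lieExp p.1 : G)⁻¹ * lieExp p.2)
      ((0 : EG), (0 : EG)) h3 (h1.inv.mul h2)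
  have hΨ' : ContinuousAt (fun p => (fderiv ℝ Ψ p).comp (ContinuousLinearMap.inr ℝ EG EG)) (0, 0) :=
    (hΨ.continuousAt_fderiv (by simp)).clm_comp continuousAt_const
  have hpt : ContinuousAt (fun u : EG => (u, u)) 0 := by fun_prop
  have h4 := (ContinuousAt.comp (f := fun u : EG => (u, u)) (x := 0) hΨ' hpt).norm
  obtain ⟨C, hC⟩ : ∃ C, ∀ᶠ u in nhds (0 : EG),
      ‖(fderiv ℝ Ψ (u, u)).comp (ContinuousLinearMap.inr ℝ EG EG)‖ < C :=
    ⟨_, h4.eventually_lt_const (lt_add_one _)⟩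
  refine ⟨C, (hC.and (hpt.eventually
    ((hΨ.of_le (m := 1) (by simp)).eventually (by simp)))).mono fun u hu => ?_⟩
  refine le_trans (le_of_eq ?_) hu.1.le
  have h2 : HasFDerivAt (fun u' : EG => (u, u')) (ContinuousLinearMap.inr ℝ EG EG) u :=
    hasFDerivAt_prodMk_right _ _
  exact congrArg norm ((hu.2.differentiableAt (by simp)).hasFDerivAt.comp u h2).fderiv

/-- Since `lieExp` is only a chart, its curves are not one-parameter subgroups. Writing `lieExp u'`
as `lieExp u` times a point near the identity recentres the derivative at `0`, at the cost of the
correction `expTheta`. -/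
theorem fderiv_expCurve_eq_chartDeriv (k : Fin n) {f : (Fin n → G) → W} (hf : SmoothFun EG f)
    (x : Fin n → G) {u : EG} (hu : u ∈ expDomain EG G) (w : EG) :
    fderiv ℝ (expCurve k f x) u w =
      chartDeriv k (expTheta G u w) f (x * Pi.mulSingle k (lieExp u)) := by
  have h1 : ContMDiffAt 𝓘(ℝ, EG) 𝓘(ℝ, EG) ∞ (fun u' : EG => (lieExp u : G)⁻¹ * lieExp u') u :=
    contMDiffAt_const.mul (contMDiffAt_lieExp hu)
  have h2 : (lieExp u : G)⁻¹ * lieExp u = 1 := by simp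
  have h3 : DifferentiableAt ℝ (fun u' : EG => (lieLog ((lieExp u : G)⁻¹ * lieExp u') : EG)) u := by
    have h3 : ContMDiffAt 𝓘(ℝ, EG) 𝓘(ℝ, EG) ∞ (lieLog : G → EG) ((lieExp u)⁻¹ * lieExp u) := by
      rw [h2]
      exact contMDiffAt_lieLog.self_of_nhds
    exact ((contMDiffAt_iff_contDiffAt).1 (ContMDiffAt.comp
      (f := fun u' : EG => (lieExp u : G)⁻¹ * lieExp u') u h3 h1)).differentiableAt (by simp)
  have h4 : lieLog ((lieExp u : G)⁻¹ * lieExp u) = (0 : EG) := by rw [h2, lieLog_one]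
  have h5 := differentiableAt_expCurve k hf (x * Pi.mulSingle k (lieExp u))
    (zero_mem_expDomain (EG := EG) (G := G))
  rw [← h4] at h5
  have h6 := (h5.hasFDerivAt.comp u h3.hasFDerivAt).fderiv
  rw [h4] at h6
  have h7 : expCurve k f x =ᶠ[nhds u] expCurve k f (x * Pi.mulSingle k (lieExp u)) ∘
      fun u' : EG => (lieLog ((lieExp u : G)⁻¹ * lieExp u') : EG) := by
    have h8 := h1.continuousAt.eventually (p := fun g : G => lieExp (lieLog g : EG) = g)
      (by simp only [h2]; exact eventually_lieExp_lieLog)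
    filter_upwards [h8] with u' hu'
    simp only [expCurve, Function.comp_apply, hu', mul_assoc, ← Pi.mulSingle_mul,
      mul_inv_cancel_left]
  rw [h7.fderiv_eq, h6]
  rfl

/-- Moving `g` past the curve uses `lieExp u * g = g * (g⁻¹ * lieExp u * g)`, and the conjugated
curve has velocity `expAd g v` at `0`. -/
theorem chartDeriv_mul_right_same (k : Fin n) {f : (Fin n → G) → W} (hf : SmoothFun EG f)
    (g : G) (v : EG) (x : Fin n → G) :
    chartDeriv k v (fun y => f (y * Pi.mulSingle k g)) x =
      chartDeriv k (expAd g v) f (x * Pi.mulSingle k g) := by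
  have h1 : ContMDiffAt 𝓘(ℝ, EG) 𝓘(ℝ, EG) ∞ (fun u : EG => g⁻¹ * lieExp u * g) 0 :=
    (contMDiffAt_const.mul (contMDiffAt_lieExp zero_mem_expDomain)).mul contMDiffAt_const
  have h2 : g⁻¹ * lieExp (0 : EG) * g = 1 := by simp [lieExp_zero]
  have h3 : DifferentiableAt ℝ (fun u : EG => (lieLog (g⁻¹ * lieExp u * g) : EG)) 0 := by
    have h3 : ContMDiffAt 𝓘(ℝ, EG) 𝓘(ℝ, EG) ∞ (lieLog : G → EG) (g⁻¹ * lieExp (0 : EG) * g) := by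
      rw [h2]
      exact contMDiffAt_lieLog.self_of_nhds
    exact ((contMDiffAt_iff_contDiffAt).1 (ContMDiffAt.comp
      (f := fun u : EG => g⁻¹ * lieExp u * g) 0 h3 h1)).differentiableAt (by simp)
  have h4 : lieLog (g⁻¹ * lieExp (0 : EG) * g) = (0 : EG) := by rw [h2, lieLog_one]
  have h5 := differentiableAt_expCurve k hf (x * Pi.mulSingle k g)
    (zero_mem_expDomain (EG := EG) (G := G))
  rw [← h4] at h5
  have h6 := (h5.hasFDerivAt.comp 0 h3.hasFDerivAt).fderiv
  rw [h4] at h6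
  have h7 : expCurve k (fun y => f (y * Pi.mulSingle k g)) x =ᶠ[nhds (0 : EG)]
      expCurve k f (x * Pi.mulSingle k g) ∘
        fun u : EG => (lieLog (g⁻¹ * lieExp u * g) : EG) := by
    have h8 := h1.continuousAt.eventually (p := fun g : G => lieExp (lieLog g : EG) = g)
      (by simp only [h2]; exact eventually_lieExp_lieLog)
    filter_upwards [h8] with u hu
    rw [mul_assoc] at hu
    simp only [expCurve, Function.comp_apply, hu, mul_assoc, ← Pi.mulSingle_mul,
      mul_inv_cancel_left]
  rw [chartDeriv, h7.fderiv_eq, h6]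
  rfl

omit [LieGroup 𝓘(ℝ, EG) ∞ G] in
-- Elements supported in different factors of `Gⁿ` commute.
theorem chartDeriv_mul_right_of_ne {k l : Fin n} (hkl : k ≠ l) (f : (Fin n → G) → W) (g : G)
    (v : EG) (x : Fin n → G) :
    chartDeriv k v (fun y => f (y * Pi.mulSingle l g)) x =
      chartDeriv k v f (x * Pi.mulSingle l g) := by
  have h1 : expCurve k (fun y => f (y * Pi.mulSingle l g)) x =
      (expCurve k f (x * Pi.mulSingle l g) : EG → W) := by
    funext u
    simp only [expCurve, mul_assoc]
    rw [show (Pi.mulSingle l g * Pi.mulSingle k (lieExp u) : Fin n → G) =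
      Pi.mulSingle k (lieExp u) * Pi.mulSingle l g from
        (Pi.mulSingle_commute (f := fun _ : Fin n => G) hkl.symm g (lieExp u)).eq]
  rw [chartDeriv, h1, chartDeriv]

/-- The vector `z` is a mixed second derivative of the conjugation map in the chart. It plays the
role of a Lie bracket, but only its existence matters below. -/
theorem hasDerivAt_expAd (w v : EG) :
    ∃ z : EG, HasDerivAt (fun t : ℝ => expAd (lieExp (t • w) : G) v) z 0 := by
  let Ψ (p : EG × EG) : EG := lieLog ((lieExp p.1 : G)⁻¹ * lieExp p.2 * lieExp p.1)
  have hΨ : ContDiffAt ℝ ∞ Ψ (0, 0) := by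
    rw [← contMDiffAt_iff_contDiffAt]
    have h1 : ContMDiffAt 𝓘(ℝ, EG × EG) 𝓘(ℝ, EG) ∞ (fun p : EG × EG => (lieExp p.1 : G)) (0, 0) :=
      ContMDiffAt.comp (f := Prod.fst) ((0 : EG), (0 : EG)) (contMDiffAt_lieExp zero_mem_expDomain)
        ((contMDiffAt_iff_contDiffAt).2 contDiffAt_fst)
    have h2 : ContMDiffAt 𝓘(ℝ, EG × EG) 𝓘(ℝ, EG) ∞ (fun p : EG × EG => (lieExp p.2 : G)) (0, 0) :=
      ContMDiffAt.comp (f := Prod.snd) ((0 : EG), (0 : EG)) (contMDiffAt_lieExp zero_mem_expDomain)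
        ((contMDiffAt_iff_contDiffAt).2 contDiffAt_snd)
    have h3 : ContMDiffAt 𝓘(ℝ, EG) 𝓘(ℝ, EG) ∞ (lieLog : G → EG)
        ((lieExp (0 : EG))⁻¹ * lieExp (0 : EG) * lieExp (0 : EG)) := by
      rw [lieExp_zero, inv_one, one_mul, one_mul]
      exact contMDiffAt_lieLog.self_of_nhds
    exact ContMDiffAt.comp (f := fun p : EG × EG => (lieExp p.1 : G)⁻¹ * lieExp p.2 * lieExp p.1)
      ((0 : EG), (0 : EG)) h3 ((h1.inv.mul h2).mul h1)
  have h4 : ContDiffAt ℝ 1 (fderiv ℝ Ψ) (0, 0) := hΨ.fderiv_right (by norm_cast)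
  have h5 : DifferentiableAt ℝ (fun u : EG => fderiv ℝ Ψ (u, 0) (0, v)) 0 := by
    have h6 : DifferentiableAt ℝ (fun u : EG => (u, (0 : EG))) 0 := by fun_prop
    exact (DifferentiableAt.comp (f := fun u : EG => (u, (0 : EG))) (0 : EG)
      (h4.differentiableAt one_ne_zero) h6).clm_apply (differentiableAt_const _)
  have h7 : HasDerivAt (fun t : ℝ => t • w) w 0 := by
    simpa using (hasDerivAt_id (0 : ℝ)).smul_const w
  have h8 : DifferentiableAt ℝ (fun u : EG => fderiv ℝ Ψ (u, 0) (0, v)) ((0 : ℝ) • w) := by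
    rwa [zero_smul]
  refine ⟨_, (h8.hasFDerivAt.comp_hasDerivAt (0 : ℝ) h7).congr_of_eventuallyEq ?_⟩
  have h9 : ∀ᶠ t : ℝ in nhds 0, DifferentiableAt ℝ Ψ (t • w, 0) := by
    have h10 : ContinuousAt (fun t : ℝ => (t • w, (0 : EG))) 0 := by fun_prop
    refine h10.eventually (p := fun p => DifferentiableAt ℝ Ψ p) ?_
    simp only [zero_smul]
    exact ((hΨ.of_le (m := 1) (by simp)).eventually (by simp)).mono
      fun p hp => hp.differentiableAt (by simp)
  filter_upwards [h9] with t ht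
  have h2 : HasFDerivAt (fun u' : EG => (t • w, u')) (ContinuousLinearMap.inr ℝ EG EG) 0 :=
    hasFDerivAt_prodMk_right _ _
  have h11 := (ht.hasFDerivAt.comp (0 : EG) h2).fderiv
  exact congrArg (fun T : EG →L[ℝ] EG => T v) h11

end Deriv

/-! ### Linearity and product rules for left-invariant derivatives. -/

section Rules
variable {EG : Type*} [NormedAddCommGroup EG] [NormedSpace ℝ EG]
  {G : Type*} [TopologicalSpace G] [ChartedSpace EG G] [Group G] {n : ℕ}
  {W W' W'' : Type*} [NormedAddCommGroup W] [NormedSpace ℝ W]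
  [NormedAddCommGroup W'] [NormedSpace ℝ W'] [NormedAddCommGroup W''] [NormedSpace ℝ W'']

omit [NormedAddCommGroup W] [NormedSpace ℝ W] in
theorem expCurve_zero (k : Fin n) (f : (Fin n → G) → W) (x : Fin n → G) :
    expCurve k f x (0 : EG) = f x := by
  simp [expCurve, lieExp_zero]

theorem chartDeriv_eq_sum {ι : Type*} [Fintype ι] (b : Module.Basis ι ℝ EG) (k : Fin n) (v : EG)
    (f : (Fin n → G) → W) (x : Fin n → G) :
    chartDeriv k v f x = ∑ i, b.repr v i • chartDeriv k (b i) f x := by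
  conv_lhs => rw [← b.sum_repr v]
  simp only [chartDeriv, map_sum, map_smul]

variable [LieGroup 𝓘(ℝ, EG) ∞ G]

theorem chartDeriv_bilinear (B : W →L[ℝ] W' →L[ℝ] W'') (k : Fin n) (v : EG)
    {f : (Fin n → G) → W} {g : (Fin n → G) → W'} (hf : SmoothFun EG f) (hg : SmoothFun EG g)
    (x : Fin n → G) :
    chartDeriv k v (fun y => B (f y) (g y)) x =
      B (f x) (chartDeriv k v g x) + B (chartDeriv k v f x) (g x) := by
  have h := B.fderiv_of_bilinear
    (differentiableAt_expCurve k hf x (zero_mem_expDomain (EG := EG) (G := G)))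
    (differentiableAt_expCurve k hg x (zero_mem_expDomain (EG := EG) (G := G)))
  rw [expCurve_zero, expCurve_zero] at h
  exact congrArg (fun T : EG →L[ℝ] W'' => T v) h

theorem chartDeriv_linear (L : W →L[ℝ] W') (k : Fin n) (v : EG)
    {f : (Fin n → G) → W} (hf : SmoothFun EG f) (x : Fin n → G) :
    chartDeriv k v (fun y => L (f y)) x = L (chartDeriv k v f x) := by
  have h := L.hasFDerivAt.comp (0 : EG)
    (differentiableAt_expCurve k hf x (zero_mem_expDomain (EG := EG) (G := G))).hasFDerivAt
  exact congrArg (fun T : EG →L[ℝ] W' => T v) h.fderiv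

theorem chartDeriv_add (k : Fin n) (v : EG) {f g : (Fin n → G) → W} (hf : SmoothFun EG f)
    (hg : SmoothFun EG g) (x : Fin n → G) :
    chartDeriv k v (fun y => f y + g y) x = chartDeriv k v f x + chartDeriv k v g x :=
  congrArg (fun T : EG →L[ℝ] W => T v) (fderiv_add
    (differentiableAt_expCurve k hf x (zero_mem_expDomain (EG := EG) (G := G)))
    (differentiableAt_expCurve k hg x (zero_mem_expDomain (EG := EG) (G := G))))

end Rules

section Inner
variable {EG : Type*} [NormedAddCommGroup EG] [NormedSpace ℝ EG]
  {G : Type*} [TopologicalSpace G] [ChartedSpace EG G] [Group G] {n : ℕ}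
  {W : Type*} [NormedAddCommGroup W] [InnerProductSpace ℂ W]

omit [Group G] in
theorem smoothFun_inner {f g : (Fin n → G) → W} (hf : SmoothFun EG f) (hg : SmoothFun EG g) :
    SmoothFun EG fun x => inner ℂ (f x) (g x) := by
  have h : ContDiff ℝ ∞ fun p : W × W => inner ℂ p.1 p.2 := contDiff_inner
  exact (contMDiff_iff_contDiff.2 h).comp (hf.prodMk_space hg)

theorem chartDeriv_inner [LieGroup 𝓘(ℝ, EG) ∞ G] (k : Fin n) (v : EG) {f g : (Fin n → G) → W} (hf : SmoothFun EG f)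
    (hg : SmoothFun EG g) (x : Fin n → G) :
    chartDeriv k v (fun y => inner ℂ (f y) (g y)) x =
      inner ℂ (f x) (chartDeriv k v g x) + inner ℂ (chartDeriv k v f x) (g x) := by
  have h := fderiv_inner_apply ℂ
    (differentiableAt_expCurve k hf x (zero_mem_expDomain (EG := EG) (G := G)))
    (differentiableAt_expCurve k hg x (zero_mem_expDomain (EG := EG) (G := G))) v
  rw [expCurve_zero, expCurve_zero] at h
  exact h

end Inner

/-! ### Integration over `Gⁿ` and left-invariant derivatives. -/

section Integral
variable {EG : Type*} [NormedAddCommGroup EG] [NormedSpace ℝ EG]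
  {G : Type*} [TopologicalSpace G] [ChartedSpace EG G] [Group G] {n : ℕ}
  [LieGroup 𝓘(ℝ, EG) ∞ G] [IsTopologicalGroup G] [T2Space G] [SecondCountableTopology G]
  [CompactSpace G] [MeasurableSpace G] [BorelSpace G] (μ : Measure G) [μ.IsHaarMeasure]
  [IsProbabilityMeasure μ]

omit [T2Space G] [SecondCountableTopology G] in
-- A right translate of `μ` is again a Haar probability measure, and there is only one of these.
theorem isMulRightInvariant_of_compactSpace : μ.IsMulRightInvariant := by
  refine ⟨fun g => ?_⟩
  have h1 : IsProbabilityMeasure (μ.map (· * g)) :=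
    Measure.isProbabilityMeasure_map (measurable_mul_const g).aemeasurable
  exact Measure.isHaarMeasure_eq_of_isProbabilityMeasure _ _

omit [T2Space G] in
-- By right invariance the integral of `x ↦ f (x * lieExp (t v))` does not depend on `t`.
-- Differentiating under the integral sign at `t = 0` gives the claim, and integration by parts
-- follows from it.
theorem integral_chartDeriv {W : Type*} [NormedAddCommGroup W] [NormedSpace ℝ W] (k : Fin n) (v : EG)
    {f : (Fin n → G) → W} (hf : SmoothFun EG f) :
    ∫ x, chartDeriv k v f x ∂(Measure.pi fun _ : Fin n => μ) = 0 := by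
  have := isMulRightInvariant_of_compactSpace μ
  obtain ⟨C, hC⟩ := exists_bound_fderiv_expCurve k hf
  have htv : ContinuousAt (fun t : ℝ => t • v) 0 := by fun_prop
  have hS : {t : ℝ | t • v ∈ expDomain EG G ∧
      ∀ x : Fin n → G, ‖fderiv ℝ (expCurve k f x) (t • v)‖ ≤ C} ∈ nhds (0 : ℝ) := by
    refine (htv.eventually (p := fun u => u ∈ expDomain EG G) ?_).and (htv.eventually
      (p := fun u => ∀ x : Fin n → G, ‖fderiv ℝ (expCurve k f x) u‖ ≤ C) ?_)
    · simp only [zero_smul]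
      exact expDomain_mem_nhds
    · simp only [zero_smul]
      exact hC
  have hcont (g : G) : Continuous fun x : Fin n → G => f (x * Pi.mulSingle k g) :=
    hf.continuous.comp (continuous_mul_const _)
  have hint {h : (Fin n → G) → W} (hh : Continuous h) :
      Integrable h (Measure.pi fun _ : Fin n => μ) :=
    hh.integrable_of_hasCompactSupport (HasCompactSupport.of_compactSpace _)
  have key := hasDerivAt_integral_of_dominated_loc_of_deriv_le
    (μ := Measure.pi fun _ : Fin n => μ) (𝕜 := ℝ)
    (F := fun t x => expCurve k f x (t • v))
    (F' := fun t x => fderiv ℝ (expCurve k f x) (t • v) v) (bound := fun _ => C * ‖v‖) hS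
    (.of_forall fun t => (hcont _).aestronglyMeasurable) (hint (hcont _))
    (by
      simp only [zero_smul]
      exact (continuous_chartDeriv k v hf).aestronglyMeasurable)
    (.of_forall fun x t ht => ((fderiv ℝ (expCurve k f x) (t • v)).le_opNorm v).trans
      (mul_le_mul_of_nonneg_right (ht.2 x) (norm_nonneg _))) (integrable_const _)
    (.of_forall fun x t ht => by
      have h7 : HasDerivAt (fun t : ℝ => t • v) v t := by
        simpa using (hasDerivAt_id t).smul_const v
      exact (differentiableAt_expCurve k hf x ht.1).hasFDerivAt.comp_hasDerivAt t h7)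
  have h1 : (fun t : ℝ => ∫ x, expCurve k f x (t • v) ∂(Measure.pi fun _ : Fin n => μ)) =
      fun _ => ∫ x, f x ∂(Measure.pi fun _ : Fin n => μ) :=
    funext fun t => integral_mul_right_eq_self f _
  have h2 := key.2
  rw [h1] at h2
  have h3 := h2.unique (hasDerivAt_const (0 : ℝ) _)
  simp only [zero_smul] at h3
  exact h3

end Integral

/-! ### Finite-dimensional translation-invariant spaces of smooth functions -/

section FiniteDim

/-- Evaluation embeds the finite-dimensional space `V` as a closed subspace of all functions with
the topology of pointwise convergence. Hence pointwise limits stay in `V`, and the convergence is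
automatically uniform. -/
theorem exists_mem_tendsto_of_pointwise {X W : Type*} [TopologicalSpace X] [CompactSpace X]
    [NormedAddCommGroup W] [NormedSpace ℂ W] (V : Submodule ℂ C(X, W)) [FiniteDimensional ℂ V]
    {α : Type*} {l : Filter α} [l.NeBot] {F : α → V} {f : X → W}
    (h : ∀ x, Filter.Tendsto (fun a => (F a : C(X, W)) x) l (nhds (f x))) :
    ∃ g : V, ⇑(g : C(X, W)) = f ∧ Filter.Tendsto F l (nhds g) := by
  let L : V →ₗ[ℂ] (X → W) :=
    { toFun := fun g => ⇑(g : C(X, W))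
      map_add' := fun _ _ => rfl
      map_smul' := fun _ _ => rfl }
  have hL : Topology.IsClosedEmbedding L := LinearMap.isClosedEmbedding_of_injective
    (LinearMap.ker_eq_bot.2 fun a b hab => Subtype.ext (DFunLike.coe_injective hab))
  have hLF : Filter.Tendsto (fun a => L (F a)) l (nhds f) := tendsto_pi_nhds.2 h
  obtain ⟨g, hg⟩ := hL.isClosed_range.mem_of_tendsto hLF (.of_forall fun a => ⟨F a, rfl⟩)
  refine ⟨g, hg, ?_⟩
  rw [hL.isInducing.tendsto_nhds_iff]
  change Filter.Tendsto (fun a => L (F a)) l (nhds (L g))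
  rwa [hg]

variable {EG : Type*} [NormedAddCommGroup EG] [NormedSpace ℝ EG]
  {G : Type*} [TopologicalSpace G] [ChartedSpace EG G] [Group G] {n : ℕ}
  [IsTopologicalGroup G]
  {W : Type*} [NormedAddCommGroup W] [NormedSpace ℂ W]

/-- Right translation of continuous functions. -/
def rightTranslate (h : Fin n → G) (f : C(Fin n → G, W)) : C(Fin n → G, W) :=
  ⟨fun x => f (x * h), f.continuous.comp (continuous_mul_const h)⟩

variable (EG) in
/-- A space of smooth functions that is invariant under right translations. -/
structure IsTranslationInvariant (V : Submodule ℂ C(Fin n → G, W)) : Prop where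
  smooth : ∀ f ∈ V, SmoothFun EG f
  translate : ∀ f ∈ V, ∀ h, rightTranslate h f ∈ V

variable [LieGroup 𝓘(ℝ, EG) ∞ G] [CompactSpace G] {V : Submodule ℂ C(Fin n → G, W)}
  [FiniteDimensional ℂ V] (hV : IsTranslationInvariant EG V)
include hV

/-- The difference quotients of translates lie in `V` and converge pointwise, so
`exists_mem_tendsto_of_pointwise` puts the derivative in `V` and makes the convergence hold in norm.
-/
theorem IsTranslationInvariant.hasDerivAt {f : C(Fin n → G, W)} (hf : f ∈ V) (k : Fin n) (v : EG)
    {t : ℝ} (ht : t • v ∈ expDomain EG G) :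
    ∃ g : V, (∀ x, (g : C(Fin n → G, W)) x = fderiv ℝ (expCurve k f x) (t • v) v) ∧
      HasDerivAt (fun s : ℝ => (⟨_, hV.translate f hf (Pi.mulSingle k (lieExp (s • v)))⟩ : V)) g t := by
  have h1 (x : Fin n → G) : HasDerivAt (fun s : ℝ => expCurve k f x (s • v))
      (fderiv ℝ (expCurve k f x) (t • v) v) t := by
    have h7 : HasDerivAt (fun t : ℝ => t • v) v t := by
      simpa using (hasDerivAt_id t).smul_const v
    exact (differentiableAt_expCurve k (hV.smooth f hf) x ht).hasFDerivAt.comp_hasDerivAt t h7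
  simp only [hasDerivAt_iff_tendsto_slope] at h1 ⊢
  obtain ⟨g, hg, hg'⟩ := exists_mem_tendsto_of_pointwise V (l := nhdsWithin t {t}ᶜ)
    (F := slope (fun s : ℝ =>
      (⟨_, hV.translate f hf (Pi.mulSingle k (lieExp (s • v)))⟩ : V)) t) h1
  exact ⟨g, congrFun hg, hg'⟩

theorem IsTranslationInvariant.exists_chartDeriv {f : C(Fin n → G, W)} (hf : f ∈ V) (k : Fin n)
    (v : EG) : ∃ g ∈ V, ⇑g = chartDeriv k v f := by
  obtain ⟨g, hg, -⟩ := hV.hasDerivAt hf k v (t := 0) (by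
    rw [zero_smul]; exact zero_mem_expDomain)
  refine ⟨g, g.2, funext fun x => ?_⟩
  rw [hg, zero_smul]
  rfl

/-- The left-invariant derivative as an operator on a translation-invariant space. -/
def IsTranslationInvariant.deriv (k : Fin n) (v : EG) : V →ₗ[ℂ] V where
  toFun f := ⟨_, (hV.exists_chartDeriv f.2 k v).choose_spec.1⟩
  map_add' f g := by
    refine Subtype.ext (DFunLike.coe_injective ?_)
    change ⇑(hV.exists_chartDeriv (f + g).2 k v).choose =
      ⇑(hV.exists_chartDeriv f.2 k v).choose + ⇑(hV.exists_chartDeriv g.2 k v).choose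
    rw [(hV.exists_chartDeriv (f + g).2 k v).choose_spec.2,
      (hV.exists_chartDeriv f.2 k v).choose_spec.2, (hV.exists_chartDeriv g.2 k v).choose_spec.2]
    exact funext (chartDeriv_add k v (hV.smooth f f.2) (hV.smooth g g.2))
  map_smul' c f := by
    refine Subtype.ext (DFunLike.coe_injective ?_)
    change ⇑(hV.exists_chartDeriv (c • f).2 k v).choose =
      c • ⇑(hV.exists_chartDeriv f.2 k v).choose
    rw [(hV.exists_chartDeriv (c • f).2 k v).choose_spec.2,
      (hV.exists_chartDeriv f.2 k v).choose_spec.2]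
    exact funext (chartDeriv_linear ((c • ContinuousLinearMap.id ℂ W).restrictScalars ℝ) k v
      (hV.smooth f f.2))

theorem IsTranslationInvariant.deriv_apply (k : Fin n) (v : EG) (f : V) (x : Fin n → G) :
    (hV.deriv k v f : C(Fin n → G, W)) x = chartDeriv k v (f : C(Fin n → G, W)) x :=
  congrFun (hV.exists_chartDeriv f.2 k v).choose_spec.2 x

/-- A derivation on the finite-dimensional space `V` is a continuous linear map, so it may be
interchanged with the derivative of `t ↦` translate of `f`. -/
theorem IsTranslationInvariant.chartDeriv_comm_aux (k l : Fin n) (v w : EG) (f : V) (x : Fin n → G) :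
    HasDerivAt (fun t : ℝ => chartDeriv k v
      (rightTranslate (Pi.mulSingle l (lieExp (t • w))) (f : C(Fin n → G, W))) x)
      ((hV.deriv k v (hV.deriv l w f) : V).1 x) 0 := by
  obtain ⟨g, hg, hg'⟩ := hV.hasDerivAt f.2 l w (t := 0) (by
    rw [zero_smul]; exact zero_mem_expDomain)
  have h1 : g = hV.deriv l w f := by
    refine Subtype.ext (DFunLike.coe_injective (funext fun x => ?_))
    rw [hg, hV.deriv_apply, zero_smul]
    rfl
  rw [h1] at hg'
  let T : V →L[ℝ] W := (((ContinuousMap.evalCLM ℂ x).comp V.subtypeL).comp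
    (LinearMap.toContinuousLinearMap (hV.deriv k v))).restrictScalars ℝ
  have h2 := T.hasFDerivAt.comp_hasDerivAt (0 : ℝ) hg'
  refine h2.congr_of_eventuallyEq (.of_forall fun t => ?_)
  exact (hV.deriv_apply k v
    ⟨_, hV.translate f f.2 (Pi.mulSingle l (lieExp (t • w)))⟩ x).symm

/-- The derivative in `chartDeriv_comm_aux` can be computed a second way: translation in the `l`-th
variable commutes with differentiation in the `k`-th. -/
theorem IsTranslationInvariant.deriv_comm_of_ne {k l : Fin n} (hkl : k ≠ l) (v w : EG) (f : V) :
    hV.deriv k v (hV.deriv l w f) = hV.deriv l w (hV.deriv k v f) := by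
  refine Subtype.ext (DFunLike.coe_injective (funext fun x => ?_))
  have h1 := hV.chartDeriv_comm_aux k l v w f x
  have h2 : (fun t : ℝ => chartDeriv k v
      (rightTranslate (Pi.mulSingle l (lieExp (t • w))) (f : C(Fin n → G, W))) x) =
      fun t : ℝ => expCurve l (hV.deriv k v f : C(Fin n → G, W)) x (t • w) := by
    funext t
    refine (chartDeriv_mul_right_of_ne hkl _ _ v x).trans ?_
    rw [expCurve, hV.deriv_apply]
    rfl
  rw [h2] at h1
  rw [hV.deriv_apply l w]
  refine h1.unique ?_
  have h7 : HasDerivAt (fun t : ℝ => t • w) w 0 := by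
    simpa using (hasDerivAt_id (0 : ℝ)).smul_const w
  have h3 := differentiableAt_expCurve l (hV.smooth _ (hV.deriv k v f).2) x
    (zero_mem_expDomain (EG := EG) (G := G))
  rw [← zero_smul ℝ w] at h3
  have h4 := h3.hasFDerivAt.comp_hasDerivAt (0 : ℝ) h7
  rwa [zero_smul] at h4

omit hV [FiniteDimensional ℂ V] in
variable (EG G) in
/-- Left-invariant derivatives commute up to a left-invariant derivative. -/
theorem exists_bracket [FiniteDimensional ℝ EG] (v w : EG) : ∃ z : EG,
    ∀ (n : ℕ) (V : Submodule ℂ C(Fin n → G, W)) [FiniteDimensional ℂ V]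
      (hV : IsTranslationInvariant EG V) (k : Fin n) (f : V),
      hV.deriv k v (hV.deriv k w f) = hV.deriv k w (hV.deriv k v f) + hV.deriv k z f := by
  -- The vector `z` is fixed before `n`, `V`, `k` and `f`. This makes the constant of the gradient
  -- estimate the same for all spaces of the exhaustion.
  obtain ⟨z, hz⟩ := hasDerivAt_expAd (G := G) w v
  refine ⟨z, fun n V _ hV k f => Subtype.ext (DFunLike.coe_injective (funext fun x => ?_))⟩
  have h1 := hV.chartDeriv_comm_aux k k v w f x
  let b := Module.finBasis ℝ EG
  have h2 : (fun t : ℝ => chartDeriv k v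
      (rightTranslate (Pi.mulSingle k (lieExp (t • w))) (f : C(Fin n → G, W))) x) =
      fun t : ℝ => ∑ i, b.coord i (expAd (lieExp (t • w) : G) v) •
        expCurve k (hV.deriv k (b i) f : C(Fin n → G, W)) x (t • w) := by
    funext t
    refine (chartDeriv_mul_right_same k (hV.smooth f f.2) _ v x).trans ?_
    rw [chartDeriv_eq_sum b]
    simp only [expCurve, hV.deriv_apply]
    rfl
  rw [h2] at h1
  refine h1.unique ?_
  have h7 : HasDerivAt (fun t : ℝ => t • w) w 0 := by
    simpa using (hasDerivAt_id (0 : ℝ)).smul_const w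
  have hc (i) : HasDerivAt (fun t : ℝ => b.coord i (expAd (lieExp (t • w) : G) v)) (b.coord i z) 0 :=
    (LinearMap.toContinuousLinearMap (b.coord i)).hasFDerivAt.comp_hasDerivAt (0 : ℝ) hz
  have hd (i) : HasDerivAt (fun t : ℝ => expCurve k (hV.deriv k (b i) f : C(Fin n → G, W)) x (t • w))
      (chartDeriv k w (hV.deriv k (b i) f : C(Fin n → G, W)) x) 0 := by
    have h3 := differentiableAt_expCurve k (hV.smooth _ (hV.deriv k (b i) f).2) x
      (zero_mem_expDomain (EG := EG) (G := G))
    rw [← zero_smul ℝ w] at h3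
    have h4 := h3.hasFDerivAt.comp_hasDerivAt (0 : ℝ) h7
    rwa [zero_smul] at h4
  -- The product rule at `t = 0`: differentiating the curve gives the iterated derivative in the
  -- other order, since `expAd 1` is the identity, and differentiating the coefficients gives the
  -- derivative along `z`.
  have h8 := HasDerivAt.fun_sum (u := Finset.univ) fun i _ => (hc i).smul (hd i)
  refine h8.congr_deriv ?_
  rw [Finset.sum_add_distrib, zero_smul, lieExp_zero]
  have hAd : expAd (1 : G) v = v := by
    have h9 : (fun u : EG => (lieLog ((1 : G)⁻¹ * lieExp u * 1) : EG)) =ᶠ[nhds 0] id := by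
      filter_upwards [expDomain_mem_nhds (EG := EG) (G := G)] with u hu
      rw [inv_one, one_mul, mul_one, lieLog_lieExp hu, id]
    rw [expAd, h9.fderiv_eq, fderiv_id]
    rfl
  rw [hAd]
  congr 1
  · have h10 : hV.deriv k v f = ∑ i, ((b.repr v i : ℝ) : ℂ) • hV.deriv k (b i) f := by
      refine Subtype.ext (DFunLike.coe_injective (funext fun y => ?_))
      rw [hV.deriv_apply, chartDeriv_eq_sum b]
      simp only [AddSubmonoidClass.coe_finsetSum, ContinuousMap.coe_sum, Finset.sum_apply,
        Submodule.coe_smul, ContinuousMap.coe_smul, Pi.smul_apply, hV.deriv_apply, Complex.coe_smul]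
    rw [h10, map_sum]
    simp only [AddSubmonoidClass.coe_finsetSum, ContinuousMap.coe_sum, Finset.sum_apply, map_smul,
        Submodule.coe_smul, ContinuousMap.coe_smul, Pi.smul_apply, hV.deriv_apply, Complex.coe_smul]
    rfl
  · rw [hV.deriv_apply, chartDeriv_eq_sum b]
    simp only [expCurve_zero, hV.deriv_apply]
    rfl

end FiniteDim

/-- The elliptic estimate for a Dirac-type operator `∑ Cₐ ∂ₐ`: here `F a` stands for `∂ₐ f` and
`K a b` for `∂ₐ ∂_b f`. -/
theorem clifford_estimate {H ι : Type*} [NormedAddCommGroup H] [InnerProductSpace ℂ H] [Fintype ι]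
    [DecidableEq ι] (C : ι → H →L[ℂ] H) (hsa : ∀ a x y, inner ℂ (C a x) y = inner ℂ x (C a y))
    (hac : ∀ a b x, C a (C b x) + C b (C a x) = if a = b then (2 : ℂ) • x else 0)
    (f : H) (F : ι → H) (K : ι → ι → H)
    (hskew : ∀ a b, inner ℂ (F a) (C a (C b (F b))) = -inner ℂ f (C a (C b (K a b))))
    {M : ℝ} (hM : 0 ≤ M) (hK : ∀ a b, ‖K a b - K b a‖ ≤ M * ∑ a, ‖F a‖) :
    (∑ a, ‖F a‖) ^ 2 ≤ (2 * Fintype.card ι + (Fintype.card ι ^ 3 * M) ^ 2) *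
      (‖f‖ ^ 2 + ‖∑ a, C a (F a)‖ ^ 2) := by
  set S := ∑ a, ‖F a‖ with hS
  set m : ℝ := (Fintype.card ι : ℝ) with hm
  have hS0 : 0 ≤ S := Finset.sum_nonneg fun _ _ => norm_nonneg _
  have hsq (a : ι) (x : H) : C a (C a x) = x := by
    have := hac a a x
    rw [if_pos rfl, ← two_smul ℂ] at this
    exact smul_right_injective H (two_ne_zero : (2 : ℂ) ≠ 0) this
  have hnorm (a : ι) (x : H) : ‖C a x‖ = ‖x‖ := by
    have : ‖C a x‖ ^ 2 = ‖x‖ ^ 2 := by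
      rw [← inner_self_eq_norm_sq (𝕜 := ℂ), ← inner_self_eq_norm_sq (𝕜 := ℂ) x, hsa, hsq]
    exact (pow_left_inj₀ (norm_nonneg _) (norm_nonneg _) two_ne_zero).1 this
  -- These are the terms of the expansion of `‖∑ a, C a (F a)‖²`. Diagonal ones are `‖F a‖²`;
  -- symmetrized off-diagonal ones contain only the commutator of two derivatives and are of lower
  -- order.
  let T (a b : ι) : ℝ := (inner ℂ (F a) (C a (C b (F b)))).re
  have hT (a b : ι) : 2 * (if a = b then ‖F a‖ ^ 2 else 0) - M * S * ‖f‖ ≤ T a b + T b a := by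
    split_ifs with h
    · subst h
      have : T a a = ‖F a‖ ^ 2 := by
        simp only [T, hsq]
        exact inner_self_eq_norm_sq (𝕜 := ℂ) (F a)
      rw [this]
      have : 0 ≤ M * S * ‖f‖ := by positivity
      linarith
    -- Skewness moves the derivative off `F`, and `C b C a = -C a C b` turns the sum of the two
    -- second derivatives into the difference `K a b - K b a`.
    · have h1 : T a b + T b a = -(inner ℂ f (C a (C b (K a b - K b a)))).re := by
        have h2 := hac a b (K b a)
        rw [if_neg h] at h2
        simp only [T, hskew, ← Complex.add_re, ← Complex.neg_re, ← neg_add, ← inner_add_right]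
        rw [map_sub, map_sub, eq_neg_of_add_eq_zero_right h2, sub_eq_add_neg]
      have h3 : |(inner ℂ f (C a (C b (K a b - K b a)))).re| ≤ ‖f‖ * (M * S) := by
        refine (Complex.abs_re_le_norm _).trans ((norm_inner_le_norm _ _).trans ?_)
        rw [hnorm, hnorm]
        exact mul_le_mul_of_nonneg_left (hK a b) (norm_nonneg _)
      have h4 := (abs_le.1 h3).2
      rw [h1]
      linarith
  have hsum : ‖∑ a, C a (F a)‖ ^ 2 = ∑ a, ∑ b, T a b := by
    rw [← inner_self_eq_norm_sq (𝕜 := ℂ)]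
    simp only [sum_inner, inner_sum, hsa]
    simp only [Complex.re_sum, T, RCLike.re_to_complex]
    exact Finset.sum_comm
  have hsum' : 2 * ∑ a, ‖F a‖ ^ 2 - m ^ 2 * (M * S * ‖f‖) ≤ 2 * ‖∑ a, C a (F a)‖ ^ 2 := by
    have h1 := Finset.sum_le_sum fun a (_ : a ∈ Finset.univ) =>
      Finset.sum_le_sum fun b (_ : b ∈ Finset.univ) => hT a b
    simp only [Finset.sum_add_distrib, Finset.sum_sub_distrib, ← Finset.mul_sum] at h1
    rw [Finset.sum_comm (f := fun a b => T b a), ← hsum] at h1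
    simp only [Finset.sum_ite_eq, Finset.mem_univ, if_true, Finset.sum_const, Finset.card_univ,
      nsmul_eq_mul] at h1
    rw [← hm] at h1
    linarith
  have hCS : S ^ 2 ≤ m * ∑ a, ‖F a‖ ^ 2 := by
    have := sq_sum_le_card_mul_sum_sq (s := Finset.univ) (f := fun a => ‖F a‖)
    simpa [hS, hm] using this
  have hm0 : 0 ≤ m := by positivity
  set X := ‖f‖
  set Y := ‖∑ a, C a (F a)‖
  have h5 : S ^ 2 ≤ m * Y ^ 2 + (m ^ 3 * M * X) * S / 2 := by
    have := mul_le_mul_of_nonneg_left hsum' hm0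
    nlinarith
  -- Young's inequality absorbs the term linear in `S` into the left-hand side.
  have h6 : (m ^ 3 * M * X) * S / 2 ≤ S ^ 2 / 2 + (m ^ 3 * M * X) ^ 2 / 2 := by
    nlinarith [sq_nonneg (m ^ 3 * M * X - S), sq_nonneg (m ^ 3 * M * X + S)]
  have h7 : 0 ≤ (m ^ 3 * M) ^ 2 * Y ^ 2 := by positivity
  have h8 : 0 ≤ 2 * m * X ^ 2 := by positivity
  nlinarith

theorem norm_sum_ofReal_smul_le {H ι : Type*} [NormedAddCommGroup H] [NormedSpace ℂ H] [Fintype ι]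
    (c : ι → ℝ) (y : ι → H) {S : ℝ} (h : ∀ i, ‖y i‖ ≤ S) :
    ‖∑ i, (c i : ℂ) • y i‖ ≤ (∑ i, |c i|) * S := by
  refine (norm_sum_le _ _).trans ?_
  rw [Finset.sum_mul]
  refine Finset.sum_le_sum fun i _ => ?_
  rw [norm_smul, Complex.norm_real, Real.norm_eq_abs]
  exact mul_le_mul_of_nonneg_left (h i) (abs_nonneg _)

/-! ### Derivatives and translations in `L²(Gⁿ, W)`. -/

section L2
variable {EG : Type*} [NormedAddCommGroup EG] [NormedSpace ℝ EG]
  {G : Type*} [TopologicalSpace G] [ChartedSpace EG G] [Group G] {n : ℕ}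
  [IsTopologicalGroup G] [T2Space G] [SecondCountableTopology G]
  [CompactSpace G] [MeasurableSpace G] [BorelSpace G] (μ : Measure G) [μ.IsHaarMeasure]
  [IsProbabilityMeasure μ]
  {W : Type*} [NormedAddCommGroup W] [InnerProductSpace ℂ W] [CompleteSpace W]

/-- Continuous functions on `Gⁿ` as elements of `L²`. -/
abbrev toL2 : C(Fin n → G, W) →L[ℂ] Lp W 2 (Measure.pi fun _ : Fin n => μ) :=
  ContinuousMap.toLp 2 _ ℂ

omit [IsTopologicalGroup G] [T2Space G] [μ.IsHaarMeasure] [CompleteSpace W] [Group G] in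
theorem inner_toL2 (f g : C(Fin n → G, W)) :
    inner ℂ (toL2 μ f) (toL2 μ g) = ∫ x, inner ℂ (f x) (g x) ∂(Measure.pi fun _ : Fin n => μ) := by
  rw [L2.inner_def]
  refine integral_congr_ae ?_
  filter_upwards [ContinuousMap.coeFn_toLp (p := 2) (𝕜 := ℂ) (Measure.pi fun _ : Fin n => μ) f,
    ContinuousMap.coeFn_toLp (p := 2) (𝕜 := ℂ) (Measure.pi fun _ : Fin n => μ) g] with x h1 h2
  rw [h1, h2]

omit [T2Space G] [CompleteSpace W] in
theorem norm_toL2_rightTranslate (h : Fin n → G) (f : C(Fin n → G, W)) :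
    ‖toL2 μ (rightTranslate h f)‖ = ‖toL2 μ f‖ := by
  have := isMulRightInvariant_of_compactSpace μ
  have h1 : inner ℂ (toL2 μ (rightTranslate h f)) (toL2 μ (rightTranslate h f)) =
      inner ℂ (toL2 μ f) (toL2 μ f) := by
    rw [inner_toL2, inner_toL2]
    exact integral_mul_right_eq_self (fun x => inner ℂ (f x) (f x)) h
  rw [inner_self_eq_norm_sq_to_K, inner_self_eq_norm_sq_to_K] at h1
  have h2 : ‖toL2 μ (rightTranslate h f)‖ ^ 2 = ‖toL2 μ f‖ ^ 2 := by exact_mod_cast h1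
  exact (pow_left_inj₀ (norm_nonneg _) (norm_nonneg _) two_ne_zero).1 h2

variable [LieGroup 𝓘(ℝ, EG) ∞ G]

omit [T2Space G] [CompleteSpace W] in
/-- Left-invariant derivatives are skew-symmetric. -/
theorem integral_inner_chartDeriv (k : Fin n) (v : EG) {f g : (Fin n → G) → W}
    (hf : SmoothFun EG f) (hg : SmoothFun EG g) :
    ∫ x, inner ℂ (chartDeriv k v f x) (g x) ∂(Measure.pi fun _ : Fin n => μ) =
      -∫ x, inner ℂ (f x) (chartDeriv k v g x) ∂(Measure.pi fun _ : Fin n => μ) := by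
  have hint {h : (Fin n → G) → ℂ} (hh : Continuous h) :
      Integrable h (Measure.pi fun _ : Fin n => μ) :=
    hh.integrable_of_hasCompactSupport (HasCompactSupport.of_compactSpace _)
  have h1 := integral_chartDeriv μ k v (smoothFun_inner hf hg)
  simp only [chartDeriv_inner k v hf hg] at h1
  rw [integral_add (hint (hf.continuous.inner (continuous_chartDeriv k v hg)))
    (hint ((continuous_chartDeriv k v hf).inner hg.continuous))] at h1
  exact eq_neg_of_add_eq_zero_right h1

variable {V : Submodule ℂ C(Fin n → G, W)}
  [FiniteDimensional ℂ V] (hV : IsTranslationInvariant EG V)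

omit [T2Space G] [CompleteSpace W] [μ.IsHaarMeasure] in
-- Expanding `v` in the basis `e` bounds any left-invariant derivative by the full gradient.
theorem norm_deriv_le {q : ℕ} (e : Module.Basis (Fin q) ℝ EG) (k : Fin n) (v : EG) (f : V) :
    ‖toL2 μ (hV.deriv k v f : C(Fin n → G, W))‖ ≤ (∑ i, |e.repr v i|) *
      ∑ a : Fin n × Fin q, ‖toL2 μ (hV.deriv a.1 (e a.2) f : C(Fin n → G, W))‖ := by
  have h1 : hV.deriv k v f = ∑ i, ((e.repr v i : ℝ) : ℂ) • hV.deriv k (e i) f := by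
    refine Subtype.ext (DFunLike.coe_injective (funext fun y => ?_))
    rw [hV.deriv_apply, chartDeriv_eq_sum e]
    simp only [AddSubmonoidClass.coe_finsetSum, ContinuousMap.coe_sum, Finset.sum_apply,
      Submodule.coe_smul, ContinuousMap.coe_smul, Pi.smul_apply, hV.deriv_apply, Complex.coe_smul]
  let L : V →L[ℂ] Lp W 2 (Measure.pi fun _ : Fin n => μ) := (toL2 μ).comp V.subtypeL
  have h2 : L (hV.deriv k v f) = ∑ i, ((e.repr v i : ℝ) : ℂ) • L (hV.deriv k (e i) f) := by
    rw [h1, map_sum]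
    exact Finset.sum_congr rfl fun i _ => map_smul L _ _
  change ‖L (hV.deriv k v f)‖ ≤ (∑ i, |e.repr v i|) *
      ∑ a : Fin n × Fin q, ‖L (hV.deriv a.1 (e a.2) f)‖
  have h3 (i : Fin q) := Finset.single_le_sum
    (f := fun a : Fin n × Fin q => ‖L (hV.deriv a.1 (e a.2) f)‖)
    (fun _ _ => norm_nonneg _) (Finset.mem_univ (k, i))
  exact (congrArg norm h2).trans_le (norm_sum_ofReal_smul_le _ _ h3)

omit [T2Space G] [CompleteSpace W] in
variable (EG W) in
/-- Translations by elements close to the identity move a function little compared with its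
gradient. -/
theorem norm_rightTranslate_sub_le {q : ℕ} (e : Module.Basis (Fin q) ℝ EG) {ε : ℝ} (hε : 0 < ε) :
    ∀ᶠ g in nhds (1 : G), ∀ (n : ℕ) (V : Submodule ℂ C(Fin n → G, W)) [FiniteDimensional ℂ V]
      (hV : IsTranslationInvariant EG V) (k : Fin n) (f : V),
      ‖toL2 μ (rightTranslate (Pi.mulSingle k g) (f : C(Fin n → G, W))) - toL2 μ f.1‖ ≤ ε *
        ∑ a : Fin n × Fin q, ‖toL2 μ (hV.deriv a.1 (e a.2) f : C(Fin n → G, W))‖ := by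
  have : FiniteDimensional ℝ EG := e.finiteDimensional_of_finite
  obtain ⟨C, hC⟩ := exists_bound_expTheta (EG := EG) (G := G)
  let A : EG →L[ℝ] (Fin q → ℝ) := LinearMap.toContinuousLinearMap e.equivFun.toLinearMap
  obtain ⟨r, hr, hr'⟩ := Metric.eventually_nhds_iff_ball.1
    (hC.and (expDomain_mem_nhds (EG := EG) (G := G)))
  have hC0 : 0 ≤ C := (norm_nonneg _).trans (hr' 0 (Metric.mem_ball_self hr)).1
  have hlog : ContinuousAt (lieLog : G → EG) 1 := contMDiffAt_lieLog.self_of_nhds.continuousAt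
  -- With `u = lieLog g`, the path `t ↦` translate by `lieExp (t u)` has as velocity a translate of
  -- the derivative of `f` along `expTheta G (t u) u`. Each of the `q` coordinates of this vector is
  -- at most `‖A‖ C ‖u‖`, which explains the factor to be made smaller than `ε`.
  have h1 : Filter.Tendsto (fun g : G => q * ‖A‖ * C * ‖(lieLog g : EG)‖) (nhds 1) (nhds 0) := by
    have := (hlog.norm.tendsto).const_mul (q * ‖A‖ * C)
    rwa [lieLog_one, norm_zero, mul_zero] at this
  have h2 : ∀ᶠ g in nhds (1 : G), (lieLog g : EG) ∈ Metric.ball (0 : EG) r :=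
    hlog.eventually (by rw [lieLog_one]; exact Metric.ball_mem_nhds _ hr)
  filter_upwards [h1.eventually_lt_const hε, h2, eventually_lieExp_lieLog (EG := EG) (G := G)]
    with g hg1 hg2 hg3 n V _ hV k f
  set u : EG := lieLog g
  set S := ∑ a : Fin n × Fin q, ‖toL2 μ (hV.deriv a.1 (e a.2) f : C(Fin n → G, W))‖ with hS
  have hS0 : 0 ≤ S := Finset.sum_nonneg fun _ _ => norm_nonneg _
  have htu {t : ℝ} (ht : t ∈ Set.Icc (0 : ℝ) 1) : t • u ∈ Metric.ball (0 : EG) r := by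
    rw [mem_ball_zero_iff] at hg2 ⊢
    rw [norm_smul, Real.norm_eq_abs, abs_of_nonneg ht.1]
    exact (mul_le_of_le_one_left (norm_nonneg _) ht.2).trans_lt hg2
  have hd (t : ℝ) (ht : t ∈ Set.Icc (0 : ℝ) 1) := hV.hasDerivAt f.2 k u (hr' _ (htu ht)).2
  let L : V →L[ℝ] Lp W 2 (Measure.pi fun _ : Fin n => μ) :=
    ((toL2 μ).comp V.subtypeL).restrictScalars ℝ
  let γ (t : ℝ) : Lp W 2 (Measure.pi fun _ : Fin n => μ) :=
    toL2 μ (rightTranslate (Pi.mulSingle k (lieExp (t • u))) (f : C(Fin n → G, W)))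
  have hγ (t : ℝ) (ht : t ∈ Set.Icc (0 : ℝ) 1) :
      ∃ y, HasDerivAt γ y t ∧ ‖y‖ ≤ ε * S := by
    obtain ⟨y, hy, hy'⟩ := hd t ht
    refine ⟨L y, L.hasFDerivAt.comp_hasDerivAt t hy', ?_⟩
    have h3 : (y : C(Fin n → G, W)) = rightTranslate (Pi.mulSingle k (lieExp (t • u)))
        (hV.deriv k (expTheta G (t • u) u) f : C(Fin n → G, W)) := by
      ext x
      rw [hy, fderiv_expCurve_eq_chartDeriv k (hV.smooth f f.2) x (hr' _ (htu ht)).2]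
      exact (hV.deriv_apply _ _ _ _).symm
    change ‖toL2 μ (y : C(Fin n → G, W))‖ ≤ _
    rw [h3, norm_toL2_rightTranslate]
    refine (norm_deriv_le μ hV e k _ f).trans (mul_le_mul_of_nonneg_right ?_ hS0)
    refine le_trans ?_ hg1.le
    have h4 (i : Fin q) : |e.repr (expTheta G (t • u) u) i| ≤ ‖A‖ * C * ‖u‖ := by
      refine (norm_le_pi_norm (A (expTheta G (t • u) u)) i).trans ((A.le_opNorm _).trans ?_)
      rw [mul_assoc]
      refine mul_le_mul_of_nonneg_left ?_ (norm_nonneg _)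
      exact ((expTheta G (t • u)).le_opNorm u).trans
        (mul_le_mul_of_nonneg_right (hr' _ (htu ht)).1 (norm_nonneg _))
    refine (Finset.sum_le_sum fun i _ => h4 i).trans (le_of_eq ?_)
    simp only [Finset.sum_const, Finset.card_univ, Fintype.card_fin, nsmul_eq_mul]
    ring
  choose! γ' hγ' hγ'' using hγ
  -- The mean value inequality on `[0, 1]`: the endpoints of the path are the translate by `g` and
  -- `f` itself.
  have h5 := norm_image_sub_le_of_norm_deriv_le_segment_01' (f := γ) (f' := γ')
    (fun t ht => (hγ' t ht).hasDerivWithinAt) fun t ht => hγ'' t ⟨ht.1, ht.2.le⟩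
  simp only [γ, one_smul, zero_smul, lieExp_zero] at h5
  rw [hg3] at h5
  refine le_trans (le_of_eq ?_) h5
  congr 3
  ext x
  simp [rightTranslate]

end L2

/-! ### Polynomials in the matrix coefficients -/

section Trig
variable {EG : Type*} [NormedAddCommGroup EG] [NormedSpace ℝ EG]
  {G : Type*} [TopologicalSpace G] [ChartedSpace EG G] [Group G] {N : ℕ} (ρ : FaithfulRep EG G N)
  (n : ℕ)

/-- The matrix coefficient `x ↦ ρ(xₖ)ₐᵦ`. -/
def matrixCoeff {n : ℕ} (k : Fin n) (a b : Fin N) : C(Fin n → G, ℂ) :=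
  ⟨fun x => (ρ.hom (x k) : Matrix (Fin N) (Fin N) ℂ) a b,
    ((ρ.smooth a b).continuous).comp (continuous_apply k)⟩

/-- The constants, the matrix coefficients and their conjugates. -/
def coeffSet : Set C(Fin n → G, ℂ) :=
  {1} ∪ Set.range (fun p : Fin n × Fin N × Fin N => matrixCoeff ρ p.1 p.2.1 p.2.2) ∪
    Set.range (fun p : Fin n × Fin N × Fin N => star (matrixCoeff ρ p.1 p.2.1 p.2.2))

/-- Polynomials of degree at most `d` in the matrix coefficients and their conjugates. -/
def trigPoly (d : ℕ) : Submodule ℂ C(Fin n → G, ℂ) := Submodule.span ℂ (coeffSet ρ n) ^ d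

theorem coeffSet_finite : (coeffSet ρ n).Finite :=
  ((Set.finite_singleton _).union (Set.finite_range _)).union (Set.finite_range _)

variable {n}

theorem matrixCoeff_mem (k : Fin n) (a b : Fin N) : matrixCoeff ρ k a b ∈ coeffSet ρ n :=
  Or.inl (Or.inr ⟨(k, a, b), rfl⟩)

theorem star_matrixCoeff_mem (k : Fin n) (a b : Fin N) :
    star (matrixCoeff ρ k a b) ∈ coeffSet ρ n :=
  Or.inr ⟨(k, a, b), rfl⟩

theorem one_mem_span_coeffSet : (1 : C(Fin n → G, ℂ)) ∈ Submodule.span ℂ (coeffSet ρ n) :=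
  Submodule.subset_span (Or.inl (Or.inl rfl))

theorem trigPoly_mono : Monotone (trigPoly ρ n) :=
  monotone_nat_of_le_succ fun d f hf => by
    rw [trigPoly, Submodule.pow_succ, ← mul_one f]
    exact Submodule.mul_mem_mul hf (one_mem_span_coeffSet ρ)

instance (d : ℕ) : FiniteDimensional ℂ (trigPoly ρ n d) :=
  Module.Finite.iff_fg.2 ((Submodule.fg_span (coeffSet_finite ρ n)).pow d)

/-- An algebra homomorphism that preserves the span of the generators preserves its powers, so
translation invariance only has to be checked in degree one. -/
theorem map_trigPoly_le (Φ : C(Fin n → G, ℂ) →ₐ[ℂ] C(Fin n → G, ℂ))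
    (h : ∀ f ∈ coeffSet ρ n, Φ f ∈ Submodule.span ℂ (coeffSet ρ n)) (d : ℕ)
    {f : C(Fin n → G, ℂ)} (hf : f ∈ trigPoly ρ n d) : Φ f ∈ trigPoly ρ n d := by
  have h1 : (Submodule.span ℂ (coeffSet ρ n)).map Φ.toLinearMap ≤ Submodule.span ℂ (coeffSet ρ n) := by
    rw [Submodule.map_span_le]
    exact h
  have h2 : ∀ d, (Submodule.span ℂ (coeffSet ρ n)).map Φ.toLinearMap ^ d ≤ trigPoly ρ n d := by
    intro d
    induction d with
    | zero => exact le_rfl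
    | succ d ih => exact Submodule.mul_le.2 fun a ha b hb => Submodule.mul_mem_mul (ih ha) (h1 hb)
  refine h2 d ?_
  rw [← Submodule.map_pow]
  exact ⟨f, hf, rfl⟩

theorem star_mem_trigPoly {d : ℕ} {f : C(Fin n → G, ℂ)} (hf : f ∈ trigPoly ρ n d) :
    star f ∈ trigPoly ρ n d := by
  have h1 : ∀ g ∈ Submodule.span ℂ (coeffSet ρ n), star g ∈ Submodule.span ℂ (coeffSet ρ n) := by
    intro g hg
    induction hg using Submodule.span_induction with
    | mem g hg =>
      refine Submodule.subset_span ?_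
      rcases hg with (rfl | ⟨p, rfl⟩) | ⟨p, rfl⟩
      · rw [star_one]; exact Or.inl (Or.inl rfl)
      · exact star_matrixCoeff_mem ρ _ _ _
      · rw [star_star]; exact matrixCoeff_mem ρ _ _ _
    | zero => rw [star_zero]; exact zero_mem _
    | add f g _ _ hf hg => rw [star_add]; exact add_mem hf hg
    | smul c f _ hf => rw [star_smul]; exact Submodule.smul_mem _ _ hf
  induction d generalizing f with
  | zero =>
    rw [trigPoly, Submodule.pow_zero] at hf ⊢
    obtain ⟨c, rfl⟩ := Submodule.mem_one.1 hf
    rw [← algebraMap_star_comm]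
    exact Submodule.mem_one.2 ⟨_, rfl⟩
  | succ d ih =>
    rw [trigPoly, Submodule.pow_succ] at hf ⊢
    induction hf using Submodule.mul_induction_on' with
    | mem_mul_mem a ha b hb =>
      rw [star_mul, mul_comm]
      exact Submodule.mul_mem_mul (ih ha) (h1 b hb)
    | add f _ g _ hf hg => rw [star_add]; exact add_mem hf hg

section Translate
variable [IsTopologicalGroup G]

/-- Left and right translation as an algebra homomorphism. -/
def translateHom (g h : Fin n → G) : C(Fin n → G, ℂ) →ₐ[ℂ] C(Fin n → G, ℂ) :=
  ContinuousMap.compRightAlgHom ℂ ℂ ⟨fun x => g * x * h, by fun_prop⟩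

/-- As `ρ(g x h) = ρ(g) ρ(x) ρ(h)`, a translate of a matrix coefficient is a linear combination of
coefficients of the same factor. -/
theorem translateHom_mem (g h : Fin n → G) {d : ℕ} {f : C(Fin n → G, ℂ)}
    (hf : f ∈ trigPoly ρ n d) : translateHom g h f ∈ trigPoly ρ n d := by
  refine map_trigPoly_le ρ _ ?_ d hf
  have h1 (k : Fin n) (a b : Fin N) : translateHom g h (matrixCoeff ρ k a b) =
      ∑ i, ∑ j, ((ρ.hom (g k) : Matrix (Fin N) (Fin N) ℂ) a i *
        (ρ.hom (h k) : Matrix (Fin N) (Fin N) ℂ) j b) • matrixCoeff ρ k i j := by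
    ext x
    simp only [translateHom, ContinuousMap.compRightAlgHom_apply, ContinuousMap.comp_apply,
      matrixCoeff, ContinuousMap.coe_mk, Pi.mul_apply, map_mul, Submonoid.coe_mul,
      Matrix.mul_apply, ContinuousMap.coe_sum, Finset.sum_apply, ContinuousMap.coe_smul,
      Pi.smul_apply, smul_eq_mul, Finset.sum_mul]
    rw [Finset.sum_comm]
    exact Finset.sum_congr rfl fun i _ => Finset.sum_congr rfl fun j _ => by ring
  rintro f ((rfl | ⟨⟨k, a, b⟩, rfl⟩) | ⟨⟨k, a, b⟩, rfl⟩)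
  · rw [map_one]; exact one_mem_span_coeffSet ρ
  · simp only [h1]
    exact Submodule.sum_mem _ fun i _ => Submodule.sum_mem _ fun j _ =>
      Submodule.smul_mem _ _ (Submodule.subset_span (matrixCoeff_mem ρ _ _ _))
  · have h2 : translateHom g h (star (matrixCoeff ρ k a b)) =
        star (translateHom g h (matrixCoeff ρ k a b)) := rfl
    simp only [h2, h1, star_sum, star_smul]
    exact Submodule.sum_mem _ fun i _ => Submodule.sum_mem _ fun j _ =>
      Submodule.smul_mem _ _ (Submodule.subset_span (star_matrixCoeff_mem ρ _ _ _))

end Translate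

theorem smoothFun_trigPoly [LieGroup 𝓘(ℝ, EG) ∞ G] {d : ℕ} {f : C(Fin n → G, ℂ)}
    (hf : f ∈ trigPoly ρ n d) : SmoothFun EG f := by
  have h0 (k : Fin n) (a b : Fin N) : SmoothFun EG (matrixCoeff ρ k a b) :=
    (ρ.smooth a b).comp (contMDiff_apply_pi k)
  have h1 : ∀ g ∈ Submodule.span ℂ (coeffSet ρ n), SmoothFun EG g := by
    intro g hg
    induction hg using Submodule.span_induction with
    | mem g hg =>
      rcases hg with (rfl | ⟨p, rfl⟩) | ⟨p, rfl⟩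
      · exact contMDiff_const
      · exact h0 _ _ _
      · have h : ContDiff ℝ ∞ fun z : ℂ => star z := Complex.conjCLE.contDiff
        exact (contMDiff_iff_contDiff.2 h).comp (h0 _ _ _)
    | zero => exact contMDiff_const
    | add f g _ _ hf hg => exact hf.add hg
    | smul c f _ hf =>
      have h : ContDiff ℝ ∞ fun z : ℂ => c • z := contDiff_const_smul c
      exact (contMDiff_iff_contDiff.2 h).comp hf
  induction d generalizing f with
  | zero =>
    rw [trigPoly, Submodule.pow_zero] at hf
    obtain ⟨c, rfl⟩ := Submodule.mem_one.1 hf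
    exact contMDiff_const
  | succ d ih =>
    rw [trigPoly, Submodule.pow_succ] at hf
    induction hf using Submodule.mul_induction_on' with
    | mem_mul_mem a ha b hb =>
      have h : ContDiff ℝ ∞ fun z : ℂ × ℂ => z.1 * z.2 := contDiff_mul
      exact (contMDiff_iff_contDiff.2 h).comp ((ih ha).prodMk_space (h1 b hb))
    | add f _ g _ hf hg => exact hf.add hg

/-- Stone–Weierstrass: faithfulness of `ρ` is what makes the matrix coefficients separate the points
of `Gⁿ`. -/
theorem exists_mem_trigPoly_dist_lt [CompactSpace G] (f : C(Fin n → G, ℂ)) {ε : ℝ} (hε : 0 < ε) :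
    ∃ d, ∃ p ∈ trigPoly ρ n d, ‖p - f‖ < ε := by
  let A : StarSubalgebra ℂ C(Fin n → G, ℂ) := StarAlgebra.adjoin ℂ
    (Set.range (fun p : Fin n × Fin N × Fin N => matrixCoeff ρ p.1 p.2.1 p.2.2))
  have hA : A.SeparatesPoints := by
    intro x y hxy
    by_contra! hcon
    refine hxy (funext fun k => ρ.injective (Subtype.ext (Matrix.ext fun a b => ?_)))
    exact hcon _ ⟨matrixCoeff ρ k a b, StarAlgebra.subset_adjoin ℂ _ ⟨(k, a, b), rfl⟩, rfl⟩
  have h1 := ContinuousMap.starSubalgebra_topologicalClosure_eq_top_of_separatesPoints A hA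
  have h2 : ∀ p ∈ A, ∃ d, p ∈ trigPoly ρ n d := by
    intro p hp
    induction hp using StarAlgebra.adjoin_induction with
    | mem p hp =>
      obtain ⟨q, rfl⟩ := hp
      exact ⟨1, by rw [trigPoly, Submodule.pow_one]; exact Submodule.subset_span (matrixCoeff_mem ρ _ _ _)⟩
    | algebraMap c =>
      exact ⟨0, by rw [trigPoly, Submodule.pow_zero]; exact Submodule.mem_one.2 ⟨c, rfl⟩⟩
    | add f g _ _ hf hg =>
      obtain ⟨d, hd⟩ := hf
      obtain ⟨d', hd'⟩ := hg
      exact ⟨max d d', add_mem (trigPoly_mono ρ (le_max_left _ _) hd)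
        (trigPoly_mono ρ (le_max_right _ _) hd')⟩
    | mul f g _ _ hf hg =>
      obtain ⟨d, hd⟩ := hf
      obtain ⟨d', hd'⟩ := hg
      rcases eq_or_ne d' 0 with rfl | h
      · obtain ⟨c, rfl⟩ := Submodule.mem_one.1 (show g ∈ (1 : Submodule ℂ C(Fin n → G, ℂ)) from hd')
        exact ⟨d, by rw [mul_comm, ← Algebra.smul_def]; exact Submodule.smul_mem _ _ hd⟩
      · exact ⟨d + d', by rw [trigPoly, Submodule.pow_add _ h]; exact Submodule.mul_mem_mul hd hd'⟩
    | star f _ hf =>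
      obtain ⟨d, hd⟩ := hf
      exact ⟨d, star_mem_trigPoly ρ hd⟩
  have h3 : f ∈ closure (A : Set C(Fin n → G, ℂ)) := by
    rw [← StarSubalgebra.topologicalClosure_coe, h1]
    trivial
  obtain ⟨p, hp, hp'⟩ := Metric.mem_closure_iff.1 h3 ε hε
  obtain ⟨d, hd⟩ := h2 p hp
  exact ⟨d, p, hd, by rwa [← dist_eq_norm, dist_comm]⟩

variable (W : Type*) [NormedAddCommGroup W] [NormedSpace ℂ W]

/-- The function `x ↦ p(x) w`. -/
def smulConst : C(Fin n → G, ℂ) →ₗ[ℂ] W →ₗ[ℂ] C(Fin n → G, W) :=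
  LinearMap.mk₂ ℂ (fun p w => ⟨fun x => p x • w, p.continuous.smul continuous_const⟩)
    (fun _ _ _ => by ext; simp [add_smul]) (fun _ _ _ => by ext; simp [mul_smul])
    (fun _ _ _ => by ext; simp) (fun _ _ _ => by ext; exact smul_comm _ _ _)

/-- Polynomials in the matrix coefficients with values in `W`. -/
def trigSpace (d : ℕ) : Submodule ℂ C(Fin n → G, W) :=
  Submodule.map₂ (smulConst W) (trigPoly ρ n d) ⊤

theorem trigSpace_mono : Monotone (trigSpace ρ (n := n) W) :=
  fun _ _ h => Submodule.map₂_le_map₂_left (trigPoly_mono ρ h)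

instance [FiniteDimensional ℂ W] (d : ℕ) : FiniteDimensional ℂ (trigSpace ρ (n := n) W d) :=
  Module.Finite.iff_fg.2 ((Module.Finite.iff_fg.1 inferInstance).map₂ _ Module.Finite.fg_top)

variable {W}

theorem smulConst_mem_trigSpace {d : ℕ} {p : C(Fin n → G, ℂ)} (hp : p ∈ trigPoly ρ n d) (w : W) :
    smulConst W p w ∈ trigSpace ρ W d :=
  Submodule.apply_mem_map₂ _ hp trivial

theorem trigSpace_induction {d : ℕ} {P : C(Fin n → G, W) → Prop}
    (h0 : ∀ p ∈ trigPoly ρ n d, ∀ w, P (smulConst W p w)) (hadd : ∀ f g, P f → P g → P (f + g))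
    {f : C(Fin n → G, W)} (hf : f ∈ trigSpace ρ W d) : P f := by
  rw [trigSpace, Submodule.map₂_eq_span_image2] at hf
  -- The property `P` is not assumed stable under scalars. Carrying an arbitrary scalar through the
  -- induction lets it be absorbed into the vector `w` at the generators.
  suffices h : ∀ c : ℂ, P (c • f) by simpa using h 1
  induction hf using Submodule.span_induction with
  | mem f hf =>
    obtain ⟨p, hp, w, -, rfl⟩ := hf
    intro c
    rw [← map_smul]
    exact h0 p hp _
  | zero => intro c; simpa using h0 0 (zero_mem _) 0
  | add f g _ _ hf hg => intro c; rw [smul_add]; exact hadd _ _ (hf c) (hg c)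
  | smul a f _ ih => intro c; rw [smul_smul]; exact ih _

theorem comp_mem_trigSpace {W' : Type*} [NormedAddCommGroup W'] [NormedSpace ℂ W']
    (L : W →L[ℂ] W') {d : ℕ} {f : C(Fin n → G, W)} (hf : f ∈ trigSpace ρ W d) :
    (L : C(W, W')).comp f ∈ trigSpace ρ W' d := by
  refine trigSpace_induction ρ (P := fun f => (L : C(W, W')).comp f ∈ trigSpace ρ W' d)
    (fun p hp w => ?_) (fun f g hf hg => ?_) hf
  ·
    convert smulConst_mem_trigSpace ρ hp (L w)
    ext x
    exact map_smul L _ _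
  ·
    convert add_mem hf hg
    ext x
    exact map_add L _ _

theorem isTranslationInvariant_trigSpace [LieGroup 𝓘(ℝ, EG) ∞ G] [IsTopologicalGroup G] (d : ℕ) :
    IsTranslationInvariant EG (trigSpace ρ (n := n) W d) where
  smooth f hf := by
    refine trigSpace_induction ρ (P := fun f => SmoothFun EG f)
      (fun p hp w => ?_) (fun f g hf hg => ?_) hf
    ·
      have h : ContDiff ℝ ∞ fun z : ℂ => z • w := contDiff_id.smul contDiff_const
      exact (contMDiff_iff_contDiff.2 h).comp (smoothFun_trigPoly ρ hp)
    · exact hf.add hg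
  translate f hf h := by
    refine trigSpace_induction ρ (P := fun f => rightTranslate h f ∈ trigSpace ρ W d)
      (fun p hp w => ?_) (fun f g hf hg => ?_) hf
    ·
      convert smulConst_mem_trigSpace ρ (translateHom_mem ρ 1 h hp) w
      ext x
      simp [rightTranslate, smulConst, translateHom]
    · exact add_mem hf hg

theorem exists_mem_trigSpace_dist_lt [CompactSpace G] {W : Type*} [NormedAddCommGroup W]
    [NormedSpace ℂ W] [FiniteDimensional ℂ W] (f : C(Fin n → G, W)) {ε : ℝ} (hε : 0 < ε) :
    ∃ d, ∃ p ∈ trigSpace ρ W d, ‖p - f‖ < ε := by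
  let b := Module.finBasis ℂ W
  let c (i) : C(Fin n → G, ℂ) :=
    ⟨fun x => b.coord i (f x), (LinearMap.continuous_of_finiteDimensional _).comp f.continuous⟩
  obtain ⟨δ, hδ, hδ'⟩ : ∃ δ > 0, δ * ∑ i, ‖b i‖ < ε := by
    have h : 0 ≤ ∑ i, ‖b i‖ := Finset.sum_nonneg fun i _ => norm_nonneg _
    refine ⟨ε / (∑ i, ‖b i‖ + 1), by positivity, ?_⟩
    rw [div_mul_eq_mul_div, div_lt_iff₀ (by positivity)]
    nlinarith
  choose d p hp hpc using fun i => exists_mem_trigPoly_dist_lt ρ (c i) hδ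
  refine ⟨Finset.univ.sup d, ∑ i, smulConst W (p i) (b i), Submodule.sum_mem _ fun i _ =>
    trigSpace_mono ρ W (Finset.le_sup (Finset.mem_univ i)) (smulConst_mem_trigSpace ρ (hp i) _), ?_⟩
  have h1 : (∑ i, smulConst W (p i) (b i)) - f = ∑ i, smulConst W (p i - c i) (b i) := by
    have : f = ∑ i, smulConst W (c i) (b i) := by
      ext x
      simp [c, smulConst]
    conv_lhs => rw [this]
    simp [Finset.sum_sub_distrib]
  rw [h1]
  refine lt_of_le_of_lt (norm_sum_le_of_le (n := fun i => δ * ‖b i‖) _ fun i _ => ?_)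
    (by rwa [← Finset.mul_sum])
  refine (ContinuousMap.norm_le _ (by positivity)).2 fun x => ?_
  refine (norm_smul_le _ _).trans ?_
  gcongr
  exact (((p i - c i).norm_coe_le_norm x).trans (hpc i).le)

end Trig

/-! ### Polynomials orthogonal to those of low degree are small compared with their gradient. -/

section Spectral
variable {EG : Type*} [NormedAddCommGroup EG] [NormedSpace ℝ EG]
  {G : Type*} [TopologicalSpace G] [ChartedSpace EG G] [Group G] {n : ℕ}
  [IsTopologicalGroup G] [T2Space G] [SecondCountableTopology G]
  [CompactSpace G] [MeasurableSpace G] [BorelSpace G] (μ : Measure G) [μ.IsHaarMeasure]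
  [IsProbabilityMeasure μ]
  {W : Type*} [NormedAddCommGroup W] [InnerProductSpace ℂ W] [CompleteSpace W]

omit [T2Space G] [CompleteSpace W] in
-- The coordinates of `h` are switched on one at a time; each step costs one term because the other
-- translations are isometries.
theorem norm_rightTranslate_sub_le_sum (h : Fin n → G) (f : C(Fin n → G, W)) :
    ‖toL2 μ (rightTranslate h f) - toL2 μ f‖ ≤
      ∑ k, ‖toL2 μ (rightTranslate (Pi.mulSingle k (h k)) f) - toL2 μ f‖ := by
  have key (s : Finset (Fin n)) :
      ‖toL2 μ (rightTranslate (fun i => if i ∈ s then h i else 1) f) - toL2 μ f‖ ≤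
        ∑ k ∈ s, ‖toL2 μ (rightTranslate (Pi.mulSingle k (h k)) f) - toL2 μ f‖ := by
    induction s using Finset.induction_on with
    | empty =>
      have : rightTranslate (fun i : Fin n => if i ∈ (∅ : Finset (Fin n)) then h i else 1) f = f := by
        ext x
        exact congrArg f (funext fun i => by simp)
      rw [this]
      simp
    | insert k s hk ih =>
      have h1 : (fun i => if i ∈ insert k s then h i else 1) =
          (fun i => if i ∈ s then h i else 1) * Pi.mulSingle k (h k) := by
        funext i
        by_cases hi : i = k
        · subst hi; simp [hk]
        · simp [hi]
      have h2 : toL2 μ (rightTranslate (fun i => if i ∈ insert k s then h i else 1) f) - toL2 μ f =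
          toL2 μ (rightTranslate (fun i => if i ∈ s then h i else 1)
            (rightTranslate (Pi.mulSingle k (h k)) f - f)) +
          (toL2 μ (rightTranslate (fun i => if i ∈ s then h i else 1) f) - toL2 μ f) := by
        rw [h1, ← add_sub_assoc, ← map_add]
        congr 2
        ext x
        simp [rightTranslate, mul_assoc]
      rw [h2, Finset.sum_insert hk]
      refine (norm_add_le _ _).trans (add_le_add ?_ ih)
      rw [norm_toL2_rightTranslate, map_sub]
  convert key Finset.univ using 3
  simp

omit [T2Space G] [SecondCountableTopology G] [CompactSpace G] [MeasurableSpace G] [BorelSpace G]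
  [InnerProductSpace ℂ W] [CompleteSpace W] in
theorem continuous_rightTranslate (f : C(Fin n → G, W)) :
    Continuous fun h : Fin n → G => rightTranslate h f :=
  (ContinuousMap.curry ⟨fun p : (Fin n → G) × (Fin n → G) => f (p.2 * p.1), by fun_prop⟩).continuous

omit [T2Space G] [CompleteSpace W] in
-- By Fubini and the substitution `y = x h`, the inner integral for fixed `x` pairs `f` with the
-- function `y ↦ conj (ψ (x⁻¹ y)) • f x`. That function lies in `trigSpace ρ W d`, because `trigPoly
-- ρ n d` is stable under translation and conjugation.
theorem integral_mul_inner_rightTranslate_eq_zero {N : ℕ} (ρ : FaithfulRep EG G N) {d : ℕ}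
    {ψ : C(Fin n → G, ℂ)} (hψ : ψ ∈ trigPoly ρ n d) (f : C(Fin n → G, W))
    (hf : ∀ g ∈ trigSpace ρ W d, inner ℂ (toL2 μ g) (toL2 μ f) = 0) :
    ∫ h, ψ h * inner ℂ (toL2 μ f) (toL2 μ (rightTranslate h f))
      ∂(Measure.pi fun _ : Fin n => μ) = 0 := by
  simp_rw [inner_toL2, ← integral_const_mul]
  rw [integral_integral_swap]
  · refine integral_eq_zero_of_ae (Filter.Eventually.of_forall fun x => ?_)
    have h1 := integral_mul_left_eq_self (μ := Measure.pi fun _ : Fin n => μ)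
      (fun y => ψ (x⁻¹ * y) * inner ℂ (f x) (f y)) x
    simp only [inv_mul_cancel_left] at h1
    have h2 := hf _ (smulConst_mem_trigSpace ρ
      (star_mem_trigPoly ρ (translateHom_mem ρ x⁻¹ 1 hψ)) (f x))
    rw [inner_toL2] at h2
    refine h1.trans (Eq.trans (integral_congr_ae (Filter.Eventually.of_forall fun y => ?_)) h2)
    simp [smulConst, translateHom, mul_comm]
  · refine Continuous.integrable_of_hasCompactSupport ?_ (HasCompactSupport.of_compactSpace _)
    simp only [Function.uncurry_def, rightTranslate, ContinuousMap.coe_mk]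
    fun_prop

omit [ChartedSpace EG G] [T2Space G] [IsTopologicalGroup G] [NormedSpace ℝ EG] [Group G]
  [NormedAddCommGroup EG] [μ.IsHaarMeasure] in
-- If `ψ` were `χ` and `J` were constantly `A²` on the support, the integral would be `c A²` rather
-- than `0`. The error from `ψ` is at most `c A² / 2` and the error from `J` at most `c A X`, so `c
-- A² ≤ c A² / 2 + c A X`.
theorem le_two_mul_of_integral_mul_eq_zero {χ : C(Fin n → G, ℝ)} {ψ : C(Fin n → G, ℂ)}
    (hχ : ∀ h, 0 ≤ χ h) (hc : 0 < ∫ h, χ h ∂(Measure.pi fun _ : Fin n => μ))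
    (hψ : ∀ h, ‖ψ h - χ h‖ ≤ (∫ h, χ h ∂(Measure.pi fun _ : Fin n => μ)) / 2)
    {J : (Fin n → G) → ℂ} (hJ : Continuous J)
    (hψJ : ∫ h, ψ h * J h ∂(Measure.pi fun _ : Fin n => μ) = 0)
    {A X : ℝ} (hA : 0 ≤ A) (hX : 0 ≤ X) (hJA : ∀ h, ‖J h‖ ≤ A ^ 2)
    (hJX : ∀ h, χ h ≠ 0 → ‖J h - (A : ℂ) ^ 2‖ ≤ A * X) : A ≤ 2 * X := by
  set c := ∫ h, χ h ∂(Measure.pi fun _ : Fin n => μ) with hc'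
  have hint {F : (Fin n → G) → ℂ} (hF : Continuous F) :
      Integrable F (Measure.pi fun _ : Fin n => μ) :=
    hF.integrable_of_hasCompactSupport (HasCompactSupport.of_compactSpace _)
  have hint' {F : (Fin n → G) → ℝ} (hF : Continuous F) :
      Integrable F (Measure.pi fun _ : Fin n => μ) :=
    hF.integrable_of_hasCompactSupport (HasCompactSupport.of_compactSpace _)
  have h0 : ∫ h, (ψ h * J h - (χ h : ℂ) * (A : ℂ) ^ 2) ∂(Measure.pi fun _ : Fin n => μ) =
      -((c * A ^ 2 : ℝ) : ℂ) := by
    have h1 : ∫ h, (χ h : ℂ) ∂(Measure.pi fun _ : Fin n => μ) = c := integral_ofReal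
    rw [integral_sub (hint (F := fun h => ψ h * J h) (by fun_prop))
      (hint (F := fun h => (χ h : ℂ) * (A : ℂ) ^ 2) (by fun_prop)), hψJ, zero_sub,
      integral_mul_const, h1]
    push_cast
    rfl
  have h1 (h : Fin n → G) : ‖ψ h * J h - (χ h : ℂ) * (A : ℂ) ^ 2‖ ≤
      c / 2 * A ^ 2 + χ h * (A * X) := by
    have e1 : ψ h * J h - (χ h : ℂ) * (A : ℂ) ^ 2 =
        (ψ h - χ h) * J h + χ h * (J h - (A : ℂ) ^ 2) := by ring
    rw [e1]
    refine (norm_add_le _ _).trans (add_le_add ?_ ?_)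
    · rw [norm_mul]
      exact mul_le_mul (hψ h) (hJA h) (norm_nonneg _) (half_pos hc).le
    · rw [norm_mul, Complex.norm_real, Real.norm_of_nonneg (hχ h)]
      by_cases hh : χ h = 0
      · rw [hh, zero_mul, zero_mul]
      · exact mul_le_mul_of_nonneg_left (hJX h hh) (hχ h)
  have h2 := norm_integral_le_of_norm_le
    (hint' (F := fun h => c / 2 * A ^ 2 + χ h * (A * X)) (by fun_prop))
    (Filter.Eventually.of_forall h1)
  rw [h0, norm_neg, Complex.norm_real, Real.norm_of_nonneg (by positivity),
    integral_add (hint' continuous_const) (hint' (F := fun h => χ h * (A * X)) (by fun_prop)),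
    integral_const, integral_mul_const, ← hc', probReal_univ, one_smul] at h2
  rcases hA.eq_or_lt with h | h
  · rw [← h]; positivity
  · have h3 : c * (A * A) ≤ c * (A * (2 * X)) := by nlinarith
    exact le_of_mul_le_mul_left (le_of_mul_le_mul_left h3 hc) h

variable [LieGroup 𝓘(ℝ, EG) ∞ G]

omit [CompleteSpace W] in
/-- A polynomial in the matrix coefficients that is orthogonal to all those of small degree is
small compared with its gradient. -/
theorem exists_norm_le_of_orthogonal_trigSpace [FiniteDimensional ℂ W] {N : ℕ}
    (ρ : FaithfulRep EG G N) {q : ℕ}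
    (e : Module.Basis (Fin q) ℝ EG) (n : ℕ) {ε : ℝ} (hε : 0 < ε) :
    ∃ d, ∀ d', ∀ f : trigSpace ρ (n := n) W d',
      (∀ g ∈ trigSpace ρ W d, inner ℂ (toL2 μ g) (toL2 μ f.1) = 0) →
      ‖toL2 μ f.1‖ ≤ ε * ∑ a : Fin n × Fin q,
        ‖toL2 μ ((isTranslationInvariant_trigSpace ρ d').deriv a.1 (e a.2) f :
          C(Fin n → G, W))‖ := by
  -- One factor `n` comes from moving the `n` coordinates separately, and the factor `2` from
  -- `le_two_mul_of_integral_mul_eq_zero`.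
  obtain ⟨δ, hδ, hδε⟩ : ∃ δ > 0, 2 * (n * δ) ≤ ε := by
    refine ⟨ε / (2 * (n + 1)), by positivity, ?_⟩
    rw [← mul_assoc, ← mul_div_assoc, div_le_iff₀ (by positivity)]
    nlinarith
  -- The neighbourhood is chosen uniformly over all invariant spaces `V`, so the bump function, its
  -- approximation `ψ` and the degree `d` do not depend on `d'` or `f`.
  set U : Set (Fin n → G) := {h | ∀ k, ∀ (n : ℕ) (V : Submodule ℂ C(Fin n → G, W))
      [FiniteDimensional ℂ V] (hV : IsTranslationInvariant EG V) (l : Fin n) (f : V),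
      ‖toL2 μ (rightTranslate (Pi.mulSingle l (h k)) (f : C(Fin n → G, W))) - toL2 μ f.1‖ ≤ δ *
        ∑ a : Fin n × Fin q, ‖toL2 μ (hV.deriv a.1 (e a.2) f : C(Fin n → G, W))‖} with hU
  have hU1 : U ∈ nhds (1 : Fin n → G) := Filter.eventually_all.2 fun k =>
    (show Filter.Tendsto (fun h : Fin n → G => h k) (nhds 1) (nhds 1) from
      (continuous_apply k).tendsto 1).eventually (norm_rightTranslate_sub_le EG μ W e hδ)
  obtain ⟨O, hOU, hO, h1O⟩ := mem_nhds_iff.1 hU1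
  obtain ⟨χ, hχ0, hχ1, hχ⟩ := exists_continuous_zero_one_of_isClosed hO.isClosed_compl
    (isClosed_singleton (x := (1 : Fin n → G))) (by simpa using h1O)
  have hχ1 : χ 1 = 1 := hχ1 rfl
  set c := ∫ h, χ h ∂(Measure.pi fun _ : Fin n => μ) with hc
  have hc0 : 0 < c := χ.continuous.integral_pos_of_hasCompactSupport_nonneg_nonzero
    (HasCompactSupport.of_compactSpace _) (fun h => (hχ h).1) (x := 1) (by simp [hχ1])
  -- The threshold `d` is the degree of a polynomial within `c / 2` of the bump function;
  -- orthogonality to degree `d` then kills the pairing with `ψ`.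
  obtain ⟨d, ψ, hψ, hψχ⟩ := exists_mem_trigPoly_dist_lt ρ
    (⟨fun h => (χ h : ℂ), by fun_prop⟩ : C(Fin n → G, ℂ)) (half_pos hc0)
  refine ⟨d, fun d' f hf => ?_⟩
  set S := ∑ a : Fin n × Fin q, ‖toL2 μ ((isTranslationInvariant_trigSpace ρ d').deriv a.1
    (e a.2) f : C(Fin n → G, W))‖ with hS
  have hS0 : 0 ≤ S := Finset.sum_nonneg fun _ _ => norm_nonneg _
  have h1 : ‖toL2 μ f.1‖ ≤ 2 * (n * δ * S) := by
    refine le_two_mul_of_integral_mul_eq_zero μ (fun h => (hχ h).1) hc0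
      (fun h => (ContinuousMap.norm_coe_le_norm _ h).trans hψχ.le)
      (continuous_const.inner ((toL2 μ).continuous.comp (continuous_rightTranslate f.1)))
      (integral_mul_inner_rightTranslate_eq_zero μ ρ hψ f.1 hf) (norm_nonneg _) (by positivity)
      (fun h => ?_) fun h hh => ?_
    · refine (norm_inner_le_norm _ _).trans ?_
      rw [Function.comp_apply, norm_toL2_rightTranslate, sq]
    · have hhO : h ∈ O := by
        by_contra hhO
        exact hh (hχ0 hhO)
      have e2 : inner ℂ (toL2 μ f.1) (toL2 μ (rightTranslate h f.1)) - (‖toL2 μ f.1‖ : ℂ) ^ 2 =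
          inner ℂ (toL2 μ f.1) (toL2 μ (rightTranslate h f.1) - toL2 μ f.1) := by
        rw [inner_sub_right, inner_self_eq_norm_sq_to_K]
        rfl
      refine (congrArg norm e2).trans_le ((norm_inner_le_norm _ _).trans
        (mul_le_mul_of_nonneg_left ?_ (norm_nonneg _)))
      refine (norm_rightTranslate_sub_le_sum μ h f.1).trans ?_
      refine (Finset.sum_le_sum fun k _ => hOU hhO k n _
        (isTranslationInvariant_trigSpace ρ d') k f).trans_eq ?_
      rw [Finset.sum_const, Finset.card_univ, Fintype.card_fin, nsmul_eq_mul, mul_assoc]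
  refine h1.trans ?_
  rw [← mul_assoc]
  exact mul_le_mul_of_nonneg_right hδε hS0

end Spectral

/-! ### Dirac operators with constant coefficients on `Gⁿ` -/

section Dirac
variable {EG : Type*} [NormedAddCommGroup EG] [NormedSpace ℝ EG]
  {G : Type*} [TopologicalSpace G] [ChartedSpace EG G] [Group G] {n : ℕ}
  {W : Type*} [NormedAddCommGroup W] [InnerProductSpace ℂ W] {q : ℕ}

/-- The operator `(1/i) ∑ₐ cₐ ∂ₐ`. -/
def diracOf (e : Fin q → EG) (c : Fin n × Fin q → W →L[ℂ] W) (f : (Fin n → G) → W)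
    (x : Fin n → G) : W :=
  (Complex.I)⁻¹ • ∑ a, c a (chartDeriv a.1 (e a.2) f x)

variable [IsTopologicalGroup G] [SecondCountableTopology G]
  [CompactSpace G] [MeasurableSpace G] [BorelSpace G] (μ : Measure G)
  [IsProbabilityMeasure μ]

omit [NormedAddCommGroup EG] [NormedSpace ℝ EG] [ChartedSpace EG G] [Group G]
  [IsTopologicalGroup G] in
theorem compLpL_toL2 (L : W →L[ℂ] W) (f : C(Fin n → G, W)) :
    L.compLpL 2 (Measure.pi fun _ : Fin n => μ) (toL2 μ f) = toL2 μ ((L : C(W, W)).comp f) := by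
  refine Lp.ext ?_
  filter_upwards [L.coeFn_compLpL (toL2 μ f),
    ContinuousMap.coeFn_toLp (p := 2) (𝕜 := ℂ) (Measure.pi fun _ : Fin n => μ) f,
    ContinuousMap.coeFn_toLp (p := 2) (𝕜 := ℂ) (Measure.pi fun _ : Fin n => μ)
      ((L : C(W, W)).comp f)] with x h1 h2 h3
  rw [h1, h2, h3]
  rfl

theorem inner_compLpL {X : Type*} [MeasurableSpace X] {ν : Measure X} {L : W →L[ℂ] W}
    (hL : ∀ x y, inner ℂ (L x) y = inner ℂ x (L y)) (x y : Lp W 2 ν) :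
    inner ℂ (L.compLpL 2 ν x) y = inner ℂ x (L.compLpL 2 ν y) := by
  rw [L2.inner_def, L2.inner_def]
  refine integral_congr_ae ?_
  filter_upwards [L.coeFn_compLpL x, L.coeFn_compLpL y] with t h1 h2
  rw [h1, h2, hL]

theorem compLpL_anticomm {X : Type*} [MeasurableSpace X] {ν : Measure X} {ι : Type*}
    [DecidableEq ι] {c : ι → W →L[ℂ] W}
    (hc : ∀ a b x, c a (c b x) + c b (c a x) = if a = b then (2 : ℂ) • x else 0) (a b : ι)
    (x : Lp W 2 ν) : (c a).compLpL 2 ν ((c b).compLpL 2 ν x) +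
      (c b).compLpL 2 ν ((c a).compLpL 2 ν x) = if a = b then (2 : ℂ) • x else 0 := by
  have h : (c a).compLpL 2 ν ((c b).compLpL 2 ν x) +
      (c b).compLpL 2 ν ((c a).compLpL 2 ν x) = (if a = b then (2 : ℂ) else 0) • x := by
    refine Lp.ext ?_
    filter_upwards [Lp.coeFn_add ((c a).compLpL 2 ν ((c b).compLpL 2 ν x))
        ((c b).compLpL 2 ν ((c a).compLpL 2 ν x)), Lp.coeFn_smul (if a = b then (2 : ℂ) else 0) x,
      (c a).coeFn_compLpL ((c b).compLpL 2 ν x), (c b).coeFn_compLpL x,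
      (c b).coeFn_compLpL ((c a).compLpL 2 ν x), (c a).coeFn_compLpL x] with t h1 h2 h3 h4 h5 h6
    rw [h1, h2, Pi.add_apply, h3, h4, h5, h6, hc, Pi.smul_apply]
    split_ifs
    · rfl
    · rw [zero_smul]
  rw [h]
  split_ifs
  · rfl
  · rw [zero_smul]

variable [LieGroup 𝓘(ℝ, EG) ∞ G]

omit [IsTopologicalGroup G] [SecondCountableTopology G] [CompactSpace G] [MeasurableSpace G]
  [BorelSpace G] in
theorem continuous_diracOf (e : Fin q → EG) (c : Fin n × Fin q → W →L[ℂ] W) {f : (Fin n → G) → W}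
    (hf : SmoothFun EG f) : Continuous (diracOf e c f) :=
  (continuous_finsetSum _ fun a _ =>
    (c a).continuous.comp (continuous_chartDeriv a.1 (e a.2) hf)).const_smul _

/-- This is `clifford_estimate` with the coefficients acting pointwise on `L²`. The constant depends
only on `n`, `q` and the brackets of the basis fields, never on the finite-dimensional space `V`. -/
theorem exists_gradient_estimate [μ.IsHaarMeasure] (e : Module.Basis (Fin q) ℝ EG)
    {c : Fin n × Fin q → W →L[ℂ] W} (hsym : ∀ a x y, inner ℂ (c a x) y = inner ℂ x (c a y))
    (hanti : ∀ a b x, c a (c b x) + c b (c a x) = if a = b then (2 : ℂ) • x else 0) :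
    ∃ C : ℝ, 0 ≤ C ∧ ∀ (V : Submodule ℂ C(Fin n → G, W)) [FiniteDimensional ℂ V]
      (hV : IsTranslationInvariant EG V) (f : V) (g : C(Fin n → G, W)),
      (∀ x, g x = diracOf e c f.1 x) →
      (∑ a : Fin n × Fin q, ‖toL2 μ (hV.deriv a.1 (e a.2) f : C(Fin n → G, W))‖) ^ 2 ≤
        C * (‖toL2 μ f.1‖ ^ 2 + ‖toL2 μ g‖ ^ 2) := by
  have : FiniteDimensional ℝ EG := e.finiteDimensional_of_finite
  choose z hz using fun i j => exists_bracket EG G (W := W) (e i) (e j)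
  set M := ∑ i, ∑ j, ∑ l, |e.repr (z i j) l| with hM
  have hM' (i j) : ∑ l, |e.repr (z i j) l| ≤ M := by
    refine le_trans ?_ (Finset.single_le_sum (f := fun i => ∑ j, ∑ l, |e.repr (z i j) l|)
      (fun i _ => by positivity) (Finset.mem_univ i))
    exact Finset.single_le_sum (f := fun j => ∑ l, |e.repr (z i j) l|)
      (fun i _ => by positivity) (Finset.mem_univ j)
  have hM0 : 0 ≤ M := by positivity
  refine ⟨2 * (Fintype.card (Fin n × Fin q) : ℝ) + ((Fintype.card (Fin n × Fin q) : ℝ) ^ 3 * M) ^ 2,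
    by positivity, fun V _ hV f g hg => ?_⟩
  let F (a : Fin n × Fin q) : V := hV.deriv a.1 (e a.2) f
  let K (a b : Fin n × Fin q) : V := hV.deriv a.1 (e a.2) (F b)
  have key := clifford_estimate (fun a => (c a).compLpL 2 (Measure.pi fun _ : Fin n => μ))
    (fun a => inner_compLpL (hsym a)) (compLpL_anticomm hanti) (toL2 μ f.1)
    (fun a => toL2 μ (F a).1) (fun a b => toL2 μ (K a b).1) (fun a b => ?_) hM0 (fun a b => ?_)
  · have h1 : ‖∑ a, (c a).compLpL 2 (Measure.pi fun _ : Fin n => μ) (toL2 μ (F a).1)‖ =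
        ‖toL2 μ g‖ := by
      have h2 : g = (Complex.I)⁻¹ • ∑ a, ((c a : C(W, W)).comp (F a).1) := by
        ext x
        rw [hg, diracOf]
        simp [F, hV.deriv_apply]
      rw [h2, map_smul, norm_smul, map_sum]
      simp only [compLpL_toL2]
      simp
    rw [h1] at key
    exact key
  · simp only [compLpL_toL2, inner_toL2]
    let L : W →L[ℝ] W := ((c a).comp (c b)).restrictScalars ℝ
    have hs : SmoothFun EG (fun x => L ((F b).1 x)) :=
      (contMDiff_iff_contDiff.2 L.contDiff).comp (hV.smooth _ (F b).2)
    have h1 := integral_inner_chartDeriv μ a.1 (e a.2) (hV.smooth _ f.2) hs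
    refine Eq.trans (integral_congr_ae (Filter.Eventually.of_forall fun x => ?_)) (h1.trans
      (congrArg Neg.neg (integral_congr_ae (Filter.Eventually.of_forall fun x => ?_))))
    · exact congrArg (fun w => inner ℂ w (c a (c b ((F b).1 x))))
        (hV.deriv_apply a.1 (e a.2) f x)
    · simp only [chartDeriv_linear L a.1 (e a.2) (hV.smooth _ (F b).2), K, hV.deriv_apply,
        ContinuousMap.comp_apply]
      rfl
  -- Derivatives in the same variable commute up to a first-order term, bounded by the gradient;
  -- derivatives in different variables commute exactly.
  · rw [← map_sub]
    by_cases hab : a.1 = b.1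
    · obtain ⟨k, i⟩ := a
      obtain ⟨l, j⟩ := b
      obtain rfl : k = l := hab
      have h1 : (K (k, i) (k, j)).1 - (K (k, j) (k, i)).1 = (hV.deriv k (z i j) f).1 := by
        have h2 := congrArg Subtype.val (hz i j n V hV k f)
        simp only [K, F]
        rw [h2]
        simp
      rw [h1]
      exact (norm_deriv_le μ hV e k _ f).trans
        (mul_le_mul_of_nonneg_right (hM' i j) (Finset.sum_nonneg fun _ _ => norm_nonneg _))
    · have h1 : K a b = K b a := hV.deriv_comm_of_ne hab _ _ _
      rw [h1, sub_self, map_zero, norm_zero]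
      positivity

omit [IsTopologicalGroup G] in
/-- The span of the graph on smooth functions is the graph. -/
theorem mem_graph_of_smooth [μ.IsOpenPosMeasure] (e : Fin q → EG) (c : Fin n × Fin q → W →L[ℂ] W)
    {D : ((Fin n → G) → W) → (Fin n → G) → W}
    (hD : ∀ f, SmoothFun EG f → D f = diracOf e c f)
    (x y : Lp W 2 (Measure.pi fun _ : Fin n => μ)) :
    (x, y) ∈ (Submodule.span ℂ {p : Lp W 2 (Measure.pi fun _ : Fin n => μ) ×
        Lp W 2 (Measure.pi fun _ : Fin n => μ) | ∃ f : (Fin n → G) → W, SmoothFun EG f ∧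
        p.1 =ᵐ[Measure.pi fun _ : Fin n => μ] f ∧
        p.2 =ᵐ[Measure.pi fun _ : Fin n => μ] D f}).toLinearPMap.graph ↔
      ∃ f g : C(Fin n → G, W), SmoothFun EG f ∧ (∀ t, g t = diracOf e c f t) ∧ x = toL2 μ f ∧
        y = toL2 μ g := by
  let R : Submodule ℂ (Lp W 2 (Measure.pi fun _ : Fin n => μ) ×
      Lp W 2 (Measure.pi fun _ : Fin n => μ)) :=
    { carrier := {p | ∃ f g : C(Fin n → G, W), SmoothFun EG f ∧ (∀ t, g t = diracOf e c f t) ∧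
        p.1 = toL2 μ f ∧ p.2 = toL2 μ g}
      zero_mem' := by
        refine ⟨0, 0, contMDiff_const, fun t => ?_, by simp, by simp⟩
        have h (a : Fin n × Fin q) : chartDeriv a.1 (e a.2) (0 : C(Fin n → G, W)) t = 0 := by
          have := chartDeriv_linear (0 : W →L[ℝ] W) a.1 (e a.2)
            (contMDiff_const (c := (0 : W)) : SmoothFun EG fun _ : Fin n → G => (0 : W)) t
          exact this
        change (0 : W) = _
        simp only [diracOf, h, map_zero, Finset.sum_const_zero, smul_zero]
      add_mem' := by
        rintro p p' ⟨f, g, hf, hg, h1, h2⟩ ⟨f', g', hf', hg', h1', h2'⟩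
        refine ⟨f + f', g + g', hf.add hf', fun t => ?_, by simp [h1, h1'], by simp [h2, h2']⟩
        have h (a : Fin n × Fin q) := chartDeriv_add a.1 (e a.2) hf hf' t
        have h' (a : Fin n × Fin q) : chartDeriv a.1 (e a.2) (f + f' : C(Fin n → G, W)) t =
          chartDeriv a.1 (e a.2) f t + chartDeriv a.1 (e a.2) f' t := h a
        change g t + g' t = _
        simp only [hg, hg', diracOf, h', map_add, Finset.sum_add_distrib, smul_add]
      smul_mem' := by
        rintro r p ⟨f, g, hf, hg, h1, h2⟩
        let L : W →L[ℝ] W := (r • ContinuousLinearMap.id ℂ W).restrictScalars ℝ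
        refine ⟨r • f, r • g, (contMDiff_iff_contDiff.2 L.contDiff).comp hf, fun t => ?_,
          by simp [h1], by simp [h2]⟩
        have h' (a : Fin n × Fin q) : chartDeriv a.1 (e a.2) (r • f : C(Fin n → G, W)) t =
          r • chartDeriv a.1 (e a.2) f t := chartDeriv_linear L a.1 (e a.2) hf t
        simp only [ContinuousMap.smul_apply, hg, diracOf, h', map_smul, ← Finset.smul_sum]
        rw [smul_comm] }
  have hR : Submodule.span ℂ {p : Lp W 2 (Measure.pi fun _ : Fin n => μ) ×
        Lp W 2 (Measure.pi fun _ : Fin n => μ) | ∃ f : (Fin n → G) → W, SmoothFun EG f ∧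
        p.1 =ᵐ[Measure.pi fun _ : Fin n => μ] f ∧
        p.2 =ᵐ[Measure.pi fun _ : Fin n => μ] D f} = R := by
    refine le_antisymm (Submodule.span_le.2 ?_) fun p hp => Submodule.subset_span ?_
    · rintro p ⟨f, hf, h1, h2⟩
      rw [hD f hf] at h2
      refine ⟨⟨f, hf.continuous⟩, ⟨_, continuous_diracOf e c hf⟩, hf, fun t => rfl,
        Lp.ext (h1.trans ?_), Lp.ext (h2.trans ?_)⟩
      · exact (ContinuousMap.coeFn_toLp (p := 2) (𝕜 := ℂ) _ (⟨f, hf.continuous⟩ : C(_, W))).symm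
      · exact (ContinuousMap.coeFn_toLp (p := 2) (𝕜 := ℂ) _
          (⟨_, continuous_diracOf e c hf⟩ : C(_, W))).symm
    · obtain ⟨f, g, hf, hg, h1, h2⟩ := hp
      refine ⟨f, hf, ?_, ?_⟩
      · rw [h1]; exact ContinuousMap.coeFn_toLp _ _
      · rw [h2, hD f hf, ← funext hg]; exact ContinuousMap.coeFn_toLp _ _
  rw [hR, Submodule.toLinearPMap_graph_eq]
  · rfl
  -- The span is the graph of a function: the measure has full support, so a continuous `f` that
  -- vanishes in `L²` vanishes identically, and then so does its image.
  · rintro p ⟨f, g, hf, hg, h1, h2⟩ h0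
    rw [h0] at h1
    have hf0 : f = 0 := by
      refine ContinuousMap.toLp_injective (p := 2) (𝕜 := ℂ) (Measure.pi fun _ : Fin n => μ) ?_
      rw [map_zero]
      exact h1.symm
    have hg0 : g = 0 := by
      obtain ⟨f', g', hf', hg', h1', h2'⟩ := R.zero_mem
      have hf0' : f' = 0 := by
        refine ContinuousMap.toLp_injective (p := 2) (𝕜 := ℂ) (Measure.pi fun _ : Fin n => μ) ?_
        rw [map_zero]
        exact h1'.symm
      have : g = g' := by
        ext t
        rw [hg, hg', hf0, hf0']
      rw [this]
      refine ContinuousMap.toLp_injective (p := 2) (𝕜 := ℂ) (Measure.pi fun _ : Fin n => μ) ?_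
      rw [map_zero]
      exact h2'.symm
    rw [h2, hg0, map_zero]

variable {A : Lp W 2 (Measure.pi fun _ : Fin n => μ) →ₗ.[ℂ] Lp W 2 (Measure.pi fun _ : Fin n => μ)}
  {c : Fin n × Fin q → W →L[ℂ] W}

/-- The derivatives are skew, the coefficients symmetric and constant, and conjugating `1/i`
supplies the compensating sign. -/
theorem isFormalAdjoint_of_mem_graph_iff [μ.IsHaarMeasure] {e : Fin q → EG}
    (hsym : ∀ a x y, inner ℂ (c a x) y = inner ℂ x (c a y))
    (hA : ∀ x y, (x, y) ∈ A.graph → ∃ f g : C(Fin n → G, W), SmoothFun EG f ∧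
      (∀ t, g t = diracOf e c f t) ∧ x = toL2 μ f ∧ y = toL2 μ g) : A.IsFormalAdjoint A := by
  intro x y
  obtain ⟨f, g, hf, hg, h1, h2⟩ := hA _ _ (A.mem_graph x)
  obtain ⟨f', g', hf', hg', h1', h2'⟩ := hA _ _ (A.mem_graph y)
  rw [h1, h2, h1', h2', inner_toL2, inner_toL2]
  simp only [hg, hg', diracOf, inner_smul_left, inner_smul_right, sum_inner, inner_sum]
  have hint {F : (Fin n → G) → ℂ} (hF : Continuous F) :
      Integrable F (Measure.pi fun _ : Fin n => μ) :=
    hF.integrable_of_hasCompactSupport (HasCompactSupport.of_compactSpace _)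
  rw [integral_const_mul, integral_const_mul, integral_finsetSum, integral_finsetSum,
    Finset.mul_sum, Finset.mul_sum]
  · refine Finset.sum_congr rfl fun a _ => ?_
    let L : W →L[ℝ] W := (c a).restrictScalars ℝ
    have hs : SmoothFun EG (fun x => L (f' x)) := (contMDiff_iff_contDiff.2 L.contDiff).comp hf'
    have h3 := integral_inner_chartDeriv μ a.1 (e a.2) hf hs
    simp only [chartDeriv_linear L a.1 (e a.2) hf'] at h3
    have h4 : ∫ x, inner ℂ (c a (chartDeriv a.1 (e a.2) f x)) (f' x)
        ∂(Measure.pi fun _ : Fin n => μ) = -∫ x, inner ℂ (f x) (c a (chartDeriv a.1 (e a.2) f' x))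
        ∂(Measure.pi fun _ : Fin n => μ) := by
      simp only [hsym]
      exact h3
    rw [h4]
    simp
  · exact fun a _ => hint (hf.continuous.inner ((c a).continuous.comp
      (continuous_chartDeriv a.1 (e a.2) hf')))
  · exact fun a _ => hint (((c a).continuous.comp
      (continuous_chartDeriv a.1 (e a.2) hf)).inner hf'.continuous)

/-- A Dirac operator on `Gⁿ` has an orthonormal basis of eigenvectors. -/
theorem exists_eigenbasis_dirac [T2Space G] [μ.IsHaarMeasure] [FiniteDimensional ℂ W] {N : ℕ}
    (ρ : FaithfulRep EG G N) {e : Module.Basis (Fin q) ℝ EG}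
    (hsym : ∀ a x y, inner ℂ (c a x) y = inner ℂ x (c a y))
    (hanti : ∀ a b x, c a (c b x) + c b (c a x) = if a = b then (2 : ℂ) • x else 0)
    (hA : ∀ x y, (x, y) ∈ A.graph ↔ ∃ f g : C(Fin n → G, W), SmoothFun EG f ∧
      (∀ t, g t = diracOf e c f t) ∧ x = toL2 μ f ∧ y = toL2 μ g) :
    ∃ (ι : Type) (b : HilbertBasis ι ℂ (Lp W 2 (Measure.pi fun _ : Fin n => μ))) (l : ι → ℝ),
      (∀ i, (b i, (l i : ℂ) • b i) ∈ A.graph) ∧ ∀ C : ℝ, {i | |l i| ≤ C}.Finite := by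
  have : CompleteSpace W := FiniteDimensional.complete ℂ W
  -- Degrees are shifted by one because `exists_eigenbasis` starts its exhaustion from the zero
  -- space, whereas degree zero already contains the constants.
  let V : ℕ → Submodule ℂ (Lp W 2 (Measure.pi fun _ : Fin n => μ))
    | 0 => ⊥
    | d + 1 => (trigSpace ρ W d).map (toL2 μ).toLinearMap
  have : ∀ d, FiniteDimensional ℂ (V d)
    | 0 => inferInstanceAs (FiniteDimensional ℂ (⊥ : Submodule ℂ _))
    | d + 1 => inferInstanceAs (FiniteDimensional ℂ ((trigSpace ρ W d).map (toL2 μ).toLinearMap))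
  have hmono : Monotone V := monotone_nat_of_le_succ fun d => by
    cases d with
    | zero => exact bot_le
    | succ d => exact Submodule.map_mono (trigSpace_mono ρ W d.le_succ)
  have hcases {d x} (hx : x ∈ V d) : ∃ d, ∃ f ∈ trigSpace ρ W d, toL2 μ f = x := by
    cases d with
    | zero => exact ⟨0, 0, zero_mem _, by rw [map_zero]; exact ((Submodule.mem_bot ℂ).1 hx).symm⟩
    | succ d => exact ⟨d, hx⟩
  refine exists_eigenbasis (isFormalAdjoint_of_mem_graph_iff μ hsym fun x y => (hA x y).1) V hmono
    rfl ?_ (fun d x hx => ?_) fun ε hε => ?_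
  · rw [← Submodule.dense_iff_topologicalClosure_eq_top]
    intro x
    refine Metric.mem_closure_iff.2 fun ε hε => ?_
    obtain ⟨-, ⟨f, rfl⟩, hf⟩ := Metric.mem_closure_iff.1
      (ContinuousMap.toLp_denseRange W (Measure.pi fun _ : Fin n => μ) ℂ (p := 2)
        (by simp) x) (ε / 2) (half_pos hε)
    obtain ⟨d, p, hp, hpf⟩ := exists_mem_trigSpace_dist_lt ρ f
      (show 0 < ε / 2 / (‖toL2 (n := n) (W := W) μ‖ + 1) by positivity)
    refine ⟨toL2 μ p, Submodule.mem_iSup_of_mem (d + 1) ⟨p, hp, rfl⟩, ?_⟩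
    refine (dist_triangle _ (toL2 μ f) _).trans_lt ?_
    have h1 : dist (toL2 μ f) (toL2 μ p) < ε / 2 := by
      rw [dist_comm, dist_eq_norm, ← map_sub]
      refine ((toL2 (n := n) (W := W) μ).le_opNorm (p - f)).trans_lt ?_
      rw [lt_div_iff₀ (by positivity)] at hpf
      nlinarith [norm_nonneg (p - f), norm_nonneg (toL2 (n := n) (W := W) μ)]
    linarith
  · cases d with
    | zero => exact ⟨0, zero_mem _, by rw [(Submodule.mem_bot ℂ).1 hx]; exact zero_mem _⟩
    | succ d =>
      obtain ⟨f, hf, rfl⟩ := hx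
      have hV := isTranslationInvariant_trigSpace ρ (n := n) (W := W) d
      let g : C(Fin n → G, W) := (Complex.I)⁻¹ • ∑ a : Fin n × Fin q,
        (c a : C(W, W)).comp (hV.deriv a.1 (e a.2) ⟨f, hf⟩ : C(Fin n → G, W))
      refine ⟨toL2 μ g, ⟨g, ?_, rfl⟩, (hA _ _).2 ⟨f, g, hV.smooth f hf, fun t => ?_, rfl, rfl⟩⟩
      · exact Submodule.smul_mem _ _ (Submodule.sum_mem _ fun a _ =>
          comp_mem_trigSpace ρ _ (hV.deriv a.1 (e a.2) ⟨f, hf⟩).2)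
      · simp [g, diracOf, hV.deriv_apply]
  · obtain ⟨C, hC0, hC⟩ := exists_gradient_estimate μ e hsym hanti
    -- Squaring turns the square root into `ε / (C + 1)`. Multiplied by the constant `C` of the
    -- gradient estimate, this stays below `ε`.
    obtain ⟨d, hd⟩ := exists_norm_le_of_orthogonal_trigSpace μ (W := W) ρ e n
      (show 0 < √(ε / (C + 1)) by positivity)
    refine ⟨d + 1, fun d' x hx hxV y hxy => ?_⟩
    obtain ⟨d', f, hf, rfl⟩ := hcases hx
    obtain ⟨f', g, hf', hg, h1, rfl⟩ := (hA _ _).1 hxy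
    obtain rfl : f = f' := ContinuousMap.toLp_injective (p := 2) (𝕜 := ℂ)
      (Measure.pi fun _ : Fin n => μ) h1
    have h2 := hd d' ⟨f, hf⟩ fun g hg => hxV _ ⟨g, hg, rfl⟩
    have h3 := hC _ (isTranslationInvariant_trigSpace ρ d') ⟨f, hf⟩ g hg
    have h4 := pow_le_pow_left₀ (norm_nonneg _) h2 2
    rw [mul_pow, Real.sq_sqrt (by positivity)] at h4
    refine h4.trans ((mul_le_mul_of_nonneg_left h3 (by positivity)).trans ?_)
    rw [← mul_assoc]
    refine mul_le_mul_of_nonneg_right ?_ (by positivity)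
    rw [div_mul_eq_mul_div, div_le_iff₀ (by positivity)]
    nlinarith

end Dirac

/-! ### The Clifford action on the fibre -/

namespace SpinTensor
variable {S : Type*} [NormedAddCommGroup S] [InnerProductSpace ℂ S] {n : ℕ}

theorem tprod_update_add (s : Fin n → S) (k : Fin n) (x y : S) :
    tprod (Function.update s k (x + y)) =
      tprod (Function.update s k x) + tprod (Function.update s k y) :=
  (PiTensorProduct.tprod ℂ).map_update_add _ _ _ _

theorem tprod_update_smul (s : Fin n → S) (k : Fin n) (c : ℂ) (x : S) :
    tprod (Function.update s k (c • x)) = c • tprod (Function.update s k x) :=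
  (PiTensorProduct.tprod ℂ).map_update_smul _ _ _ _

/-- Two linear maps agree if they agree on pure tensors. -/
theorem linearMap_ext {M : Type*} [AddCommGroup M] [Module ℂ M] {f g : SpinTensor S n →ₗ[ℂ] M}
    (h : ∀ s, f (tprod s) = g (tprod s)) : f = g := by
  ext x
  induction x using induction with
  | ht s => exact h s
  | hs c x hx => rw [map_smul, map_smul, hx]
  | ha x y hx hy => rw [map_add, map_add, hx, hy]

theorem map_isSymmetric [FiniteDimensional ℂ S] {f : Fin n → Module.End ℂ S}
    (hf : ∀ i, (f i).IsSymmetric) : (map f).IsSymmetric := by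
  intro x y
  induction x using induction with
  | hs c x hx => rw [map_smul, inner_smul_left, inner_smul_left, hx]
  | ha x x' hx hx' => rw [map_add, inner_add_left, inner_add_left, hx, hx']
  | ht s =>
    induction y using induction with
    | hs c x hx => rw [map_smul, inner_smul_right, inner_smul_right, hx]
    | ha x x' hx hx' => rw [map_add, inner_add_right, inner_add_right, hx, hx']
    | ht t =>
      rw [map_tprod, map_tprod, inner_tprod, inner_tprod]
      exact Finset.prod_congr rfl fun i _ => hf i _ _

end SpinTensor

section Cliff
variable {EG : Type*} [NormedAddCommGroup EG] [NormedSpace ℝ EG]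
  {G : Type*} [TopologicalSpace G] [ChartedSpace EG G] [Group G]
  {B : InvariantMetric EG G} {S : Type*} [NormedAddCommGroup S] [InnerProductSpace ℂ S]

theorem InvariantMetric.gen_mul_add_swap (B : InvariantMetric EG G)
    (x y : GroupLieAlgebra 𝓘(ℝ, EG) G) :
    B.gen x * B.gen y + B.gen y * B.gen x = (2 * B.form x y : ℂ) • (1 : B.Cl) := by
  simp only [InvariantMetric.gen, Algebra.TensorProduct.tmul_mul_tmul, mul_one,
    ← TensorProduct.tmul_add, CliffordAlgebra.ι_mul_ι_add_swap]
  rw [LinearMap.BilinMap.polar_toQuadraticMap, B.symm y x, Algebra.algebraMap_eq_smul_one,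
    ← TensorProduct.smul_tmul, Algebra.TensorProduct.one_def, TensorProduct.smul_tmul']
  congr 1
  rw [Complex.real_smul, smul_eq_mul]
  push_cast
  ring

namespace SpinModule
variable (σ : SpinModule B S) {n : ℕ}

theorem act_anticomm (x y : GroupLieAlgebra 𝓘(ℝ, EG) G) (s : S) :
    σ.act (B.gen x) (σ.act (B.gen y) s) + σ.act (B.gen y) (σ.act (B.gen x) s) =
      (2 * B.form x y : ℂ) • s := by
  have h := congrArg σ.act (B.gen_mul_add_swap x y)
  rw [map_add, map_mul, map_mul, map_smul, map_one] at h
  exact LinearMap.congr_fun h s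

theorem grading_grading (s : S) : σ.grading (σ.grading s) = s :=
  LinearMap.congr_fun σ.grading_sq s

theorem grading_act (x : GroupLieAlgebra 𝓘(ℝ, EG) G) (s : S) :
    σ.grading (σ.act (B.gen x) s) = -σ.act (B.gen x) (σ.grading s) :=
  LinearMap.congr_fun (σ.grading_anti x) s

theorem cliff_tprod (k : Fin n) (x : GroupLieAlgebra 𝓘(ℝ, EG) G) (s : Fin n → S) :
    σ.cliff k x (SpinTensor.tprod s) = SpinTensor.tprod fun i =>
      if i < k then σ.grading (s i) else if i = k then σ.act (B.gen x) (s i) else s i := by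
  rw [cliff, SpinTensor.map_tprod]
  congr 1
  funext i
  split_ifs <;> rfl

theorem cliff_isSymmetric [FiniteDimensional ℂ S] (k : Fin n) (x : GroupLieAlgebra 𝓘(ℝ, EG) G) :
    (σ.cliff k x).IsSymmetric := by
  refine SpinTensor.map_isSymmetric fun i => ?_
  split_ifs
  · exact σ.grading_symm
  · exact σ.act_symm x
  · exact fun _ _ => rfl

/-- In the factors before the `k`-th the grading occurs twice and squares to one, so the relation
reduces to the one in the `k`-th factor. -/
theorem cliff_anticomm_self (k : Fin n) (x y : GroupLieAlgebra 𝓘(ℝ, EG) G) :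
    σ.cliff k x * σ.cliff k y + σ.cliff k y * σ.cliff k x = (2 * B.form x y : ℂ) • 1 := by
  have h (x y : GroupLieAlgebra 𝓘(ℝ, EG) G) (s : Fin n → S) :
      σ.cliff k x (σ.cliff k y (SpinTensor.tprod s)) = SpinTensor.tprod
        (Function.update s k (σ.act (B.gen x) (σ.act (B.gen y) (s k)))) := by
    rw [cliff_tprod, cliff_tprod]
    congr 1
    funext i
    rcases lt_trichotomy i k with hi | rfl | hi
    · simp [hi, hi.ne, grading_grading]
    · simp
    · simp [hi.not_gt, hi.ne']
  refine SpinTensor.linearMap_ext fun s => ?_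
  rw [LinearMap.add_apply, Module.End.mul_apply, Module.End.mul_apply, h, h,
    ← SpinTensor.tprod_update_add, act_anticomm, SpinTensor.tprod_update_smul,
    Function.update_eq_self]
  rfl

/-- The two orders of multiplication differ only in the `k`-th factor, where `x` meets the grading
operator of the `l`-th generator and anticommutes with it. -/
theorem cliff_anticomm_of_lt {k l : Fin n} (hkl : k < l) (x y : GroupLieAlgebra 𝓘(ℝ, EG) G) :
    σ.cliff k x * σ.cliff l y + σ.cliff l y * σ.cliff k x = 0 := by
  refine SpinTensor.linearMap_ext fun s => ?_
  rw [LinearMap.add_apply, Module.End.mul_apply, Module.End.mul_apply]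
  set t : Fin n → S := fun i => if i < k then s i else
    if i = k then σ.act (B.gen x) (σ.grading (s i)) else
    if i < l then σ.grading (s i) else if i = l then σ.act (B.gen y) (s i) else s i with ht
  have h1 : σ.cliff k x (σ.cliff l y (SpinTensor.tprod s)) = SpinTensor.tprod t := by
    rw [cliff_tprod, cliff_tprod]
    congr 1
    funext i
    rcases lt_trichotomy i k with hi | rfl | hi
    · simp [ht, hi, hi.trans hkl, grading_grading]
    · simp [ht, hkl]
    · simp [ht, hi.not_gt, hi.ne']
  have h2 : σ.cliff l y (σ.cliff k x (SpinTensor.tprod s)) =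
      SpinTensor.tprod (Function.update t k ((-1 : ℂ) • t k)) := by
    rw [cliff_tprod, cliff_tprod]
    congr 1
    funext i
    rcases lt_trichotomy i k with hi | rfl | hi
    · simp [ht, hi, hi.trans hkl, hi.ne, grading_grading]
    · simp [ht, hkl, grading_act]
    · simp [ht, hi.not_gt, hi.ne']
  rw [h1, h2, SpinTensor.tprod_update_smul, Function.update_eq_self, neg_one_smul, add_neg_cancel]
  rfl

variable [FiniteDimensional ℂ S] (E : Type*) [NormedAddCommGroup E] [InnerProductSpace ℂ E]

/-- The Clifford action of the `a`-th basis vector on the fibre. -/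
def cliffOp {q : ℕ} (e : Fin q → GroupLieAlgebra 𝓘(ℝ, EG) G) (a : Fin n × Fin q) :
    Fiber E S n →L[ℂ] Fiber E S n :=
  (LinearMap.toContinuousLinearMap (σ.cliff a.1 (e a.2))).lTensor E

theorem cliffOp_anticomm {q : ℕ} {e : Fin q → GroupLieAlgebra 𝓘(ℝ, EG) G}
    (he : ∀ i j, B.form (e i) (e j) = if i = j then 1 else 0) (a b : Fin n × Fin q)
    (x : Fiber E S n) :
    σ.cliffOp E e a (σ.cliffOp E e b x) + σ.cliffOp E e b (σ.cliffOp E e a x) =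
      if a = b then (2 : ℂ) • x else 0 := by
  have h1 : σ.cliff a.1 (e a.2) * σ.cliff b.1 (e b.2) + σ.cliff b.1 (e b.2) * σ.cliff a.1 (e a.2) =
      (if a = b then (2 : ℂ) else 0) • 1 := by
    rcases lt_trichotomy a.1 b.1 with h | h | h
    · rw [cliff_anticomm_of_lt σ h, if_neg (fun hab => h.ne (congrArg _ hab)), zero_smul]
    · rw [← h, cliff_anticomm_self, he]
      congr 1
      by_cases h2 : a.2 = b.2
      · rw [if_pos h2, if_pos (Prod.ext h h2)]; simp
      · rw [if_neg h2, if_neg (fun hab => h2 (congrArg _ hab))]; simp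
    · rw [add_comm, cliff_anticomm_of_lt σ h, if_neg (fun hab => h.ne' (congrArg _ hab)), zero_smul]
  have h2 := congrArg (fun L => (LinearMap.toContinuousLinearMap L).lTensor E x) h1
  have h3 : (LinearMap.toContinuousLinearMap (σ.cliff a.1 (e a.2) * σ.cliff b.1 (e b.2) +
      σ.cliff b.1 (e b.2) * σ.cliff a.1 (e a.2))).lTensor E x =
      σ.cliffOp E e a (σ.cliffOp E e b x) + σ.cliffOp E e b (σ.cliffOp E e a x) := by
    have : LinearMap.toContinuousLinearMap (σ.cliff a.1 (e a.2) * σ.cliff b.1 (e b.2) +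
      σ.cliff b.1 (e b.2) * σ.cliff a.1 (e a.2)) =
        LinearMap.toContinuousLinearMap (σ.cliff a.1 (e a.2)) ∘L
          LinearMap.toContinuousLinearMap (σ.cliff b.1 (e b.2)) +
        LinearMap.toContinuousLinearMap (σ.cliff b.1 (e b.2)) ∘L
          LinearMap.toContinuousLinearMap (σ.cliff a.1 (e a.2)) := rfl
    rw [this, ContinuousLinearMap.lTensor_add, ContinuousLinearMap.lTensor_comp,
      ContinuousLinearMap.lTensor_comp]
    rfl
  rw [← h3]
  refine h2.trans ?_
  have h4 (r : ℂ) : LinearMap.toContinuousLinearMap (r • (1 : Module.End ℂ (SpinTensor S n))) =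
      r • 1 := rfl
  simp only [h4, ContinuousLinearMap.lTensor_smul, ContinuousLinearMap.lTensor_one]
  split_ifs
  · rfl
  · simp

theorem cliffOp_symm [FiniteDimensional ℂ E] {q : ℕ} (e : Fin q → GroupLieAlgebra 𝓘(ℝ, EG) G)
    (a : Fin n × Fin q)
    (x y : Fiber E S n) : inner ℂ (σ.cliffOp E e a x) y = inner ℂ x (σ.cliffOp E e a y) := by
  have : CompleteSpace E := FiniteDimensional.complete ℂ E
  have : CompleteSpace (SpinTensor S n) := FiniteDimensional.complete ℂ _
  have h1 : ContinuousLinearMap.adjoint (LinearMap.toContinuousLinearMap (σ.cliff a.1 (e a.2))) =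
      LinearMap.toContinuousLinearMap (σ.cliff a.1 (e a.2)) := by
    refine Eq.symm ((ContinuousLinearMap.eq_adjoint_iff _ _).2 fun s t => ?_)
    rw [LinearMap.coe_toContinuousLinearMap']
    exact σ.cliff_isSymmetric a.1 (e a.2) s t
  have h2 : ContinuousLinearMap.adjoint (σ.cliffOp E e a) = σ.cliffOp E e a := by
    rw [cliffOp, ContinuousLinearMap.adjoint_lTensor, h1]
  conv_rhs => rw [← h2]
  rw [ContinuousLinearMap.adjoint_inner_right]

end SpinModule
end Cliff

/-! ### The Dirac operator of a graph -/

section GraphDirac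
variable {EG : Type*} [NormedAddCommGroup EG] [NormedSpace ℝ EG]
  {G : Type*} [TopologicalSpace G] [ChartedSpace EG G] [Group G] [LieGroup 𝓘(ℝ, EG) ∞ G]
  [IsTopologicalGroup G] [SecondCountableTopology G] [CompactSpace G]
  [MeasurableSpace G] [BorelSpace G]
  (μ : Measure G) [μ.IsHaarMeasure] [IsProbabilityMeasure μ]
  {E : Type*} [NormedAddCommGroup E] [InnerProductSpace ℂ E] [FiniteDimensional ℂ E]
  {B : InvariantMetric EG G} {q : ℕ}
  {S : Type*} [NormedAddCommGroup S] [InnerProductSpace ℂ S] [FiniteDimensional ℂ S]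
  (σ : SpinModule B S) {n : ℕ}

omit [IsTopologicalGroup G] [SecondCountableTopology G] [CompactSpace G] [MeasurableSpace G]
  [BorelSpace G] [FiniteDimensional ℂ E] in
theorem diracFun_eq_diracOf (e : Fin q → GroupLieAlgebra 𝓘(ℝ, EG) G)
    {f : (Fin n → G) → Fiber E S n} (hf : SmoothFun EG f) :
    diracFun σ e f = diracOf (EG := EG) e (σ.cliffOp E e) f := by
  funext x
  simp only [diracFun, diracOf, Fintype.sum_prod_type, leftDeriv_eq_chartDeriv _ _ hf]
  rfl

omit [IsTopologicalGroup G] [FiniteDimensional ℂ E] [μ.IsHaarMeasure] in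
theorem mem_graph_diracCore [μ.IsOpenPosMeasure] (e : Fin q → GroupLieAlgebra 𝓘(ℝ, EG) G)
    (x y : GraphHilbert E S μ n) : (x, y) ∈ (diracCore E μ σ e n).graph ↔
      ∃ f g : C(Fin n → G, Fiber E S n), SmoothFun EG f ∧
        (∀ t, g t = diracOf (EG := EG) e (σ.cliffOp E e) f t) ∧ x = toL2 μ f ∧ y = toL2 μ g :=
  mem_graph_of_smooth (EG := EG) μ e (σ.cliffOp E e) (fun _ hf => diracFun_eq_diracOf σ e hf) x y

variable (E) in
theorem isFormalAdjoint_diracCore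
    (e : Fin q → GroupLieAlgebra 𝓘(ℝ, EG) G) :
    (diracCore E μ σ e n).IsFormalAdjoint (diracCore E μ σ e n) :=
  isFormalAdjoint_of_mem_graph_iff (EG := EG) μ (e := e) (σ.cliffOp_symm E e)
    fun x y => (mem_graph_diracCore μ σ e x y).1

variable [T2Space G] {N : ℕ} (ρ : FaithfulRep EG G N)
  {e : Module.Basis (Fin q) ℝ (GroupLieAlgebra 𝓘(ℝ, EG) G)}
  (he : ∀ i j, B.form (e i) (e j) = if i = j then 1 else 0)
include ρ he

variable (E) in
theorem exists_eigenbasis_diracCore :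
    ∃ (ι : Type) (b : HilbertBasis ι ℂ (GraphHilbert E S μ n)) (l : ι → ℝ),
      (∀ i, (b i, (l i : ℂ) • b i) ∈ (diracCore E μ σ e n).graph) ∧
        ∀ C : ℝ, {i | |l i| ≤ C}.Finite :=
  exists_eigenbasis_dirac μ ρ (e := (e : Module.Basis (Fin q) ℝ EG)) (σ.cliffOp_symm E e)
    (σ.cliffOp_anticomm E he) (mem_graph_diracCore μ σ e)

variable (E n) in
theorem dense_domain_dirac : Dense ((dirac E μ σ e n).domain : Set (GraphHilbert E S μ n)) := by
  obtain ⟨ι, b, l, hb, -⟩ := exists_eigenbasis_diracCore μ E σ ρ he (n := n)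
  exact (dense_domain_of_eigenbasis b l hb).mono (LinearPMap.le_closure _).1

variable (E n) in
theorem isClosable_diracCore : (diracCore E μ σ e n).IsClosable := by
  obtain ⟨ι, b, l, hb, -⟩ := exists_eigenbasis_diracCore μ E σ ρ he (n := n)
  exact isClosable_of_symmetric (isFormalAdjoint_diracCore μ E σ e)
    (dense_domain_of_eigenbasis b l hb)

variable (E n) in
theorem isSelfAdjoint_dirac : IsSelfAdjoint (dirac E μ σ e n) := by
  obtain ⟨ι, b, l, hb, -⟩ := exists_eigenbasis_diracCore μ E σ ρ he (n := n)
  exact isSelfAdjoint_closure_of_eigenbasis b l (isFormalAdjoint_diracCore μ E σ e) hb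

variable (E n) in
theorem exists_compact_resolvent_dirac :
    ∃ T : GraphHilbert E S μ n →L[ℂ] GraphHilbert E S μ n, T.IsPositive ∧ IsCompactOperator T ∧
      ∀ x, ∃ y z : (dirac E μ σ e n).domain,
        (y : GraphHilbert E S μ n) = T (T x) ∧ (z : GraphHilbert E S μ n) = dirac E μ σ e n y ∧
        (y : GraphHilbert E S μ n) + dirac E μ σ e n z = x := by
  obtain ⟨ι, b, l, hb, hfin⟩ := exists_eigenbasis_diracCore μ E σ ρ he (n := n)
  exact exists_compact_resolvent_of_eigenbasis b l (isFormalAdjoint_diracCore μ E σ e) hb hfin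

/-- A bounded operator that maps the graph of the Dirac operator on smooth functions to the graph
of another closed operator does so for the closure. -/
theorem map_mem_graph_of_smooth {H' : Type*} [NormedAddCommGroup H'] [InnerProductSpace ℂ H']
    [CompleteSpace H'] {D : H' →ₗ.[ℂ] H'} (hD : D.IsClosed)
    (Φ : GraphHilbert E S μ n × GraphHilbert E S μ n →L[ℂ] H' × H')
    (h : ∀ f g : C(Fin n → G, Fiber E S n), SmoothFun EG f →
      (∀ t, g t = diracOf (EG := EG) e (σ.cliffOp E e) f t) → Φ (toL2 μ f, toL2 μ g) ∈ D.graph)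
    (η : (dirac E μ σ e n).domain) : Φ (η, dirac E μ σ e n η) ∈ D.graph := by
  refine map_mem_closure_graph (isClosable_diracCore μ E σ n ρ he) hD Φ (fun p hp => ?_)
    ((dirac E μ σ e n).mem_graph η)
  obtain ⟨f, g, hf, hg, h1, h2⟩ := (mem_graph_diracCore μ σ e p.1 p.2).1 hp
  obtain ⟨x, y⟩ := p
  obtain rfl : x = toL2 μ f := h1
  obtain rfl : y = toL2 μ g := h2
  exact h f g hf hg

theorem isClosed_dirac : (dirac E μ σ e n).IsClosed :=
  (isClosable_diracCore μ E σ n ρ he).closure_isClosed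

omit [IsTopologicalGroup G] [FiniteDimensional ℂ E] [T2Space G] ρ he [μ.IsHaarMeasure] in
theorem toL2_mem_graph_dirac [μ.IsOpenPosMeasure] {f g : C(Fin n → G, Fiber E S n)} (hf : SmoothFun EG f)
    (hg : ∀ t, g t = diracOf (EG := EG) e (σ.cliffOp E e) f t) :
    (toL2 μ f, toL2 μ g) ∈ (dirac E μ σ e n).graph :=
  LinearPMap.le_graph_of_le (LinearPMap.le_closure _)
    ((mem_graph_diracCore μ σ e _ _).2 ⟨f, g, hf, hg, rfl, rfl⟩)

end GraphDirac

/-! ### Holonomies are smooth and have bounded commutators with the Dirac operator -/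

section SmoothHolonomy
variable {EG : Type*} [NormedAddCommGroup EG] [NormedSpace ℝ EG]
  {G : Type w} [TopologicalSpace G] [ChartedSpace EG G] [Group G] [LieGroup 𝓘(ℝ, EG) ∞ G]
  {N : ℕ} {V : Type u} [Quiver.{v} V] {n : ℕ} {F : Fin n → Arrow (Quiver.FreeGroupoid V)}

/-- The smooth maps `Gⁿ → G` form a group. By freeness the coordinate projections extend to a
connection `U` with values in it, and evaluating `U` at `x` gives the connection with coordinates
`x`. The holonomy along `γ` is therefore the smooth map `U.map γ`. -/
theorem contMDiff_holonomy (hF : IsFreeGenerating.{u, v, w} F) {a b : Quiver.FreeGroupoid V}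
    (γ : a ⟶ b) : ContMDiff (ModelWithCorners.pi fun _ : Fin n => 𝓘(ℝ, EG)) 𝓘(ℝ, EG) ∞
      fun x : Fin n → G => holonomy (connectionOf hF x) γ := by
  let X := C^∞⟮ModelWithCorners.pi fun _ : Fin n => 𝓘(ℝ, EG), Fin n → G; 𝓘(ℝ, EG), G⟯
  let f : Fin n → X := fun k => ⟨fun x => x k, contMDiff_apply_pi k⟩
  let U := (hF X f).choose
  have hU := (hF X f).choose_spec.1
  have key (x : Fin n → G) : connectionOf hF x = U ⋙ MonoidHom.toFunctor
      (⟨⟨fun f => f x, rfl⟩, fun _ _ => rfl⟩ : X →* G) := by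
    refine (eq_connectionOf hF x _ fun k => ?_).symm
    exact congrArg (fun f : X => f x) (hU k)
  simp only [key]
  exact (show X from U.map γ).contMDiff

omit [Group G] [LieGroup 𝓘(ℝ, EG) ∞ G] in
theorem smoothFun_finset_sum {W ι : Type*} [NormedAddCommGroup W] [NormedSpace ℝ W] (s : Finset ι)
    {f : ι → (Fin n → G) → W} (hf : ∀ i, SmoothFun EG (f i)) :
    SmoothFun EG fun x => ∑ i ∈ s, f i x := by
  classical
  induction s using Finset.induction_on with
  | empty => simpa using (contMDiff_const : SmoothFun EG fun _ : Fin n → G => (0 : W))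
  | insert i s hi ih =>
    simp only [Finset.sum_insert hi]
    exact (hf i).add ih

theorem smoothFun_holonomyAlgebra (hF : IsFreeGenerating.{u, v, w} F) (ρ : FaithfulRep EG G N)
    {ν : V} {b : Connection V G → Matrix (Fin N) (Fin N) ℂ} (hb : b ∈ holonomyAlgebra ρ ν)
    (i j : Fin N) : SmoothFun EG fun x : Fin n → G => b (connectionOf hF x) i j := by
  induction hb using StarAlgebra.adjoin_induction generalizing i j with
  | mem f hf =>
    obtain ⟨γ, rfl⟩ := hf
    exact (ρ.smooth i j).comp (contMDiff_holonomy hF γ)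
  | algebraMap c => exact contMDiff_const
  | add f g _ _ hf hg => exact (hf i j).add (hg i j)
  | mul f g _ _ hf hg =>
    have h : ContDiff ℝ ∞ fun z : ℂ × ℂ => z.1 * z.2 := contDiff_mul
    simp only [Pi.mul_apply, Matrix.mul_apply]
    exact smoothFun_finset_sum _ fun k =>
      (contMDiff_iff_contDiff.2 h).comp ((hf i k).prodMk_space (hg k j))
  | star f _ hf =>
    have h : ContDiff ℝ ∞ fun z : ℂ => star z := Complex.conjCLE.contDiff
    exact (contMDiff_iff_contDiff.2 h).comp (hf j i)

omit [Group G] [LieGroup 𝓘(ℝ, EG) ∞ G] in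
-- Smoothness is stated entry by entry, which avoids choosing a norm on matrices; expansion in
-- matrix units transfers it to the operators on the fibre.
theorem smoothFun_linearMap_comp {N : ℕ} {A : Type*} [NormedAddCommGroup A] [NormedSpace ℂ A]
    (L : Matrix (Fin N) (Fin N) ℂ →ₗ[ℂ] A) {f : (Fin n → G) → Matrix (Fin N) (Fin N) ℂ}
    (hf : ∀ i j, SmoothFun EG fun x => f x i j) : SmoothFun EG fun x => L (f x) := by
  have h1 (x : Fin n → G) : L (f x) = ∑ i, ∑ j, f x i j • L (Matrix.single i j 1) := by
    conv_lhs => rw [Matrix.matrix_eq_sum_single (f x)]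
    simp only [map_sum, ← map_smul, Matrix.smul_single, smul_eq_mul, mul_one]
  simp only [h1]
  refine smoothFun_finset_sum _ fun i => smoothFun_finset_sum _ fun j => ?_
  have h : ContDiff ℝ ∞ fun z : ℂ => z • L (Matrix.single i j 1) := contDiff_id.smul contDiff_const
  exact (contMDiff_iff_contDiff.2 h).comp (hf i j)

end SmoothHolonomy

/-! ### The Leibniz rule and bounded commutators. -/

section Commutator
variable {EG : Type*} [NormedAddCommGroup EG] [NormedSpace ℝ EG]
  {G : Type*} [TopologicalSpace G] [ChartedSpace EG G] [Group G] [LieGroup 𝓘(ℝ, EG) ∞ G] {n : ℕ}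
  {W : Type*} [NormedAddCommGroup W] [InnerProductSpace ℂ W] {q : ℕ}

omit [Group G] [LieGroup 𝓘(ℝ, EG) ∞ G] in
theorem smoothFun_apply {m : (Fin n → G) → W →L[ℂ] W} (hm : SmoothFun EG m) {f : (Fin n → G) → W}
    (hf : SmoothFun EG f) : SmoothFun EG fun x => m x (f x) := by
  have h : ContDiff ℝ ∞ fun p : (W →L[ℝ] W) × W => p.1 p.2 := isBoundedBilinearMap_apply.contDiff
  have h' := (ContinuousLinearMap.restrictScalarsL ℂ W W ℝ ℝ).contDiff (n := ∞)
  exact (contMDiff_iff_contDiff.2 h).comp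
    (((contMDiff_iff_contDiff.2 h').comp hm).prodMk_space hf)

/-- The Leibniz rule for a Dirac operator. -/
theorem diracOf_apply (e : Fin q → EG) {c : Fin n × Fin q → W →L[ℂ] W}
    {m : (Fin n → G) → W →L[ℂ] W} (hm : SmoothFun EG m) (hc : ∀ a x w, c a (m x w) = m x (c a w))
    {f : (Fin n → G) → W} (hf : SmoothFun EG f) (x : Fin n → G) :
    diracOf e c (fun y => m y (f y)) x = m x (diracOf e c f x) +
      ((Complex.I)⁻¹ • ∑ a, (c a).comp (chartDeriv a.1 (e a.2) m x)) (f x) := by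
  have h (a : Fin n × Fin q) : chartDeriv a.1 (e a.2) (fun y => m y (f y)) x =
      m x (chartDeriv a.1 (e a.2) f x) + chartDeriv a.1 (e a.2) m x (f x) :=
    chartDeriv_bilinear (ContinuousLinearMap.restrictScalarsL ℂ W W ℝ ℝ) a.1 (e a.2) hm hf x
  simp only [diracOf, h, map_add, hc, Finset.sum_add_distrib, smul_add, map_smul, map_sum]
  simp

variable [IsTopologicalGroup G] [SecondCountableTopology G] [CompactSpace G]
  [MeasurableSpace G] [BorelSpace G] (μ : Measure G) [IsProbabilityMeasure μ]

omit [NormedAddCommGroup EG] [NormedSpace ℝ EG] [ChartedSpace EG G] [Group G]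
  [LieGroup 𝓘(ℝ, EG) ∞ G] [IsTopologicalGroup G] in
theorem mulOp_toL2 [CompleteSpace W] (m : C(Fin n → G, W →L[ℂ] W)) {f g : C(Fin n → G, W)}
    (hg : ∀ x, g x = m x (f x)) :
    mulOp (Measure.pi fun _ : Fin n => μ) m (toL2 μ f) = toL2 μ g := by
  refine Lp.ext ?_
  filter_upwards [coeFn_mulOp (Measure.pi fun _ : Fin n => μ) m (toL2 μ f),
    ContinuousMap.coeFn_toLp (p := 2) (𝕜 := ℂ) (Measure.pi fun _ : Fin n => μ) f,
    ContinuousMap.coeFn_toLp (p := 2) (𝕜 := ℂ) (Measure.pi fun _ : Fin n => μ) g] with x h1 h2 h3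
  rw [h1, h2, h3, hg]

end Commutator

section Bounded
variable {EG : Type*} [NormedAddCommGroup EG] [NormedSpace ℝ EG]
  {G : Type w} [TopologicalSpace G] [ChartedSpace EG G] [Group G] [LieGroup 𝓘(ℝ, EG) ∞ G]
  [IsTopologicalGroup G] [SecondCountableTopology G] [CompactSpace G]
  [MeasurableSpace G] [BorelSpace G]
  (μ : Measure G) [μ.IsHaarMeasure] [IsProbabilityMeasure μ]
  {E : Type*} [NormedAddCommGroup E] [InnerProductSpace ℂ E] [FiniteDimensional ℂ E]
  [CompleteSpace E]
  {B : InvariantMetric EG G} {q : ℕ}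
  {S : Type*} [NormedAddCommGroup S] [InnerProductSpace ℂ S] [FiniteDimensional ℂ S]
  (σ : SpinModule B S) {n : ℕ} {N : ℕ} (ρ : FaithfulRep EG G N)
  (α : Matrix (Fin N) (Fin N) ℂ →⋆ₐ[ℂ] (E →L[ℂ] E))

omit [LieGroup 𝓘(ℝ, EG) ∞ G] [IsTopologicalGroup G] [SecondCountableTopology G] [CompactSpace G]
  [MeasurableSpace G] [BorelSpace G] [FiniteDimensional ℂ E] [CompleteSpace E] in
-- The two operators act on different tensor factors. This makes the first-order terms of the
-- commutator with `D` cancel.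
theorem cliffOp_rTensor (e : Fin q → GroupLieAlgebra 𝓘(ℝ, EG) G) (a : Fin n × Fin q)
    (T : E →L[ℂ] E) (x : Fiber E S n) :
    σ.cliffOp E e a (T.rTensor (SpinTensor S n) x) =
      T.rTensor (SpinTensor S n) (σ.cliffOp E e a x) := by
  induction x using TensorProduct.induction_on with
  | zero => simp
  | tmul x y => simp [SpinModule.cliffOp]
  | add x y hx hy => simp only [map_add, hx, hy]

variable [T2Space G] {V : Type u} [Quiver.{v} V] {F : Fin n → Arrow (Quiver.FreeGroupoid V)}

/-- For smooth `f` the Leibniz rule reads `D (m f) = m (D f) + m' f` with `m'` continuous on a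
compact space. Hence the bounded map `(x, y) ↦ (M x, M y + C x)` sends the graph over smooth
functions into the graph of `D`, and the same then holds for the closure; this gives both invariance
of the domain and the formula for the commutator. -/
theorem exists_bounded_commutator
    {e : Module.Basis (Fin q) ℝ (GroupLieAlgebra 𝓘(ℝ, EG) G)}
    (he : ∀ i j, B.form (e i) (e j) = if i = j then 1 else 0)
    (hF : IsFreeGenerating.{u, v, w} F) (ν : V) (b : holonomyAlgebra ρ ν) :
    ∃ C : GraphHilbert E S μ n →L[ℂ] GraphHilbert E S μ n, ∀ η : (dirac E μ σ e n).domain,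
      ∃ h : holonomyRep μ hF ρ ν α b η ∈ (dirac E μ σ e n).domain,
        dirac E μ σ e n ⟨holonomyRep μ hF ρ ν α b η, h⟩ -
          holonomyRep μ hF ρ ν α b (dirac E μ σ e n η) = C η := by
  let m : C(Fin n → G, Fiber E S n →L[ℂ] Fiber E S n) :=
    ⟨fun x => matAct α n (b.1 (connectionOf hF x)),
      (continuous_matAct α n).comp (continuous_coord hF ρ b.2)⟩
  let L : Matrix (Fin N) (Fin N) ℂ →ₗ[ℂ] (Fiber E S n →L[ℂ] Fiber E S n) :=
    (matAct (S := S) α n).toAlgHom.toLinearMap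
  have hm' := smoothFun_linearMap_comp (EG := EG)
    (A := Fiber E S n →L[ℂ] Fiber E S n) L
    (f := fun x : Fin n → G => b.1 (connectionOf hF x)) (smoothFun_holonomyAlgebra hF ρ b.2)
  have hm : SmoothFun EG m := hm'
  have hrep : holonomyRep (S := S) μ hF ρ ν α b = mulOp (Measure.pi fun _ : Fin n => μ) m := rfl
  let m' : C(Fin n → G, Fiber E S n →L[ℂ] Fiber E S n) :=
    ⟨fun x => (Complex.I)⁻¹ • ∑ a : Fin n × Fin q,
      (σ.cliffOp E e a).comp (chartDeriv (EG := EG) a.1 (e a.2) m x),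
      Continuous.const_smul (M := ℂ) (g := fun x => ∑ a : Fin n × Fin q,
        (σ.cliffOp E e a).comp (chartDeriv (EG := EG) a.1 (e a.2) m x))
        (continuous_finsetSum _ fun a _ => continuous_const.clm_comp
          (continuous_chartDeriv (EG := EG) a.1 (e a.2) hm)) _⟩
  let C := mulOp (Measure.pi fun _ : Fin n => μ) m'
  let M := mulOp (Measure.pi fun _ : Fin n => μ) m
  let Φ : GraphHilbert E S μ n × GraphHilbert E S μ n →L[ℂ]
      GraphHilbert E S μ n × GraphHilbert E S μ n :=
    (M.comp (ContinuousLinearMap.fst ℂ _ _)).prod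
      (M.comp (ContinuousLinearMap.snd ℂ _ _) + C.comp (ContinuousLinearMap.fst ℂ _ _))
  refine ⟨C, fun η => ?_⟩
  have h1 : (M η, M (dirac E μ σ e n η) + C η) ∈ (dirac E μ σ e n).graph := by
    refine map_mem_graph_of_smooth μ σ ρ he (isClosed_dirac μ σ ρ he) Φ (fun f g hf hg => ?_) η
    let f' : C(Fin n → G, Fiber E S n) := ⟨fun x => m x (f x), by fun_prop⟩
    let g' : C(Fin n → G, Fiber E S n) := ⟨fun x => m x (g x) + m' x (f x), by fun_prop⟩
    have h2 : Φ (toL2 μ f, toL2 μ g) = (toL2 μ f', toL2 μ g') := by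
      refine Prod.ext ?_ ?_
      · exact mulOp_toL2 μ m fun _ => rfl
      · have h3 := mulOp_toL2 μ m (f := g) (g := ⟨fun x => m x (g x), by fun_prop⟩) fun _ => rfl
        have h4 := mulOp_toL2 μ m' (f := f) (g := ⟨fun x => m' x (f x), by fun_prop⟩) fun _ => rfl
        refine (congrArg₂ (· + ·) h3 h4).trans ?_
        rw [← map_add]
        rfl
    rw [h2]
    refine toL2_mem_graph_dirac μ σ (smoothFun_apply hm hf) fun t => ?_
    refine Eq.symm ((diracOf_apply (EG := EG) e hm (fun a x y => cliffOp_rTensor σ e a _ y) hf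
      t).trans ?_)
    rw [← hg]
    rfl
  rw [hrep]
  have h2 := LinearPMap.mem_domain_of_mem_graph h1
  refine ⟨h2, ?_⟩
  rw [← (LinearPMap.image_iff h2).2 h1]
  exact add_sub_cancel_left _ _

end Bounded

/-! ### Faithfulness of the representation of holonomies. -/

section Faithful
variable {EG : Type*} [NormedAddCommGroup EG] [NormedSpace ℝ EG]
  {G : Type w} [TopologicalSpace G] [ChartedSpace EG G] [Group G]
  [IsTopologicalGroup G] [SecondCountableTopology G] [CompactSpace G]
  [MeasurableSpace G] [BorelSpace G]
  (μ : Measure G) [μ.IsOpenPosMeasure] [IsProbabilityMeasure μ]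
  {E : Type*} [NormedAddCommGroup E] [InnerProductSpace ℂ E] [FiniteDimensional ℂ E]
  [CompleteSpace E]
  {S : Type*} [NormedAddCommGroup S] [InnerProductSpace ℂ S] [FiniteDimensional ℂ S]
  {n : ℕ} {N : ℕ} (ρ : FaithfulRep EG G N)
  (α : Matrix (Fin N) (Fin N) ℂ →⋆ₐ[ℂ] (E →L[ℂ] E))

omit [Group G] [IsTopologicalGroup G] in
-- Applied to a constant function `w`, the operator recovers `x ↦ m x w` in `L²`, and continuous
-- functions are determined by their class because the measure has full support.
theorem mulOp_injective {W : Type*} [NormedAddCommGroup W] [InnerProductSpace ℂ W]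
    [CompleteSpace W] : Function.Injective fun m : C(Fin n → G, W →L[ℂ] W) =>
      mulOp (Measure.pi fun _ : Fin n => μ) m := by
  intro m m' h
  ext x w
  have h1 (m : C(Fin n → G, W →L[ℂ] W)) := mulOp_toL2 μ m
    (f := ContinuousMap.const _ w) (g := ⟨fun x => m x w, by fun_prop⟩) fun _ => rfl
  have h2 := ContinuousMap.toLp_injective (p := 2) (𝕜 := ℂ) (Measure.pi fun _ : Fin n => μ)
    ((h1 m).symm.trans ((DFunLike.congr_fun h _).trans (h1 m')))
  exact DFunLike.congr_fun h2 x

theorem matAct_injective [Nontrivial E] {v : S} (hv : ‖v‖ = 1) (n : ℕ) :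
    Function.Injective (matAct (S := S) α n) := by
  have hα : Function.Injective α := by
    -- For `N = 0` the matrix ring is trivial. Otherwise it is simple and acts unitally on the
    -- nonzero space `E`, hence injectively.
    cases N with
    | zero => exact Function.injective_of_subsingleton _
    | succ N => exact RingHom.injective (α : Matrix (Fin (N + 1)) (Fin (N + 1)) ℂ →+* (E →L[ℂ] E))
  intro a a' h
  refine hα (ContinuousLinearMap.ext fun x => ?_)
  let t : SpinTensor S n := SpinTensor.tprod fun _ => v
  have ht : ‖t‖ = 1 := by
    have h1 : inner ℂ t t = (1 : ℂ) := by
      rw [SpinTensor.inner_tprod]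
      simp [inner_self_eq_norm_sq_to_K, hv]
    have h2 : ‖t‖ ^ 2 = 1 := by rw [← inner_self_eq_norm_sq (𝕜 := ℂ), h1, RCLike.one_re]
    exact (pow_eq_one_iff_of_nonneg (norm_nonneg _) two_ne_zero).1 h2
  have h1 : α a x ⊗ₜ[ℂ] t = α a' x ⊗ₜ[ℂ] t := by
    have h2 := DFunLike.congr_fun h (x ⊗ₜ[ℂ] t)
    have h3 (a) : matAct α n a (x ⊗ₜ[ℂ] t) = α a x ⊗ₜ[ℂ] t := by
      change (α a).rTensor (SpinTensor S n) (x ⊗ₜ[ℂ] t) = _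
      simp
    rwa [h3, h3] at h2
  rw [← sub_eq_zero, ← TensorProduct.sub_tmul, ← norm_eq_zero, TensorProduct.norm_tmul, ht,
    mul_one, norm_eq_zero, sub_eq_zero] at h1
  exact h1

/-- Every connection is the one determined by its own coordinates, so a function on connections is
known once it is known on `Gⁿ`. -/
theorem holonomyRep_injective [Nontrivial E] {v : S} (hv : ‖v‖ = 1) {V : Type u} [Quiver.{v} V]
    {F : Fin n → Arrow (Quiver.FreeGroupoid V)} (hF : IsFreeGenerating.{u, v, w} F) (ν : V) :
    Function.Injective (holonomyRep (S := S) μ hF ρ ν α) := by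
  intro b b' h
  have h1 := mulOp_injective μ h
  refine Subtype.ext (funext fun T => ?_)
  let x : Fin n → G := fun k => T.map (F k).hom
  rw [eq_connectionOf hF x T fun _ => rfl]
  exact matAct_injective α hv n (DFunLike.congr_fun h1 x)

end Faithful

/-! ### Extension by constants -/

section Restrict
variable {EG : Type*} [NormedAddCommGroup EG] [NormedSpace ℝ EG]
  {G : Type*} [TopologicalSpace G] [ChartedSpace EG G] [Group G] {n m : ℕ} (h : n ≤ m)
  {W : Type*} [NormedAddCommGroup W] [NormedSpace ℝ W]

/-- Dropping the last `m - n` coordinates. -/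
def restrictCoord (x : Fin m → G) (i : Fin n) : G := x (Fin.castLE h i)

omit [ChartedSpace EG G] [NormedSpace ℝ EG] [NormedAddCommGroup EG] [Group G] in
theorem continuous_restrictCoord : Continuous (restrictCoord h : (Fin m → G) → Fin n → G) :=
  continuous_pi fun _ => continuous_apply _

omit [Group G] in
theorem smoothFun_restrictCoord [IsManifold 𝓘(ℝ, EG) ∞ G] {f : (Fin n → G) → W}
    (hf : SmoothFun EG f) : SmoothFun EG fun x : Fin m → G => f (restrictCoord h x) :=
  hf.comp (contMDiff_pi_mk fun _ => contMDiff_apply_pi _)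

theorem chartDeriv_restrictCoord_castLE (k : Fin n) (v : EG) (f : (Fin n → G) → W)
    (x : Fin m → G) : chartDeriv (Fin.castLE h k) v (fun y => f (restrictCoord h y)) x =
      chartDeriv k v f (restrictCoord h x) := by
  have h1 : expCurve (EG := EG) (Fin.castLE h k) (fun y => f (restrictCoord h y)) x =
      expCurve k f (restrictCoord h x) := by
    funext u
    refine congrArg f (funext fun i => ?_)
    rcases eq_or_ne i k with rfl | hi
    · simp [restrictCoord]
    · simp [restrictCoord, hi]
  rw [chartDeriv, h1, chartDeriv]

theorem chartDeriv_restrictCoord_of_notMem {k : Fin m} (hk : k ∉ Set.range (Fin.castLE h)) (v : EG)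
    (f : (Fin n → G) → W) (x : Fin m → G) :
    chartDeriv k v (fun y => f (restrictCoord h y)) x = 0 := by
  have h1 : expCurve (EG := EG) k (fun y => f (restrictCoord h y)) x =
      fun _ => f (restrictCoord h x) := by
    funext u
    refine congrArg f (funext fun i => ?_)
    have hi : Fin.castLE h i ≠ k := fun hi => hk ⟨i, hi⟩
    simp [restrictCoord, hi]
  rw [chartDeriv, h1]
  simp

/-- Only the derivatives in the first `n` variables survive, and there the map `J` intertwines the
coefficients. -/
theorem diracOf_restrictCoord [LieGroup 𝓘(ℝ, EG) ∞ G] {W W' : Type*} [NormedAddCommGroup W]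
    [InnerProductSpace ℂ W] [NormedAddCommGroup W'] [InnerProductSpace ℂ W'] {q : ℕ}
    (e : Fin q → EG) {c : Fin n × Fin q → W →L[ℂ] W} {c' : Fin m × Fin q → W' →L[ℂ] W'}
    (J : W →L[ℂ] W') (hc : ∀ k i x, c' (Fin.castLE h k, i) (J x) = J (c (k, i) x))
    {f : (Fin n → G) → W} (hf : SmoothFun EG f) (x : Fin m → G) :
    diracOf e c' (fun y => J (f (restrictCoord h y))) x =
      J (diracOf e c f (restrictCoord h x)) := by
  have h1 (a : Fin m × Fin q) : chartDeriv a.1 (e a.2) (fun y => J (f (restrictCoord h y))) x =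
      J (chartDeriv a.1 (e a.2) (fun y => f (restrictCoord h y)) x) :=
    chartDeriv_linear (J.restrictScalars ℝ) a.1 (e a.2) (smoothFun_restrictCoord h hf) x
  simp only [diracOf, h1, map_smul, map_sum, Fintype.sum_prod_type]
  congr 1
  refine (Fintype.sum_of_injective (Fin.castLE h) (Fin.castLE_injective h) _ _
    (fun k hk => Finset.sum_eq_zero fun i _ => ?_) fun k => Finset.sum_congr rfl fun i _ => ?_).symm
  · rw [chartDeriv_restrictCoord_of_notMem h hk, map_zero, map_zero]
  · rw [chartDeriv_restrictCoord_castLE, hc]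

end Restrict

/-! ### The isometry `ι` and the Clifford action. -/

section Iota
variable {EG : Type*} [NormedAddCommGroup EG] [NormedSpace ℝ EG]
  {G : Type*} [TopologicalSpace G] [ChartedSpace EG G] [Group G]
  {E : Type*} [NormedAddCommGroup E] [InnerProductSpace ℂ E]
  {B : InvariantMetric EG G} {q : ℕ}
  {S : Type*} [NormedAddCommGroup S] [InnerProductSpace ℂ S]
  (σ : SpinModule B S) {n m : ℕ} (h : n ≤ m)

/-- Grading operators appear only in factors before the `k`-th, so the vectors appended at the end
are left alone. In particular the cyclic vector need not be homogeneous for the grading. -/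
theorem SpinModule.cliff_padₗ (k : Fin n) (x : GroupLieAlgebra 𝓘(ℝ, EG) G) (s : SpinTensor S n) :
    σ.cliff (Fin.castLE h k) x (SpinTensor.padₗ h σ.vac s) =
      SpinTensor.padₗ h σ.vac (σ.cliff k x s) := by
  have key : σ.cliff (Fin.castLE h k) x ∘ₗ SpinTensor.padₗ h σ.vac =
      SpinTensor.padₗ h σ.vac ∘ₗ σ.cliff k x := by
    refine SpinTensor.linearMap_ext fun s => ?_
    rw [LinearMap.comp_apply, LinearMap.comp_apply, SpinTensor.padₗ_tprod, SpinModule.cliff_tprod,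
      SpinModule.cliff_tprod, SpinTensor.padₗ_tprod]
    congr 1
    funext i
    by_cases hi : (i : ℕ) < n
    · obtain ⟨j, rfl⟩ : ∃ j : Fin n, i = Fin.castLE h j := ⟨⟨i, hi⟩, rfl⟩
      simp
    · have h1 : ¬ i < Fin.castLE h k := fun h1 => hi (lt_trans h1 k.2)
      have h2 : i ≠ Fin.castLE h k := fun h2 => hi (by rw [h2]; exact k.2)
      simp [hi, h1, h2]
  exact LinearMap.congr_fun key s

variable [FiniteDimensional ℂ S]

variable (E) in
/-- The isometry of the fibres. -/
def padFiber : Fiber E S n →ₗᵢ[ℂ] Fiber E S m :=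
  (SpinTensor.pad h σ.vac σ.norm_vac).lTensor E

theorem padFiber_tmul (x : E) (s : SpinTensor S n) :
    padFiber E σ h (x ⊗ₜ s) = x ⊗ₜ SpinTensor.padₗ h σ.vac s := by
  rw [padFiber, LinearIsometry.lTensor_apply]
  rfl

theorem cliffOp_padFiber (e : Fin q → GroupLieAlgebra 𝓘(ℝ, EG) G) (k : Fin n) (i : Fin q)
    (x : Fiber E S n) : σ.cliffOp E e (Fin.castLE h k, i) (padFiber E σ h x) =
      padFiber E σ h (σ.cliffOp E e (k, i) x) := by
  induction x using TensorProduct.induction_on with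
  | zero => simp
  | tmul x s =>
    have h1 {n : ℕ} (a : Fin n × Fin q) (s : SpinTensor S n) :
        σ.cliffOp E e a (x ⊗ₜ s) = x ⊗ₜ σ.cliff a.1 (e a.2) s := by
      simp [SpinModule.cliffOp]
    rw [padFiber_tmul, h1, h1, padFiber_tmul, SpinModule.cliff_padₗ]
  | add x y hx hy => simp only [map_add, hx, hy]

theorem padFiber_matAct [FiniteDimensional ℂ E] [CompleteSpace E] {N : ℕ}
    (α : Matrix (Fin N) (Fin N) ℂ →⋆ₐ[ℂ] (E →L[ℂ] E)) (a : Matrix (Fin N) (Fin N) ℂ)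
    (x : Fiber E S n) : padFiber E σ h (matAct α n a x) = matAct α m a (padFiber E σ h x) := by
  have h1 {n : ℕ} (x : E) (s : SpinTensor S n) : matAct α n a (x ⊗ₜ s) = α a x ⊗ₜ s := by
    change (α a).rTensor (SpinTensor S n) (x ⊗ₜ s) = _
    simp
  induction x using TensorProduct.induction_on with
  | zero => simp
  | tmul x s => rw [padFiber_tmul, h1, h1, padFiber_tmul]
  | add x y hx hy => simp only [map_add, hx, hy]

theorem padFiber_rfl (x : Fiber E S n) : padFiber E σ le_rfl x = x := by
  have h1 : SpinTensor.padₗ (le_refl n) σ.vac = LinearMap.id := by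
    refine SpinTensor.linearMap_ext fun s => ?_
    rw [SpinTensor.padₗ_tprod]
    simp
  induction x using TensorProduct.induction_on with
  | zero => simp
  | tmul x s => rw [padFiber_tmul, h1]; rfl
  | add x y hx hy => simp only [map_add, hx, hy]

theorem padFiber_padFiber {l : ℕ} (h' : m ≤ l) (x : Fiber E S n) :
    padFiber E σ h' (padFiber E σ h x) = padFiber E σ (h.trans h') x := by
  have h1 : SpinTensor.padₗ h' σ.vac ∘ₗ SpinTensor.padₗ h σ.vac =
      SpinTensor.padₗ (h.trans h') σ.vac := by
    refine SpinTensor.linearMap_ext fun s => ?_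
    rw [LinearMap.comp_apply, SpinTensor.padₗ_tprod, SpinTensor.padₗ_tprod, SpinTensor.padₗ_tprod]
    congr 1
    funext i
    by_cases hi : (i : ℕ) < n
    · simp [hi, hi.trans_le h]
    · simp [hi]
  induction x using TensorProduct.induction_on with
  | zero => simp
  | tmul x s => rw [padFiber_tmul, padFiber_tmul, padFiber_tmul, ← h1]; rfl
  | add x y hx hy => simp only [map_add, hx, hy]

variable [SecondCountableTopology G] [CompactSpace G] [MeasurableSpace G] [BorelSpace G]
  (μ : Measure G) [IsProbabilityMeasure μ]

omit [Group G] [TopologicalSpace G] [ChartedSpace EG G] [SecondCountableTopology G]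
  [CompactSpace G] [BorelSpace G] [NormedAddCommGroup EG] [NormedSpace ℝ EG] in
theorem ae_restrictCoord {p : (Fin n → G) → Prop} (hp : ∀ᵐ x ∂(Measure.pi fun _ : Fin n => μ), p x) :
    ∀ᵐ x ∂(Measure.pi fun _ : Fin m => μ), p (restrictCoord h x) :=
  (measurePreserving_restrict μ h).quasiMeasurePreserving.ae hp

omit [SecondCountableTopology G] [CompactSpace G] [BorelSpace G] in
theorem coeFn_mapIota (η : GraphHilbert E S μ n) :
    mapIota E μ σ h η =ᵐ[Measure.pi fun _ : Fin m => μ]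
      fun x => padFiber E σ h (η (restrictCoord h x)) :=
  coeFn_extendConst μ h (padFiber E σ h) η

theorem mapIota_toL2 (f : C(Fin n → G, Fiber E S n)) (f' : C(Fin m → G, Fiber E S m))
    (hf' : ∀ x, f' x = padFiber E σ h (f (restrictCoord h x))) :
    mapIota E μ σ h (toL2 μ f) = toL2 μ f' := by
  refine Lp.ext ?_
  filter_upwards [coeFn_mapIota σ h μ (toL2 μ f), ae_restrictCoord h μ
    (ContinuousMap.coeFn_toLp (p := 2) (𝕜 := ℂ) (Measure.pi fun _ : Fin n => μ) f),
    ContinuousMap.coeFn_toLp (p := 2) (𝕜 := ℂ) (Measure.pi fun _ : Fin m => μ) f'] with x h1 h2 h3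
  rw [h1, h2, h3, hf']

omit [SecondCountableTopology G] [CompactSpace G] [BorelSpace G] in
theorem mapIota_rfl : mapIota E μ σ (le_refl n) = LinearIsometry.id := by
  refine LinearIsometry.ext fun η => Lp.ext ?_
  filter_upwards [coeFn_mapIota σ le_rfl μ η] with x hx
  rw [hx, padFiber_rfl]
  rfl

omit [SecondCountableTopology G] [CompactSpace G] [BorelSpace G] in
theorem mapIota_comp {l : ℕ} (h' : m ≤ l) :
    (mapIota E μ σ h').comp (mapIota E μ σ h) = mapIota E μ σ (h.trans h') := by
  refine LinearIsometry.ext fun η => Lp.ext ?_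
  change mapIota E μ σ h' (mapIota E μ σ h η) =ᵐ[_] _
  filter_upwards [coeFn_mapIota σ h' μ (mapIota E μ σ h η), coeFn_mapIota σ (h.trans h') μ η,
    ae_restrictCoord h' μ (coeFn_mapIota σ h μ η)] with x h1 h2 h3
  rw [h1, h2, h3, padFiber_padFiber]
  rfl

end Iota

/-! ### Functoriality of conjugation by isometries. -/

section Conj
variable {H H' H'' : Type*} [NormedAddCommGroup H] [InnerProductSpace ℂ H] [CompleteSpace H]
  [NormedAddCommGroup H'] [InnerProductSpace ℂ H'] [CompleteSpace H']
  [NormedAddCommGroup H''] [InnerProductSpace ℂ H''] [CompleteSpace H'']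

theorem conjIsometry_apply (ι : H →ₗᵢ[ℂ] H') (a : H →L[ℂ] H) (x : H) :
    conjIsometry ι a (ι x) = ι (a x) := by
  have h : ContinuousLinearMap.adjoint ι.toContinuousLinearMap (ι x) = x :=
    ContinuousLinearMap.ext_iff.1 ((ContinuousLinearMap.norm_map_iff_adjoint_comp_self
      ι.toContinuousLinearMap).1 (fun x => ι.norm_map x)) x
  change ι (a (ContinuousLinearMap.adjoint ι.toContinuousLinearMap (ι x))) = _
  rw [h]

theorem conjIsometry_id : conjIsometry (LinearIsometry.id : H →ₗᵢ[ℂ] H) =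
    NonUnitalStarAlgHom.id ℂ (H →L[ℂ] H) := by
  refine NonUnitalStarAlgHom.ext fun a => ContinuousLinearMap.ext fun x => ?_
  exact conjIsometry_apply LinearIsometry.id a x

theorem conjIsometry_comp (κ : H' →ₗᵢ[ℂ] H'') (ι : H →ₗᵢ[ℂ] H') :
    (conjIsometry κ).comp (conjIsometry ι) = conjIsometry (κ.comp ι) := by
  refine NonUnitalStarAlgHom.ext fun a => ContinuousLinearMap.ext fun x => ?_
  have h : (κ.comp ι).toContinuousLinearMap =
      κ.toContinuousLinearMap ∘L ι.toContinuousLinearMap := rfl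
  change κ (ι (a (ContinuousLinearMap.adjoint ι.toContinuousLinearMap
    (ContinuousLinearMap.adjoint κ.toContinuousLinearMap x)))) =
    κ (ι (a (ContinuousLinearMap.adjoint (κ.comp ι).toContinuousLinearMap x)))
  rw [h, ContinuousLinearMap.adjoint_comp]
  rfl

end Conj


/-! ### The spectral triple of a graph and its morphisms -/

section Main
variable {EG : Type*} [NormedAddCommGroup EG] [NormedSpace ℝ EG]
  {G : Type w} [TopologicalSpace G] [ChartedSpace EG G] [Group G] [LieGroup 𝓘(ℝ, EG) ∞ G]
  [IsTopologicalGroup G] [T2Space G] [SecondCountableTopology G] [CompactSpace G]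
  [MeasurableSpace G] [BorelSpace G]
  (μ : Measure G) [μ.IsHaarMeasure] [IsProbabilityMeasure μ]
  {N : ℕ} (ρ : FaithfulRep EG G N)
  {E : Type*} [NormedAddCommGroup E] [InnerProductSpace ℂ E] [FiniteDimensional ℂ E]
  [CompleteSpace E] (α : Matrix (Fin N) (Fin N) ℂ →⋆ₐ[ℂ] (E →L[ℂ] E))
  {B : InvariantMetric EG G} {q : ℕ} {e : Module.Basis (Fin q) ℝ (GroupLieAlgebra 𝓘(ℝ, EG) G)}
  (he : ∀ i j, B.form (e i) (e j) = if i = j then 1 else 0)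
  {S : Type*} [NormedAddCommGroup S] [InnerProductSpace ℂ S] [FiniteDimensional ℂ S]
  (σ : SpinModule B S) {n m : ℕ}
  {V : Type u} [Quiver.{v} V] {F : Fin n → Arrow (Quiver.FreeGroupoid V)}
  {V' : Type u'} [Quiver.{v'} V'] {F' : Fin m → Arrow (Quiver.FreeGroupoid V')}

include he in
theorem isSpectralTriple_graph [Nontrivial E] (hF : IsFreeGenerating.{u, v, w} F) (ν : V) :
    IsSpectralTriple (holonomyRep (S := S) μ hF ρ ν α) (dirac E μ σ e n) where
  separable := by
    have : Fact ((2 : ENNReal) ≠ ⊤) := ⟨by simp⟩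
    have := Lp.SecondCountableTopology (E := Fiber E S n) (p := 2)
      (μ := Measure.pi fun _ : Fin n => μ)
    infer_instance
  faithful := holonomyRep_injective μ ρ α σ.norm_vac hF ν
  dense_domain := dense_domain_dirac μ E σ n ρ he
  selfAdjoint := isSelfAdjoint_dirac μ E σ n ρ he
  bounded_commutator := exists_bounded_commutator μ σ ρ α he hF ν
  compact_resolvent := exists_compact_resolvent_dirac μ E σ n ρ he

omit [TopologicalSpace G] [ChartedSpace EG G] [LieGroup 𝓘(ℝ, EG) ∞ G] [IsTopologicalGroup G]
  [T2Space G] [SecondCountableTopology G] [CompactSpace G] [MeasurableSpace G] [BorelSpace G]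
  [NormedAddCommGroup EG] [NormedSpace ℝ EG] in
/-- Restriction of connections in terms of coordinates. -/
theorem comp_connectionOf (r : Refinement V V') (h : n ≤ m) (hF : IsFreeGenerating.{u, v, w} F)
    (hF' : IsFreeGenerating.{u', v', w} F')
    (hFF' : ∀ k, F' (Fin.castLE h k) = r.functor.mapArrow.obj (F k)) (x : Fin m → G) :
    r.functor ⋙ connectionOf hF' x = connectionOf hF (restrictCoord h x) := by
  refine eq_connectionOf hF _ _ fun k => ?_
  have h1 := congrArg
    (fun A : Arrow (Quiver.FreeGroupoid V') => (show G from (connectionOf hF' x).map A.hom)) (hFF' k)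
  exact h1.symm.trans (connectionOf_map hF' x (Fin.castLE h k))

omit [CompleteSpace E] in
include ρ he in
-- On smooth functions `ι` commutes with the differential operators exactly; applying `ι` to both
-- components of the graph is bounded, so the relation passes to the closure.
theorem mapIota_mem_graph_dirac (h : n ≤ m) (η : (dirac E μ σ e n).domain) :
    (mapIota E μ σ h η, mapIota E μ σ h (dirac E μ σ e n η)) ∈ (dirac E μ σ e m).graph := by
  let ι := (mapIota E μ σ h).toContinuousLinearMap
  refine map_mem_graph_of_smooth μ σ ρ he (isClosed_dirac μ σ ρ he) (ι.prodMap ι)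
    (fun f g hf hg => ?_) η
  let J := (padFiber E σ h).toContinuousLinearMap
  let f' : C(Fin m → G, Fiber E S m) := ⟨fun x => J (f (restrictCoord h x)),
    J.continuous.comp (f.continuous.comp (continuous_restrictCoord h))⟩
  let g' : C(Fin m → G, Fiber E S m) := ⟨fun x => J (g (restrictCoord h x)),
    J.continuous.comp (g.continuous.comp (continuous_restrictCoord h))⟩
  have h1 : ι.prodMap ι (toL2 μ f, toL2 μ g) = (toL2 μ f', toL2 μ g') :=
    Prod.ext (mapIota_toL2 σ h μ f f' fun _ => rfl) (mapIota_toL2 σ h μ g g' fun _ => rfl)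
  rw [h1]
  refine toL2_mem_graph_dirac μ σ ?_ fun t => ?_
  · exact (contMDiff_iff_contDiff.2 (J.restrictScalars ℝ).contDiff).comp
      (smoothFun_restrictCoord h hf)
  · refine Eq.trans ?_ (diracOf_restrictCoord (EG := EG) h e J
      (fun k i x => cliffOp_padFiber σ h e k i x) hf t).symm
    exact congrArg J (hg _)

omit [LieGroup 𝓘(ℝ, EG) ∞ G] [T2Space G] [μ.IsHaarMeasure] in
theorem coeFn_holonomyRep (hF : IsFreeGenerating.{u, v, w} F) (ν : V) (b : holonomyAlgebra ρ ν)
    (η : GraphHilbert E S μ n) :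
    holonomyRep μ hF ρ ν α b η =ᵐ[Measure.pi fun _ : Fin n => μ]
      fun x => matAct α n (b.1 (connectionOf hF x)) (η x) := coeFn_mulOp _ _ _

omit [LieGroup 𝓘(ℝ, EG) ∞ G] [T2Space G] [μ.IsHaarMeasure] in
-- In coordinates, restriction of connections is dropping the last variables (`comp_connectionOf`),
-- which is also how `ι` extends functions; on fibres the matrices do not touch the appended
-- spinors.
theorem holonomyRep_mapIota (r : Refinement V V') {ν : V} {ν' : V'}
    (hν : r.functor.obj ((Quiver.FreeGroupoid.of V).obj ν) = (Quiver.FreeGroupoid.of V').obj ν')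
    (h : n ≤ m) (hF : IsFreeGenerating.{u, v, w} F) (hF' : IsFreeGenerating.{u', v', w} F')
    (hFF' : ∀ k, F' (Fin.castLE h k) = r.functor.mapArrow.obj (F k))
    (b : holonomyAlgebra ρ ν) (η : GraphHilbert E S μ n) :
    holonomyRep μ hF' ρ ν' α (mapQ ρ r hν b) (mapIota E μ σ h η) =
      mapIota E μ σ h (holonomyRep μ hF ρ ν α b η) := by
  refine Lp.ext ?_
  filter_upwards [coeFn_holonomyRep μ ρ α hF' ν' (mapQ ρ r hν b) (mapIota E μ σ h η), coeFn_mapIota σ h μ η,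
    coeFn_mapIota σ h μ (holonomyRep μ hF ρ ν α b η), ae_restrictCoord h μ (coeFn_holonomyRep μ ρ α hF ν b η)]
    with x h2 h3 h4 h5
  rw [h2, h3, h4, h5, padFiber_matAct, ← comp_connectionOf r h hF hF' hFF' x]
  rfl

include he in
theorem isTripleMorphism_refinement (r : Refinement V V') {ν : V} {ν' : V'}
    (hν : r.functor.obj ((Quiver.FreeGroupoid.of V).obj ν) = (Quiver.FreeGroupoid.of V').obj ν')
    (h : n ≤ m) (hF : IsFreeGenerating.{u, v, w} F) (hF' : IsFreeGenerating.{u', v', w} F')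
    (hFF' : ∀ k, F' (Fin.castLE h k) = r.functor.mapArrow.obj (F k)) :
    IsTripleMorphism (holonomyRep (S := S) μ hF ρ ν α) (dirac E μ σ e n)
      (holonomyRep (S := S) μ hF' ρ ν' α) (dirac E μ σ e m)
      (mapQ ρ r hν) (conjIsometry (mapIota E μ σ h)) (mapIota E μ σ h) where
  dirac η := by
    have h1 := mapIota_mem_graph_dirac μ ρ he σ h η
    have h2 := LinearPMap.mem_domain_of_mem_graph h1
    exact ⟨h2, ((LinearPMap.image_iff h2).2 h1).symm⟩
  operators a η := conjIsometry_apply _ a η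
  algebra b η := holonomyRep_mapIota μ ρ α σ r hν h hF hF' hFF' b η

end Main
end GraphTriple
end

open GraphTriple
theorem mainTheorem12
    {EG : Type uM} [NormedAddCommGroup EG] [NormedSpace ℝ EG] [FiniteDimensional ℝ EG]
    {G : Type w} [TopologicalSpace G] [ChartedSpace EG G] [Group G] [LieGroup 𝓘(ℝ, EG) ∞ G]
    [IsTopologicalGroup G] [T2Space G] [SecondCountableTopology G] [CompactSpace G]
    [MeasurableSpace G] [BorelSpace G]
    (μ : Measure G) [μ.IsHaarMeasure] [IsProbabilityMeasure μ]
    {N : ℕ} (ρ : FaithfulRep EG G N)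
    {E : Type uE} [NormedAddCommGroup E] [InnerProductSpace ℂ E] [FiniteDimensional ℂ E]
    [CompleteSpace E] [Nontrivial E] (α : Matrix (Fin N) (Fin N) ℂ →⋆ₐ[ℂ] (E →L[ℂ] E))
    (B : InvariantMetric EG G) {q : ℕ} (e : Module.Basis (Fin q) ℝ (GroupLieAlgebra 𝓘(ℝ, EG) G))
    (he : ∀ i j, B.form (e i) (e j) = if i = j then 1 else 0)
    {S : Type uS} [NormedAddCommGroup S] [InnerProductSpace ℂ S] [FiniteDimensional ℂ S]
    (σ : SpinModule B S) :
    (∀ (V : Type u) [Quiver.{v} V] (V' : Type u') [Quiver.{v'} V'] (r : Refinement V V')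
      (ν : V) (ν' : V')
      (hν : r.functor.obj ((Quiver.FreeGroupoid.of V).obj ν) =
        (Quiver.FreeGroupoid.of V').obj ν')
      (n m : ℕ) (h : n ≤ m)
      (F : Fin n → Arrow (Quiver.FreeGroupoid V)) (hF : IsFreeGenerating.{u, v, w} F)
      (F' : Fin m → Arrow (Quiver.FreeGroupoid V')) (hF' : IsFreeGenerating.{u', v', w} F')
      (_ : ∀ k, F' (Fin.castLE h k) = r.functor.mapArrow.obj (F k)),
      IsSpectralTriple (holonomyRep (S := S) μ hF ρ ν α) (dirac E μ σ e n) ∧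
      IsSpectralTriple (holonomyRep (S := S) μ hF' ρ ν' α) (dirac E μ σ e m) ∧
      IsTripleMorphism (holonomyRep (S := S) μ hF ρ ν α) (dirac E μ σ e n)
        (holonomyRep (S := S) μ hF' ρ ν' α) (dirac E μ σ e m)
        (mapQ ρ r hν) (conjIsometry (mapIota E μ σ h)) (mapIota E μ σ h)) ∧
    (∀ (V : ℕ → Type u) [∀ i, Quiver.{v} (V i)] (r : ∀ i j, i ≤ j → Refinement (V i) (V j))
      (_ : ∀ i, (r i i le_rfl).functor = 𝟭 _)
      (_ : ∀ i j k (hij : i ≤ j) (hjk : j ≤ k),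
        (r i j hij).functor ⋙ (r j k hjk).functor = (r i k (hij.trans hjk)).functor)
      (ν : ∀ i, V i)
      (hν : ∀ i j (hij : i ≤ j), (r i j hij).functor.obj ((Quiver.FreeGroupoid.of (V i)).obj (ν i)) =
        (Quiver.FreeGroupoid.of (V j)).obj (ν j))
      (n : ℕ → ℕ) (hn : ∀ i j, i ≤ j → n i ≤ n j)
      (F : ∀ i, Fin (n i) → Arrow (Quiver.FreeGroupoid (V i)))
      (hF : ∀ i, IsFreeGenerating.{u, v, w} (F i))
      (_ : ∀ i j (hij : i ≤ j) k,
        F j (Fin.castLE (hn i j hij) k) = (r i j hij).functor.mapArrow.obj (F i k)),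
      IsInductiveSystem
        (fun i => holonomyRep (S := S) μ (hF i) ρ (ν i) α)
        (fun i => dirac E μ σ e (n i))
        (fun i j hij => mapQ ρ (r i j hij) (hν i j hij))
        (fun i j hij => conjIsometry (mapIota E μ σ (hn i j hij)))
        (fun i j hij => mapIota E μ σ (hn i j hij))) := by
  refine ⟨fun V _ V' _ r ν ν' hν n m h F hF F' hF' hFF' =>
    ⟨isSpectralTriple_graph μ ρ α he σ hF ν, isSpectralTriple_graph μ ρ α he σ hF' ν',
      isTripleMorphism_refinement μ ρ α he σ r hν h hF hF' hFF'⟩,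
    fun V _ r hr_refl hr_comp ν hν n hn F hF hFF => ?_⟩
  exact
    { triple := fun i => isSpectralTriple_graph μ ρ α he σ (hF i) (ν i)
      morphism := fun i j hij => isTripleMorphism_refinement μ ρ α he σ (r i j hij) (hν i j hij)
        (hn i j hij) (hF i) (hF j) (hFF i j hij)
      algebra_refl := fun i => by
        refine StarAlgHom.ext fun b => Subtype.ext (funext fun T => ?_)
        -- `mapQ` depends on the refinement only through its induced functor, so an equality of
        -- functors suffices.
        exact congrArg (fun Φ => b.1 (Φ ⋙ T)) (hr_refl i)
      operators_refl := fun i => by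
        rw [mapIota_rfl, conjIsometry_id]
      isometry_refl := fun i => mapIota_rfl σ μ
      algebra_comp := fun i j k hij hjk => by
        refine StarAlgHom.ext fun b => Subtype.ext (funext fun T => ?_)
        exact congrArg (fun Φ => b.1 (Φ ⋙ T)) (hr_comp i j k hij hjk)
      operators_comp := fun i j k hij hjk => by
        rw [conjIsometry_comp, mapIota_comp]
      isometry_comp := fun i j k hij hjk => mapIota_comp σ (hn i j hij) μ (hn j k hjk) }
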